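/- Let $M^n$, $n\ge 3$, be a connected smooth manifold with a smooth Riemannian metric $g$. A point is isotropic if all tangent 2-planes at it have the same sectional curvature; let $C$ be the set of isotropic points. On an open set $V$ the metric is globally 1-QC if there are a smooth line field $\xi$ on $V$ and angles $\theta(p)\in(0,\pi/2)$ such that, for every $p\in V$, the sectional curvature is constant on the cone of 2-planes at $p$ that make the angle $\theta(p)$ with $\xi_p$. It is locally 1-QC on an open set if each point of that set has a globally 1-QC open neighbourhood in it, and $g$ is 1-QC if every non-isotropic point of $M$ has a locally 1-QC open neighbourhood. At $p\in M\setminus C$ call a line $\ell\subset T_pM$ distinguished if, for some $\theta\in(0,\pi/2)$, the sectional curvature is constant on the cone of 2-planes making the angle $\theta$ with $\ell$. Proposition. Let $g$ be 1-QC and, when $n=3$, locally conformally flat. Then there are functions $H,N:M\to\mathbb R$ such that at each $p\in M\setminus C$, $H(p)$ is the sectional curvature of every 2-plane orthogonal to a distinguished line and $N(p)$ that of every 2-plane containing it, while at $p\in C$ both are equal to the common value of the sectional curvatures. Suppose that $M$ is compact or, more generally, that $H$ is bounded below; put $\kappa=1-\inf_M H$ if $\inf_M H\le 0$, and $\kappa=0$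 if $\inf_M H>0$. Let $\mathbb H^{n+1}_\kappa$ be the hyperbolic space of constant curvature $-\kappa$ if $\kappa>0$ and the Euclidean space $\mathbb R^{n+1}$ if $\kappa=0$. Let $\pi:\widetilde M\to M$ be the universal covering, with the metric $\pi^*g$. Then there are a smooth isometric immersion $f:\widetilde M\to\mathbb H^{n+1}_\kappa$ and a group homomorphism $\rho:\pi_1(M)\to \mathrm{Isom}(\mathbb H^{n+1}_\kappa)$ with $$f(\gamma\cdot x)=\rho(\gamma)\cdot f(x),\qquad x\in\widetilde M,\ \gamma\in\pi_1(M),$$ where $\pi_1(M)$ acts on $\widetilde M$ by deck transformations. Here $\mathrm{Isom}(\mathbb H^{n+1}_\kappa)$ is the group $O^+(n+1,1)$ of the linear Lorentz transformations that preserve the future cone if $\kappa>0$, and the group of Euclidean isometries if $\kappa=0$; if $M$ is orientable, $\rho$ takes values in the orientation preserving isometries (so in $SO(n+1,1)$ if $\kappa>0$). Moreover, for a suitable smooth unit normal field along $f$, the second fundamental form of $f$ is the pull-back to $\widetilde M$ of the tensor $$h(X,Y)=\begin{cases}\sqrt{H+\kappa}\;g(X,Y)+\dfrac{N-H}{\sqrt{H+\kappa}}\;g(\widehat\xi,X)\,g(\widehat\xi,Y)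 & \text{on } M\setminus C,\\[2mm] \sqrt{H+\kappa}\;g(X,Y) & \text{on } C,\end{cases}$$ where $\widehat\xi$ is a unit vector in the distinguished line. -/

import Mathlib

open scoped Manifold ContDiff

noncomputable section

namespace OneQC

/-- The Euclidean inner product. -/
def euclid {m : ℕ} (x y : EuclideanSpace ℝ (Fin m)) : ℝ := inner ℝ x y

/-! ### Riemannian metrics, curvature in charts -/

section Riemannian

variable {n : ℕ} {M : Type*} [TopologicalSpace M] [ChartedSpace (EuclideanSpace ℝ (Fin n)) M]
  [IsManifold (𝓡 n) ∞ M]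

/-- Smooth Riemannian metrics on the `n`-manifold `M`. -/
abbrev SmoothMetric (n : ℕ) (M : Type*) [TopologicalSpace M]
    [ChartedSpace (EuclideanSpace ℝ (Fin n)) M] [IsManifold (𝓡 n) ∞ M] :=
  Bundle.ContMDiffRiemannianMetric (𝓡 n) ∞ (EuclideanSpace ℝ (Fin n))
    (fun x : M => TangentSpace (𝓡 n) x)

/-- The coordinate vector `∂ᵢ` of the preferred chart at `p`, at the point with coordinates `y`. -/
def coordVector (p : M) (y : EuclideanSpace ℝ (Fin n)) (i : Fin n) :
    TangentSpace (𝓡 n) ((extChartAt (𝓡 n) p).symm y) :=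
  mfderiv 𝓘(ℝ, EuclideanSpace ℝ (Fin n)) (𝓡 n) (extChartAt (𝓡 n) p).symm y
    (EuclideanSpace.single i (1 : ℝ))

/-- The matrix `g_{ij}` of the metric in the preferred chart at `p`. -/
def metricMatrix (g : SmoothMetric n M) (p : M) (y : EuclideanSpace ℝ (Fin n)) :
    Matrix (Fin n) (Fin n) ℝ :=
  Matrix.of fun i j =>
    g.inner ((extChartAt (𝓡 n) p).symm y) (coordVector p y i) (coordVector p y j)

/-- The partial derivative `∂ᵢ F` of a function on `ℝⁿ`. -/
def partialDeriv (i : Fin n) (F : EuclideanSpace ℝ (Fin n) → ℝ)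
    (y : EuclideanSpace ℝ (Fin n)) : ℝ :=
  fderiv ℝ F y (EuclideanSpace.single i (1 : ℝ))

/-- The Christoffel symbol `Γᵏᵢⱼ` of the Levi-Civita connection in the preferred chart at `p`. -/
def christoffel (g : SmoothMetric n M) (p : M) (k i j : Fin n)
    (y : EuclideanSpace ℝ (Fin n)) : ℝ :=
  (1 / 2 : ℝ) * ∑ l, (metricMatrix g p y)⁻¹ k l *
    (partialDeriv i (fun z => metricMatrix g p z j l) y
      + partialDeriv j (fun z => metricMatrix g p z i l) y
      - partialDeriv l (fun z => metricMatrix g p z i j) y)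

/-- The components `Rˡᵢⱼₖ` of the curvature tensor in the preferred chart at `p`, with the
convention `R(∂ᵢ, ∂ⱼ)∂ₖ = ∇ᵢ∇ⱼ∂ₖ - ∇ⱼ∇ᵢ∂ₖ = Rˡᵢⱼₖ ∂ₗ`. -/
def riemannComponent (g : SmoothMetric n M) (p : M) (l i j k : Fin n)
    (y : EuclideanSpace ℝ (Fin n)) : ℝ :=
  partialDeriv i (christoffel g p l j k) y - partialDeriv j (christoffel g p l i k) y
    + ∑ m, (christoffel g p l i m y * christoffel g p m j k y
      - christoffel g p l j m y * christoffel g p m i k y)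

/-- The coordinates of a tangent vector at `p` in the preferred chart at `p`. -/
def coords (p : M) (u : TangentSpace (𝓡 n) p) : EuclideanSpace ℝ (Fin n) :=
  mfderiv (𝓡 n) 𝓘(ℝ, EuclideanSpace ℝ (Fin n)) (extChartAt (𝓡 n) p) p u

/-- `g(R(u, v)w, z)` at the point `p`. -/
def curvatureForm (g : SmoothMetric n M) (p : M) (u v w z : TangentSpace (𝓡 n) p) : ℝ :=
  ∑ i, ∑ j, ∑ k, ∑ l, ∑ m,
    riemannComponent g p l i j k (extChartAt (𝓡 n) p p)
      * metricMatrix g p (extChartAt (𝓡 n) p p) l m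
      * coords p u i * coords p v j * coords p w k * coords p z m

/-- The sectional curvature of the plane spanned by `u` and `v`. -/
def sectionalCurvature (g : SmoothMetric n M) (p : M) (u v : TangentSpace (𝓡 n) p) : ℝ :=
  curvatureForm g p u v v u / (g.inner p u u * g.inner p v v - g.inner p u v ^ 2)

/-- `(u, v)` is an orthonormal basis of a tangent 2-plane at `p`. -/
def IsOrthonormalPair (g : SmoothMetric n M) (p : M) (u v : TangentSpace (𝓡 n) p) : Prop :=
  g.inner p u u = 1 ∧ g.inner p v v = 1 ∧ g.inner p u v = 0

/-- All tangent 2-planes at `p` have the same sectional curvature. -/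
def IsIsotropic (g : SmoothMetric n M) (p : M) : Prop :=
  ∀ u v u' v' : TangentSpace (𝓡 n) p, IsOrthonormalPair g p u v → IsOrthonormalPair g p u' v' →
    sectionalCurvature g p u v = sectionalCurvature g p u' v'

/-- The metric is locally conformal to the Euclidean one. -/
def IsConformallyFlat (g : SmoothMetric n M) : Prop :=
  ∀ p : M, ∃ e ∈ IsManifold.maximalAtlas (𝓡 n) ∞ M, p ∈ e.source ∧
    ∃ c : M → ℝ, ∀ q ∈ e.source, 0 < c q ∧ ∀ v w : TangentSpace (𝓡 n) q,
      g.inner q v w = c q * euclid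
        (mfderiv (𝓡 n) 𝓘(ℝ, EuclideanSpace ℝ (Fin n)) e q v)
        (mfderiv (𝓡 n) 𝓘(ℝ, EuclideanSpace ℝ (Fin n)) e q w)

/-- There is an atlas of compatible smooth charts with orientation preserving transition maps. -/
def IsOrientable (n : ℕ) (M : Type*) [TopologicalSpace M]
    [ChartedSpace (EuclideanSpace ℝ (Fin n)) M] : Prop :=
  ∃ A ⊆ IsManifold.maximalAtlas (𝓡 n) ∞ M, (∀ p : M, ∃ e ∈ A, p ∈ e.source) ∧
    ∀ e ∈ A, ∀ e' ∈ A, ∀ y ∈ (e.symm.trans e').source,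
      0 < (fderiv ℝ (fun z => e' (e.symm z)) y).det

/-! ### `1`-QC metrics -/

/-- The sectional curvature is constant along the cone of the tangent 2-planes at `p` that make
the angle `θ` with the line spanned by the unit vector `ξ`: the cosine of the angle between a
line and a plane is the length of the orthogonal projection to the plane of a unit vector
spanning the line. -/
def ConstantOnCone (g : SmoothMetric n M) (p : M) (ξ : TangentSpace (𝓡 n) p) (θ : ℝ) : Prop :=
  ∀ u v u' v' : TangentSpace (𝓡 n) p, IsOrthonormalPair g p u v → IsOrthonormalPair g p u' v' →
    g.inner p ξ u ^ 2 + g.inner p ξ v ^ 2 = Real.cos θ ^ 2 →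
    g.inner p ξ u' ^ 2 + g.inner p ξ v' ^ 2 = Real.cos θ ^ 2 →
    sectionalCurvature g p u v = sectionalCurvature g p u' v'

/-- `L` restricts to a smooth line field on `U`: it is locally spanned by a nowhere zero smooth
vector field. -/
def IsLineFieldOn (U : Set M) (L : ∀ p : M, Submodule ℝ (TangentSpace (𝓡 n) p)) : Prop :=
  ∀ p ∈ U, ∃ V : Set M, IsOpen V ∧ p ∈ V ∧ V ⊆ U ∧ ∃ X : ∀ q : M, TangentSpace (𝓡 n) q,
    ContMDiffOn (𝓡 n) (𝓡 n).tangent ∞ (fun q => (⟨q, X q⟩ : TangentBundle (𝓡 n) M)) V ∧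
      ∀ q ∈ V, X q ≠ 0 ∧ L q = Submodule.span ℝ {X q}

/-- The restriction of the metric to the open set `U` is globally `1`-QC. -/
def IsGloballyOneQCOn (g : SmoothMetric n M) (U : Set M) : Prop :=
  ∃ L : ∀ p : M, Submodule ℝ (TangentSpace (𝓡 n) p), IsLineFieldOn U L ∧
    ∃ θ : M → ℝ, ∀ p ∈ U, θ p ∈ Set.Ioo 0 (Real.pi / 2) ∧
      ∀ ξ ∈ L p, g.inner p ξ ξ = 1 → ConstantOnCone g p ξ (θ p)

/-- The restriction of the metric to the open set `U` is locally `1`-QC. -/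
def IsLocallyOneQCOn (g : SmoothMetric n M) (U : Set M) : Prop :=
  ∀ p ∈ U, ∃ V : Set M, IsOpen V ∧ p ∈ V ∧ V ⊆ U ∧ IsGloballyOneQCOn g V

/-- The metric is `1`-QC: every non-isotropic point has a locally `1`-QC open neighbourhood. -/
def IsOneQC (g : SmoothMetric n M) : Prop :=
  ∀ p : M, ¬ IsIsotropic g p → ∃ U : Set M, IsOpen U ∧ p ∈ U ∧ IsLocallyOneQCOn g U

/-- `ξ` is a unit vector spanning a distinguished line at `p`. -/
def IsDistinguished (g : SmoothMetric n M) (p : M) (ξ : TangentSpace (𝓡 n) p) : Prop :=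
  g.inner p ξ ξ = 1 ∧ ∃ θ ∈ Set.Ioo 0 (Real.pi / 2), ConstantOnCone g p ξ θ

/-- `H` and `N` are the horizontal and the vertical curvature function: at a non-isotropic
point, `H` is the sectional curvature of every 2-plane orthogonal to the distinguished line and
`N` that of every 2-plane containing it; at an isotropic point both are the common value of the
sectional curvatures. -/
def AreCurvatureFunctions (g : SmoothMetric n M) (H N : M → ℝ) : Prop :=
  ∀ p : M,
    (IsIsotropic g p → ∀ u v : TangentSpace (𝓡 n) p, IsOrthonormalPair g p u v →
      sectionalCurvature g p u v = H p ∧ sectionalCurvature g p u v = N p) ∧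
    (¬ IsIsotropic g p → ∀ ξ : TangentSpace (𝓡 n) p, IsDistinguished g p ξ →
      (∀ u v : TangentSpace (𝓡 n) p, IsOrthonormalPair g p u v →
        g.inner p ξ u = 0 → g.inner p ξ v = 0 → sectionalCurvature g p u v = H p) ∧
      (∀ u : TangentSpace (𝓡 n) p, IsOrthonormalPair g p ξ u →
        sectionalCurvature g p ξ u = N p))

end Riemannian

/-! ### Space forms of curvature `-κ` and their isometries -/

/-- Minkowski space `ℝ^{m,1}`. -/
abbrev Minkowski (m : ℕ) := EuclideanSpace ℝ (Fin m) × ℝ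

/-- The Lorentzian inner product, of signature `(m, 1)`. -/
def lorentz {m : ℕ} (x y : Minkowski m) : ℝ := inner ℝ x.1 y.1 - x.2 * y.2

/-- The hyperbolic space of dimension `m` and curvature `-κ`, for `κ > 0`, as the upper sheet of
a hyperboloid. Its metric is the restriction of `lorentz` to tangent vectors. -/
def hyperbolicSpace (κ : ℝ) (m : ℕ) : Set (Minkowski m) :=
  {x | lorentz x x = -1 / κ ∧ 0 < x.2}

/-- The group `O⁺(m, 1)` of the linear isometries of Minkowski space that preserve the future
cone. It is the isometry group of `hyperbolicSpace κ m`. -/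
def lorentzGroup (m : ℕ) : Subgroup (Minkowski m ≃ₗ[ℝ] Minkowski m) where
  carrier := {A | (∀ x y, lorentz (A x) (A y) = lorentz x y) ∧
    ∀ x, lorentz x x < 0 → 0 < x.2 → 0 < (A x).2}
  mul_mem' := by
    rintro A B ⟨hA, hA'⟩ ⟨hB, hB'⟩
    refine ⟨fun x y => ?_, fun x hx h => ?_⟩
    · rw [LinearEquiv.mul_apply, LinearEquiv.mul_apply, hA, hB]
    · rw [LinearEquiv.mul_apply]
      exact hA' _ (by rw [hB]; exact hx) (hB' x hx h)
  one_mem' := ⟨fun _ _ => rfl, fun _ _ h => h⟩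
  inv_mem' := by
    rintro A ⟨hA, hA'⟩
    have key : ∀ x, A (A⁻¹ x) = x := fun x => A.apply_symm_apply x
    have hinv : ∀ x y, lorentz (A⁻¹ x) (A⁻¹ y) = lorentz x y := fun x y => by
      rw [← hA, key, key]
    refine ⟨hinv, fun x hx h => ?_⟩
    by_contra hneg
    have h1 : lorentz (A⁻¹ x) (A⁻¹ x) < 0 := by rw [hinv]; exact hx
    have h2 : (A⁻¹ x).2 ≠ 0 := by
      intro h0
      have : lorentz (A⁻¹ x) (A⁻¹ x) = inner ℝ (A⁻¹ x).1 (A⁻¹ x).1 := by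
        unfold lorentz
        rw [h0]
        ring
      rw [this] at h1
      exact absurd h1 (not_lt.mpr real_inner_self_nonneg)
    have h3 : 0 < (-(A⁻¹ x)).2 := by
      have := lt_of_le_of_ne (not_lt.mp hneg) h2
      simpa using this
    have h4 : lorentz (-(A⁻¹ x)) (-(A⁻¹ x)) < 0 := by
      simpa [lorentz] using h1
    have h5 := hA' _ h4 h3
    rw [map_neg, key] at h5
    have : 0 < -x.2 := h5
    linarith

/-! ### Immersed hypersurfaces of a space form -/

section Immersions

variable {n : ℕ} {M : Type*} [TopologicalSpace M] [ChartedSpace (EuclideanSpace ℝ (Fin n)) M]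
  [IsManifold (𝓡 n) ∞ M]
  {Mt : Type*} [TopologicalSpace Mt] [ChartedSpace (EuclideanSpace ℝ (Fin n)) Mt]
  {V : Type*} [NormedAddCommGroup V] [NormedSpace ℝ V]

/-- The differential of a map with values in a vector space. -/
def differential (f : Mt → V) (x : Mt) (v : TangentSpace (𝓡 n) x) : V :=
  mfderiv (𝓡 n) 𝓘(ℝ, V) f x v

/-- The metric on the covering `π : Mt → M` induced by the metric `g` of `M`. -/
def pullbackMetric (g : SmoothMetric n M) (π : Mt → M) (x : Mt) (v w : TangentSpace (𝓡 n) x) : ℝ :=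
  g.inner (π x) (mfderiv (𝓡 n) (𝓡 n) π x v) (mfderiv (𝓡 n) (𝓡 n) π x w)

/-- `f` is a smooth map which carries the metric of the covering to the (constant) inner product
`B` of the vector space `V`. As the former is positive definite, `f` is an immersion. -/
def IsIsometricImmersion (g : SmoothMetric n M) (π : Mt → M) (B : V → V → ℝ) (f : Mt → V) : Prop :=
  ContMDiff (𝓡 n) 𝓘(ℝ, V) ∞ f ∧ ∀ (x : Mt) (v w : TangentSpace (𝓡 n) x),
    B (differential f x v) (differential f x w) = pullbackMetric g π x v w

/-- `ν` is a smooth field of `B`-unit vectors orthogonal to the image of the differential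
of `f`. -/
def IsUnitNormal (n : ℕ) {Mt : Type*} [TopologicalSpace Mt]
    [ChartedSpace (EuclideanSpace ℝ (Fin n)) Mt] (B : V → V → ℝ) (f ν : Mt → V) : Prop :=
  ContMDiff (𝓡 n) 𝓘(ℝ, V) ∞ ν ∧ (∀ x, B (ν x) (ν x) = 1) ∧
    ∀ (x : Mt) (v : TangentSpace (𝓡 n) x), B (ν x) (differential f x v) = 0

/-- The second fundamental form of `f` with respect to the unit normal field `ν`. When `f` takes
values in a hyperboloid and `ν` is tangent to the hyperboloid, this is the second fundamental form
of `f` as a map to the hyperboloid. -/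
def secondFundamentalForm (B : V → V → ℝ) (f ν : Mt → V) (x : Mt)
    (v w : TangentSpace (𝓡 n) x) : ℝ :=
  - B (differential ν x v) (differential f x w)

/-- The symmetric tensor `h` on the covering is equal to
`√(H + κ) g + (N - H) / √(H + κ) · g(ξ, ·) g(ξ, ·)` over the non-isotropic points of `M`, where
`ξ` is any unit vector in the distinguished line, and equal to `√(H + κ) g` over the isotropic
points. -/
def HasOneQCForm (g : SmoothMetric n M) (π : Mt → M) (H N : M → ℝ) (κ : ℝ)
    (h : ∀ x : Mt, TangentSpace (𝓡 n) x → TangentSpace (𝓡 n) x → ℝ) : Prop :=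
  ∀ (x : Mt) (v w : TangentSpace (𝓡 n) x),
    (IsIsotropic g (π x) → h x v w = √(H (π x) + κ) * pullbackMetric g π x v w) ∧
    (¬ IsIsotropic g (π x) → ∀ ξ : TangentSpace (𝓡 n) (π x), IsDistinguished g (π x) ξ →
      h x v w = √(H (π x) + κ) * pullbackMetric g π x v w
        + (N (π x) - H (π x)) / √(H (π x) + κ)
          * (g.inner (π x) ξ (mfderiv (𝓡 n) (𝓡 n) π x v)
            * g.inner (π x) ξ (mfderiv (𝓡 n) (𝓡 n) π x w)))

end Immersions

/-! ### Deck transformations -/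

/-- `φ` is the deck transformation of the universal covering `π` given by the class `γ` of
loops at `π x₀`. In `FundamentalGroup` the product `γ * δ` runs first through `δ`, then through
`γ`; so, in order that `γ ↦ φ` be a homomorphism, `φ x₀` is the starting point of the lift of `γ`
that ends at `x₀`. -/
def IsDeckTransformationOf {M Mt : Type*} [TopologicalSpace M] [TopologicalSpace Mt] (π : C(Mt, M))
    (x₀ : Mt) (γ : FundamentalGroup M (π x₀)) (φ : Mt ≃ₜ Mt) : Prop :=
  ∃ hφ : ∀ x, π (φ x) = π x, ∃ c : Path (φ x₀) x₀,
    γ = FundamentalGroup.fromPath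
      (Path.Homotopic.Quotient.mk ((c.map π.continuous).cast (hφ x₀).symm rfl))

end OneQC

end

/-!
The second fundamental form of the immersion sought is prescribed by the curvature of `g`, and the
proof is Bonnet's: the prescribed form satisfies the equations of Gauss and Codazzi, and these are
the integrability conditions of the linear system for the moving frame of a hypersurface.

*The curvature tensor.* If the sectional curvature is constant on the cone of planes that make a
fixed angle in `(0, π / 2)` with `ξ`, then the curvature tensor is the Kulkarni-Nomizu product of
the metric with `S = (H / 2) g + (N - H) g(ξ, ·) ⊗ g(ξ, ·)` (`ConstantOnCone.exists_eq_kulkarni`).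
At an isotropic point this holds for any unit vector `ξ`, with `N = H`. Hence there are `H`, `N` and
a unit vector `ξ` at each point with this property, although nothing is known about their regularity
(`IsOneQC.exists_isQCField`). The Kulkarni-Nomizu product determines `S`: it is the Schouten tensor,
which is smooth (`IsLeviCivitaOn.eq_schouten`). It satisfies the Codazzi equation, for `n ≥ 4` by
the second Bianchi identity (`IsLeviCivitaOn.isCodazziAt`), for `n = 3` because this is what
conformal flatness means (`isCodazziAt_conformalSchouten`).

*Regularity across the isotropic points.* At these points `ξ` may be discontinuous, so it is not
clear that `H` and `N` are smooth there. The trace-free part of `S` is `(N - H)` times a tensor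
whose invariants are constant, and so its invariants of degree two and three show that the square
and the cube of `N - H` are smooth. By the theorem of Joris, `N - H` is itself smooth
(`contDiffOn_of_sq_of_cube`, `IsQCOn.contDiffOn_curvatures`). The proof of that theorem is direct:
the Taylor series of the square and of the cube along a line are the square and the cube of one
power series, whose coefficients are bounded uniformly over all lines
(`CoeffBounded.of_sq_of_cube`); this bounds the iterated differences of the function, hence its Fourier transform
(`contDiff_of_fwdDiff_bound`). Now `h = λ g + ((N - H) / λ) g(ξ, ·) ⊗ g(ξ, ·)`, where
`λ = √(H + κ) > 0`, is smooth, since it is a combination of `g` and `S` with smooth coefficients.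

*The equations of Gauss and Codazzi.* The Gauss equation for `h` is algebraic (`IsQCOn.gauss`). As
`h` is `(1 / λ) S` up to a multiple of `g`, the Codazzi equation for `S` yields that for `h` once
`H` is known to be constant in the directions orthogonal to `ξ` where `N ≠ H`; this, too, follows
from the Codazzi equation for `S` (`IsQCOn.fderiv_horizontal`, `IsQCOn.isCodazziAt_secondForm`).
Where `N = H`, the term that involves the derivative of `H` is absent.

*Bonnet's theorem.* The jet `(F, dF, ν)` of a hypersurface solves a linear total differential
equation which is completely integrable by the equations of Gauss and Codazzi
(`IsQCOn.isIntegrableAt_bonnetSystem`, `exists_ball_solvesAt`). Its germs of solutions form a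
covering of `M`, so a solution lives on the simply connected covering of `M` (`exists_isFlatOver`).
The Gram matrix of the frame of a solution obeys a homogeneous linear equation once the expected
matrix is subtracted; if it is the expected one at `x₀`, it is so everywhere
(`IsFlatOver.isAdapted`). This says that `F` is an isometric immersion into the space form and that
`ν` is a unit normal field.

*Equivariance.* A solution moved by a deck transformation is again a solution, and two solutions
with the expected Gram matrix differ by an isometry of the space form (`IsFlatOver.exists_act`).
That isometry is unique because the frame spans the ambient space, so it depends homomorphically on
the deck transformation (`exists_monoidHom_of_act`). If `M` is orientable, the sign of the
determinant of the frame, in positive charts, is constant, so that the isometry preserves the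
orientation (`IsFlatOver.det_pos`).
-/

noncomputable section

set_option maxSynthPendingDepth 3

namespace OneQC

/-! ### Functions whose square and cube are smooth -/

open PowerSeries in
/-- A family of power series is coefficientwise bounded if the coefficients of each fixed degree
are bounded uniformly over the family. -/
def CoeffBounded {ι : Type*} (f : ι → ℝ⟦X⟧) : Prop :=
  ∀ j, ∃ C : ℝ, ∀ i, |coeff j (f i)| ≤ C

namespace CoeffBounded
open PowerSeries
variable {ι : Type*} {f g : ι → ℝ⟦X⟧}

lemma sub (hf : CoeffBounded f) (hg : CoeffBounded g) : CoeffBounded (fun i => f i - g i) := by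
  intro j
  obtain ⟨C, hC⟩ := hf j
  obtain ⟨D, hD⟩ := hg j
  refine ⟨C + D, fun i => ?_⟩
  rw [map_sub]
  exact (abs_sub _ _).trans (add_le_add (hC i) (hD i))

lemma mul (hf : CoeffBounded f) (hg : CoeffBounded g) : CoeffBounded (fun i => f i * g i) := by
  intro j
  choose C hC using hf
  choose D hD using hg
  refine ⟨∑ p ∈ Finset.HasAntidiagonal.antidiagonal j, C p.1 * D p.2, fun i => ?_⟩
  rw [coeff_mul]
  refine (Finset.abs_sum_le_sum_abs _ _).trans (Finset.sum_le_sum fun p _ => ?_)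
  rw [abs_mul]
  exact mul_le_mul (hC _ i) (hD _ i) (abs_nonneg _) ((abs_nonneg _).trans (hC _ i))

lemma const {c : ι → ℝ} {A : ℝ} (hc : ∀ i, |c i| ≤ A) :
    CoeffBounded (fun i => C (c i)) := by
  intro j
  refine ⟨max A 0, fun i => ?_⟩
  rw [coeff_C]
  split_ifs
  · exact (hc i).trans (le_max_left _ _)
  · simp

lemma pow_add_two (h2 : CoeffBounded fun i => f i ^ 2) (h3 : CoeffBounded fun i => f i ^ 3)
    (r : ℕ) : CoeffBounded fun i => f i ^ (r + 2) := by
  induction r using Nat.strong_induction_on with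
  | _ r ih =>
    match r with
    | 0 => exact h2
    | 1 => exact h3
    | r + 2 =>
      have := (ih r (by omega)).mul h2
      convert this using 2 with i
      ring

lemma constantCoeff_of_sq (h2 : CoeffBounded fun i => f i ^ 2) :
    ∃ A : ℝ, 0 ≤ A ∧ ∀ i, |coeff 0 (f i)| ≤ A := by
  obtain ⟨B, hB⟩ := h2 0
  refine ⟨max B 1, le_trans zero_le_one (le_max_right _ _), fun i => ?_⟩
  have := hB i
  simp only [coeff_zero_eq_constantCoeff, map_pow, abs_pow] at this ⊢
  by_contra hcon
  push Not at hcon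
  have h1 := (max_lt_iff.mp hcon)
  nlinarith

/-- The rescaling `t ↦ a t`, where `a ^ M` is the constant coefficient, makes the coefficients
bounded: the lowest coefficient of `f ^ 2 * (f - s) ^ k`, for a truncation `s` of `f`, is
`f₀ ^ 2 * f_j ^ k`, and all powers `f ^ r` with `r ≥ 2` are bounded. -/
lemma scaled_coeff (h2 : CoeffBounded fun i => f i ^ 2) (h3 : CoeffBounded fun i => f i ^ 3)
    {M : ℕ} (hM : 0 < M) {a : ι → ℝ} {A : ℝ} (ha : ∀ i, 0 ≤ a i) (haA : ∀ i, a i ≤ A)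
    (haM : ∀ i, a i ^ M = |coeff 0 (f i)|) (j : ℕ) :
    ∃ B : ℝ, ∀ i, a i ^ j * |coeff j (f i)| ≤ B := by
  induction j using Nat.strong_induction_on with
  | _ j ih =>
    rcases j with _ | j
    · obtain ⟨A, -, hA⟩ := constantCoeff_of_sq h2
      exact ⟨A, fun i => by simpa using hA i⟩
    let u : ι → ℝ⟦X⟧ := fun i => C (a i ^ j)
    let s : ι → ℝ⟦X⟧ := fun i => C (a i ^ j) * (trunc (j + 1) (f i) : Polynomial ℝ)
    have hu : CoeffBounded u := const (A := A ^ j) fun i => by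
      rw [abs_of_nonneg (pow_nonneg (ha i) _)]
      exact pow_le_pow_left₀ (ha i) (haA i) _
    have hs : CoeffBounded s := by
      intro l
      by_cases hl : l < j + 1
      · obtain ⟨B, hB⟩ := ih l hl
        refine ⟨A ^ (j - l) * B, fun i => ?_⟩
        simp only [s, coeff_C_mul, Polynomial.coeff_coe, coeff_trunc, if_pos hl]
        rw [abs_mul, abs_of_nonneg (pow_nonneg (ha i) _),
          show a i ^ j = a i ^ (j - l) * a i ^ l by rw [← pow_add]; congr 1; omega, mul_assoc]
        exact mul_le_mul (pow_le_pow_left₀ (ha i) (haA i) _) (hB i)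
          (mul_nonneg (pow_nonneg (ha i) _) (abs_nonneg _))
          (pow_nonneg ((ha i).trans (haA i)) _)
      · refine ⟨0, fun i => ?_⟩
        simp only [s, coeff_C_mul, Polynomial.coeff_coe, coeff_trunc, if_neg hl, mul_zero,
          abs_zero, le_refl]
    have key : ∀ k r : ℕ, CoeffBounded fun i => f i ^ (r + 2) * (u i * f i - s i) ^ k := by
      intro k
      induction k with
      | zero => intro r; simpa using pow_add_two h2 h3 r
      | succ k ihk =>
        intro r
        have := (hu.mul (ihk (r + 1))).sub ((ihk r).mul hs)
        convert this using 2 with i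
        ring
    have hw : ∀ i, u i * f i - s i
        = X ^ (j + 1) * (C (a i ^ j) * mk fun n => coeff (n + (j + 1)) (f i)) := by
      intro i
      ext l
      simp only [u, s, ← mul_sub, coeff_C_mul, map_sub, Polynomial.coeff_coe, coeff_trunc]
      rw [mul_left_comm, coeff_C_mul, coeff_X_pow_mul']
      by_cases hl : l < j + 1
      · simp [hl, not_le.mpr hl]
      · simp [hl, not_lt.mp hl]
    obtain ⟨B, hB⟩ := key (2 * M) 0 ((j + 1) * (2 * M))
    refine ⟨max B 1, fun i => ?_⟩
    have h1 := hB i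
    simp only [zero_add] at h1
    rw [hw i, mul_pow, ← pow_mul, mul_left_comm (f i ^ 2), coeff_X_pow_mul', if_pos le_rfl,
      Nat.sub_self,
      coeff_zero_eq_constantCoeff, map_mul, map_pow, map_pow, map_mul] at h1
    simp only [constantCoeff_C, constantCoeff_mk, zero_add, ← coeff_zero_eq_constantCoeff] at h1
    rw [abs_mul, abs_pow, abs_pow, ← haM i, abs_mul, abs_of_nonneg (pow_nonneg (ha i) _)] at h1
    have h2' : (a i ^ (j + 1) * |coeff (j + 1) (f i)|) ^ (2 * M) ≤ B := by
      convert h1 using 1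
      rw [mul_pow, mul_pow, pow_succ, mul_pow]
      ring
    by_contra hcon
    push Not at hcon
    have h3' := max_lt_iff.mp hcon
    have h4 := le_self_pow₀ h3'.2.le (n := 2 * M) (by omega)
    linarith

lemma constantCoeff_mul_coeff (h2 : CoeffBounded fun i => f i ^ 2)
    (h3 : CoeffBounded fun i => f i ^ 3) (M : ℕ) :
    ∃ B : ℝ, ∀ i, |coeff 0 (f i) * coeff M (f i)| ≤ B := by
  obtain ⟨A, hA0, hA⟩ := constantCoeff_of_sq h2
  rcases Nat.eq_zero_or_pos M with rfl | hM
  · exact ⟨A * A, fun i => by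
      rw [abs_mul]; exact mul_le_mul (hA i) (hA i) (abs_nonneg _) hA0⟩
  have hM' : (M : ℝ) ≠ 0 := by exact_mod_cast hM.ne'
  obtain ⟨B, hB⟩ := scaled_coeff h2 h3 hM (a := fun i => |coeff 0 (f i)| ^ (M : ℝ)⁻¹)
    (A := A ^ (M : ℝ)⁻¹)
    (fun i => Real.rpow_nonneg (abs_nonneg _) _)
    (fun i => Real.rpow_le_rpow (abs_nonneg _) (hA i) (by positivity))
    (fun i => Real.rpow_inv_natCast_pow (abs_nonneg _) hM.ne') M
  refine ⟨B, fun i => ?_⟩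
  have := hB i
  rwa [Real.rpow_inv_natCast_pow (abs_nonneg _) hM.ne', ← abs_mul] at this

/-- A family of power series whose squares and cubes are coefficientwise bounded is
coefficientwise bounded. -/
theorem of_sq_of_cube (h2 : CoeffBounded fun i => f i ^ 2)
    (h3 : CoeffBounded fun i => f i ^ 3) : CoeffBounded f := by
  intro m
  induction m generalizing f with
  | zero =>
    obtain ⟨A, -, hA⟩ := constantCoeff_of_sq h2
    exact ⟨A, hA⟩
  | succ m ih =>
    let t : ι → ℝ⟦X⟧ := fun i => mk fun n => coeff (n + 1) (f i)
    have hft : ∀ i, f i = X * t i + C (coeff 0 (f i)) := fun i => by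
      rw [coeff_zero_eq_constantCoeff]; exact eq_X_mul_shift_add_const (f i)
    have ht : ∀ i n, coeff n (t i) = coeff (n + 1) (f i) := fun i n => coeff_mk _ _
    have e2 : ∀ i n, coeff n (t i ^ 2)
        = coeff (n + 2) (f i ^ 2) - 2 * (coeff 0 (f i) * coeff (n + 2) (f i)) := by
      intro i n
      have : f i ^ 2 = X ^ 2 * t i ^ 2 + C (2 * coeff 0 (f i)) * (X * t i)
          + C (coeff 0 (f i) ^ 2) := by
        conv_lhs => rw [hft i]
        simp only [map_mul, map_pow, map_ofNat]
        ring
      rw [this, map_add, map_add, coeff_X_pow_mul, coeff_C_mul, coeff_succ_X_mul, ht, coeff_C]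
      simp
      ring
    have e3 : ∀ i n, coeff n (t i ^ 3) = coeff (n + 3) (f i ^ 3)
        - 3 * (coeff 0 (f i) * coeff (n + 1) (t i ^ 2))
        - 3 * (coeff 0 (f i) * (coeff 0 (f i) * coeff (n + 3) (f i))) := by
      intro i n
      have : f i ^ 3 = X ^ 3 * t i ^ 3 + C (3 * coeff 0 (f i)) * (X ^ 2 * t i ^ 2)
          + C (3 * coeff 0 (f i) ^ 2) * (X * t i) + C (coeff 0 (f i) ^ 3) := by
        conv_lhs => rw [hft i]
        simp only [map_mul, map_pow, map_ofNat]
        ring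
      rw [this, map_add, map_add, map_add, coeff_X_pow_mul, coeff_C_mul,
        show n + 3 = (n + 1) + 2 from rfl, coeff_X_pow_mul, coeff_C_mul,
        show n + 1 + 2 = (n + 2) + 1 from rfl, coeff_succ_X_mul, ht, coeff_C]
      simp
      ring
    obtain ⟨A, hA0, hA⟩ := constantCoeff_of_sq h2
    have t2 : CoeffBounded fun i => t i ^ 2 := by
      intro n
      obtain ⟨B, hB⟩ := h2 (n + 2)
      obtain ⟨D, hD⟩ := constantCoeff_mul_coeff h2 h3 (n + 2)
      refine ⟨B + 2 * D, fun i => ?_⟩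
      rw [e2]
      refine (abs_sub _ _).trans (add_le_add (hB i) ?_)
      rw [abs_mul, abs_two]
      exact mul_le_mul_of_nonneg_left (hD i) zero_le_two
    have t3 : CoeffBounded fun i => t i ^ 3 := by
      intro n
      obtain ⟨B, hB⟩ := h3 (n + 3)
      obtain ⟨D, hD⟩ := constantCoeff_mul_coeff h2 h3 (n + 3)
      obtain ⟨K, hK⟩ := t2 (n + 1)
      refine ⟨B + 3 * (A * K) + 3 * (A * D), fun i => ?_⟩
      rw [e3]
      have h3p : |(3 : ℝ)| = 3 := abs_of_pos (by norm_num)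
      refine (abs_sub _ _).trans (add_le_add ((abs_sub _ _).trans (add_le_add (hB i) ?_)) ?_)
      · rw [abs_mul, h3p, abs_mul]
        exact mul_le_mul_of_nonneg_left (mul_le_mul (hA i) (hK i) (abs_nonneg _) hA0)
          (by norm_num)
      · rw [abs_mul, h3p, abs_mul]
        exact mul_le_mul_of_nonneg_left (mul_le_mul (hA i) (hD i) (abs_nonneg _) hA0)
          (by norm_num)
    obtain ⟨B, hB⟩ := ih t2 t3
    exact ⟨B, fun i => by rw [← ht]; exact hB i⟩

end CoeffBounded

open PowerSeries in
/-- Unique factorization: a power series whose cube is a square has a square root, whose cube is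
the other series. -/
lemma exists_sq_and_cube_eq {p q : ℝ⟦X⟧} (h : p ^ 3 = q ^ 2) :
    ∃ f : ℝ⟦X⟧, f ^ 2 = p ∧ f ^ 3 = q := by
  by_cases hp : p = 0
  · subst hp
    have : q = 0 := by
      rw [zero_pow three_ne_zero] at h
      exact pow_eq_zero_iff two_ne_zero |>.mp h.symm
    exact ⟨0, by simp, by simp [this]⟩
  have hdvd : p ^ 2 ∣ q ^ 2 := ⟨p, by rw [← h]; ring⟩
  rw [IsIntegrallyClosed.pow_dvd_pow_iff two_ne_zero] at hdvd
  obtain ⟨f, rfl⟩ := hdvd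
  have hf : f ^ 2 = p := by
    have : p ^ 2 * (f ^ 2) = p ^ 2 * p := by rw [← mul_pow, ← h]; ring
    exact mul_left_cancel₀ (pow_ne_zero 2 hp) this
  exact ⟨f, hf, by rw [pow_succ, hf]⟩

lemma abs_sub_taylor_le {N : ℕ} {g : ℝ → ℝ} {C : ℝ} (hg : ContDiff ℝ ∞ g)
    (hC : ∀ t, |iteratedDeriv N g t| ≤ C) {t : ℝ} (ht : 0 ≤ t) :
    |g t - ∑ k ∈ Finset.range N, iteratedDeriv k g 0 / k.factorial * t ^ k| ≤ C * t ^ N := by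
  have hC0 : 0 ≤ C := (abs_nonneg _).trans (hC 0)
  induction N generalizing g t with
  | zero => simpa using hC t
  | succ N ih =>
    have hg' : ContDiff ℝ ∞ (deriv g) := (contDiff_infty_iff_deriv.mp hg).2
    have hdiff : Differentiable ℝ g := hg.differentiable (by simp)
    let R : ℝ → ℝ := fun s =>
      g s - ∑ k ∈ Finset.range (N + 1), iteratedDeriv k g 0 / k.factorial * s ^ k
    have hR : ∀ s, HasDerivAt R (deriv g s -
        ∑ k ∈ Finset.range N, iteratedDeriv k (deriv g) 0 / k.factorial * s ^ k) s := by
      intro s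
      refine (hdiff s).hasDerivAt.sub ?_
      have h1 : HasDerivAt (fun s : ℝ => ∑ k ∈ Finset.range (N + 1),
          iteratedDeriv k g 0 / k.factorial * s ^ k)
          (∑ k ∈ Finset.range (N + 1),
            iteratedDeriv k g 0 / k.factorial * ((k : ℝ) * s ^ (k - 1))) s :=
        HasDerivAt.fun_sum fun k _ => (hasDerivAt_pow k s).const_mul _
      refine h1.congr_deriv ?_
      rw [Finset.sum_range_succ']
      simp only [Nat.cast_zero, zero_mul, mul_zero, add_zero]
      refine Finset.sum_congr rfl fun k _ => ?_
      rw [iteratedDeriv_succ', Nat.factorial_succ, Nat.cast_mul, Nat.add_sub_cancel]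
      have : ((k : ℝ) + 1) ≠ 0 := by positivity
      have : (k.factorial : ℝ) ≠ 0 := by positivity
      push_cast
      field_simp
    have hb : ∀ s ∈ Set.Icc 0 t, ‖deriv g s -
        ∑ k ∈ Finset.range N, iteratedDeriv k (deriv g) 0 / k.factorial * s ^ k‖ ≤ C * t ^ N := by
      intro s hs
      refine (ih hg' (fun r => ?_) hs.1).trans ?_
      · rw [← iteratedDeriv_succ']; exact hC r
      · exact mul_le_mul_of_nonneg_left (pow_le_pow_left₀ hs.1 hs.2 _) hC0
    have := (convex_Icc 0 t).norm_image_sub_le_of_norm_hasDerivWithin_le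
      (fun s _ => (hR s).hasDerivWithinAt) hb (Set.left_mem_Icc.mpr ht) (Set.right_mem_Icc.mpr ht)
    have hR0 : R 0 = 0 := by
      simp only [R]
      rw [Finset.sum_range_succ']
      simp
    rw [hR0, sub_zero, sub_zero, Real.norm_eq_abs, Real.norm_eq_abs, abs_of_nonneg ht] at this
    refine this.trans_eq ?_
    ring

open PowerSeries in
/-- The Taylor series at `0` of a function of one variable. -/
def taylorSeries (g : ℝ → ℝ) : ℝ⟦X⟧ :=
  PowerSeries.mk fun k => iteratedDeriv k g 0 / k.factorial

lemma taylorSeries_mul {g h : ℝ → ℝ} (hg : ContDiff ℝ ∞ g) (hh : ContDiff ℝ ∞ h) :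
    taylorSeries (g * h) = taylorSeries g * taylorSeries h := by
  ext k
  rw [PowerSeries.coeff_mul, Finset.Nat.sum_antidiagonal_eq_sum_range_succ_mk]
  simp only [taylorSeries, PowerSeries.coeff_mk]
  rw [iteratedDeriv_mul (hg.of_le (mod_cast le_top)).contDiffAt
    (hh.of_le (mod_cast le_top)).contDiffAt, Finset.sum_div]
  refine Finset.sum_congr rfl fun i hi => ?_
  rw [Nat.cast_choose ℝ (Nat.lt_succ_iff.mp (Finset.mem_range.mp hi))]
  have : (k.factorial : ℝ) ≠ 0 := by positivity
  field_simp

section Joris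

variable {E : Type*} [NormedAddCommGroup E] [NormedSpace ℝ E]

lemma iteratedDeriv_along_line {p : E → ℝ} (hp : ContDiff ℝ ∞ p) (x v : E) (k : ℕ) (t : ℝ) :
    iteratedDeriv k (fun s : ℝ => p (x + s • v)) t
      = iteratedFDeriv ℝ k p (x + t • v) (fun _ => v) := by
  have hq : ContDiff ℝ ∞ (fun y => p (x + y)) := hp.comp (contDiff_const.add contDiff_id)
  have := (ContinuousLinearMap.toSpanSingleton ℝ v).iteratedFDeriv_comp_right hq t
    (i := k) (mod_cast le_top)
  rw [iteratedDeriv_eq_iteratedFDeriv]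
  rw [show (fun s : ℝ => p (x + s • v))
    = (fun y => p (x + y)) ∘ (ContinuousLinearMap.toSpanSingleton ℝ v) from rfl, this]
  rw [iteratedFDeriv_comp_add_left]
  simp

lemma exists_bound_iteratedDeriv {p : E → ℝ} (hp : ContDiff ℝ ∞ p) (hc : HasCompactSupport p)
    (k : ℕ) : ∃ C : ℝ, ∀ x v : E, ‖v‖ ≤ 1 → ∀ t,
      |iteratedDeriv k (fun s : ℝ => p (x + s • v)) t| ≤ C := by
  obtain ⟨C, hC⟩ := Continuous.bounded_above_of_compact_support
    (hp.continuous_iteratedFDeriv (m := k) (mod_cast le_top)) (hc.iteratedFDeriv k)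
  refine ⟨C, fun x v hv t => ?_⟩
  rw [iteratedDeriv_along_line hp]
  refine ((iteratedFDeriv ℝ k p (x + t • v)).le_opNorm _).trans ?_
  rw [Finset.prod_const]
  calc _ ≤ ‖iteratedFDeriv ℝ k p (x + t • v)‖ * 1 :=
        mul_le_mul_of_nonneg_left (pow_le_one₀ (norm_nonneg _) hv) (norm_nonneg _)
    _ ≤ C := by rw [mul_one]; exact hC _

lemma abs_sub_pow_three_le (a b : ℝ) : |a - b| ^ 3 ≤ 4 * |a ^ 3 - b ^ 3| := by
  have h1 : a ^ 3 - b ^ 3 = (a - b) * (a ^ 2 + a * b + b ^ 2) := by ring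
  have h2 : (a - b) ^ 2 ≤ 4 * (a ^ 2 + a * b + b ^ 2) := by nlinarith [sq_nonneg (a + b)]
  have h3 : 0 ≤ a ^ 2 + a * b + b ^ 2 := by nlinarith [sq_nonneg (a - b)]
  rw [h1, abs_mul, abs_of_nonneg h3, pow_succ', sq_abs]
  nlinarith [abs_nonneg (a - b)]

open PowerSeries in
/-- Uniform Taylor expansions along lines of a function whose square and cube are smooth: the
formal square root of the Taylor series of the square has uniformly bounded coefficients, and
its truncation approximates the function to any order. -/
lemma exists_uniform_expansion {f : E → ℝ} (hc : HasCompactSupport f)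
    (h2 : ContDiff ℝ ∞ fun x => f x ^ 2) (h3 : ContDiff ℝ ∞ fun x => f x ^ 3) (m : ℕ)
    {T : ℝ} (hT : 1 ≤ T) :
    ∃ C : ℝ, ∀ x v : E, ‖v‖ ≤ 1 → ∃ P : Polynomial ℝ, P.natDegree < 3 * m + 1 ∧
      (∀ j, |P.coeff j| ≤ C) ∧
      ∀ t ∈ Set.Icc 0 T, |f (x + t • v) - P.eval t| ≤ C * t ^ m := by
  let ι := {i : E × E // ‖i.2‖ ≤ 1}
  let g : ι → ℝ → ℝ := fun i s => f (i.1.1 + s • i.1.2)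
  have hline : ∀ i : ι, ContDiff ℝ ∞ (fun s : ℝ => i.1.1 + s • i.1.2) := fun i => by fun_prop
  have g2 : ∀ i, ContDiff ℝ ∞ (g i ^ 2) := fun i => h2.comp (hline i)
  have g3 : ∀ i, ContDiff ℝ ∞ (g i ^ 3) := fun i => h3.comp (hline i)
  have hc2 : HasCompactSupport fun x => f x ^ 2 := hc.comp_left (g := fun y : ℝ => y ^ 2) (by simp)
  have hc3 : HasCompactSupport fun x => f x ^ 3 := hc.comp_left (g := fun y : ℝ => y ^ 3) (by simp)
  have hex : ∀ i, ∃ F : ℝ⟦X⟧, F ^ 2 = taylorSeries (g i ^ 2) ∧ F ^ 3 = taylorSeries (g i ^ 3) := by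
    intro i
    apply exists_sq_and_cube_eq
    rw [pow_succ, pow_two (taylorSeries _), pow_two (taylorSeries _),
      ← taylorSeries_mul (g2 i) (g2 i),
      ← taylorSeries_mul (show ContDiff ℝ ∞ (g i ^ 2 * g i ^ 2) from (g2 i).mul (g2 i)) (g2 i),
      ← taylorSeries_mul (g3 i) (g3 i)]
    congr 1
    ring
  choose F hF2 hF3 using hex
  have hbd : ∀ p : E → ℝ, ContDiff ℝ ∞ p → HasCompactSupport p →
      CoeffBounded fun i : ι => taylorSeries fun s => p (i.1.1 + s • i.1.2) := by
    intro p hp hpc j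
    obtain ⟨C, hC⟩ := exists_bound_iteratedDeriv hp hpc j
    refine ⟨C, fun i => ?_⟩
    simp only [taylorSeries, coeff_mk]
    rw [abs_div, Nat.abs_cast]
    refine (div_le_self (abs_nonneg _) ?_).trans (hC _ _ i.2 _)
    exact_mod_cast Nat.one_le_iff_ne_zero.mpr (Nat.factorial_ne_zero j)
  have b2 := hbd _ h2 hc2
  have b3 := hbd _ h3 hc3
  have hF : CoeffBounded F := by
    apply CoeffBounded.of_sq_of_cube
    · rw [funext hF2]; exact b2
    · rw [funext hF3]; exact b3
  set N := 3 * m + 1 with hN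
  have hT0 : 0 ≤ T := zero_le_one.trans hT
  -- the truncation and its cube
  let P : ι → Polynomial ℝ := fun i => trunc N (F i)
  have hP : CoeffBounded fun i => (P i : ℝ⟦X⟧) := by
    intro j
    obtain ⟨C, hC⟩ := hF j
    refine ⟨max C 0, fun i => ?_⟩
    simp only [P, Polynomial.coeff_coe, coeff_trunc]
    split_ifs
    · exact (hC i).trans (le_max_left _ _)
    · simp
  have hP3 : CoeffBounded fun i => ((P i ^ 3 : Polynomial ℝ) : ℝ⟦X⟧) := by
    have := (hP.mul hP).mul hP
    convert this using 2 with i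
    rw [Polynomial.coe_pow]; ring
  have hPdeg : ∀ i, (P i).natDegree < N := fun i => natDegree_trunc_lt _ _
  have hcoef : ∀ i k, k < N → (P i ^ 3).coeff k = coeff k (taylorSeries (g i ^ 3)) := by
    intro i k hk
    rw [← hF3, ← Polynomial.coeff_coe, Polynomial.coe_pow]
    have := congrArg (fun p : Polynomial ℝ => p.coeff k) (trunc_trunc_pow (F i) N 3)
    rw [coeff_trunc, coeff_trunc, if_pos hk, if_pos hk] at this
    exact this
  obtain ⟨C3, hC3⟩ := exists_bound_iteratedDeriv h3 hc3 N
  choose D hD using hP3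
  choose B hB using hP
  have hex : ∃ K : ℝ, 0 ≤ K ∧ ∀ i : ι, ∀ t ∈ Set.Icc 0 T,
      |g i t ^ 3 - (P i).eval t ^ 3| ≤ K * t ^ (3 * m) := by
    refine ⟨|C3| * T + ∑ k ∈ Finset.range (3 * N), |D k| * T ^ k, by positivity, ?_⟩
    intro i t ht
    have e1 : |g i t ^ 3 - ∑ k ∈ Finset.range N, (P i ^ 3).coeff k * t ^ k|
        ≤ |C3| * T * t ^ (3 * m) := by
      have := abs_sub_taylor_le (N := N) (g3 i) (C := C3) (fun s => hC3 _ _ i.2 s) ht.1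
      have h' : ∑ k ∈ Finset.range N, (P i ^ 3).coeff k * t ^ k
          = ∑ k ∈ Finset.range N, iteratedDeriv k (g i ^ 3) 0 / k.factorial * t ^ k := by
        refine Finset.sum_congr rfl fun k hk => ?_
        rw [hcoef i k (Finset.mem_range.mp hk), taylorSeries, coeff_mk]
      rw [h']
      refine this.trans ?_
      rw [hN, pow_succ, mul_assoc, mul_comm T]
      exact mul_le_mul (le_abs_self _)
        (mul_le_mul_of_nonneg_left ht.2 (pow_nonneg ht.1 _))
        (mul_nonneg (pow_nonneg ht.1 _) ht.1) (abs_nonneg _)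
    have e2 : (P i).eval t ^ 3 = ∑ k ∈ Finset.range N, (P i ^ 3).coeff k * t ^ k
        + ∑ k ∈ Finset.Ico N (3 * N), (P i ^ 3).coeff k * t ^ k := by
      rw [← Polynomial.eval_pow, Finset.sum_range_add_sum_Ico _ (by omega : N ≤ 3 * N)]
      apply Polynomial.eval_eq_sum_range'
      have := hPdeg i
      exact lt_of_le_of_lt Polynomial.natDegree_pow_le (by omega)
    have e3 : |∑ k ∈ Finset.Ico N (3 * N), (P i ^ 3).coeff k * t ^ k|
        ≤ (∑ k ∈ Finset.range (3 * N), |D k| * T ^ k) * t ^ (3 * m) := by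
      rw [Finset.sum_mul]
      refine (Finset.abs_sum_le_sum_abs _ _).trans ?_
      refine (Finset.sum_le_sum (g := fun k => |D k| * T ^ k * t ^ (3 * m)) fun k hk => ?_).trans
        (Finset.sum_le_sum_of_subset_of_nonneg (fun k hk => ?_) fun k _ _ => ?_)
      · have hk' := Finset.mem_Ico.mp hk
        rw [abs_mul, abs_of_nonneg (pow_nonneg ht.1 k),
          show k = (k - 3 * m) + 3 * m by omega, pow_add, ← mul_assoc,
          ← show k = (k - 3 * m) + 3 * m by omega]
        refine mul_le_mul_of_nonneg_right (mul_le_mul ?_ ?_ (pow_nonneg ht.1 _) (abs_nonneg _))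
          (pow_nonneg ht.1 _)
        · rw [← Polynomial.coeff_coe]; exact (hD k i).trans (le_abs_self _)
        · exact (pow_le_pow_left₀ ht.1 ht.2 _).trans (pow_le_pow_right₀ hT (by omega))
      · exact Finset.mem_range.mpr (Finset.mem_Ico.mp hk).2
      · have := ht.1; positivity
    rw [e2, ← sub_sub, add_mul]
    exact (abs_sub _ _).trans (add_le_add e1 e3)
  obtain ⟨K, hK0, hK⟩ := hex
  refine ⟨(4 * K + 1) + ∑ j ∈ Finset.range N, |B j|,
    fun x v hv => ⟨P ⟨(x, v), hv⟩, hPdeg _, ?_, ?_⟩⟩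
  · intro j
    by_cases hj : j < N
    · rw [← Polynomial.coeff_coe]
      refine (hB j _).trans ((le_abs_self _).trans ?_)
      have := Finset.single_le_sum (f := fun j => |B j|) (fun i _ => abs_nonneg _)
        (Finset.mem_range.mpr hj)
      linarith
    · rw [Polynomial.coeff_eq_zero_of_natDegree_lt (lt_of_lt_of_le (hPdeg _) (not_lt.mp hj)),
        abs_zero]
      have := Finset.sum_nonneg (f := fun j => |B j|) (s := Finset.range N) fun i _ => abs_nonneg _
      linarith
  · intro t ht
    have h1 := hK ⟨(x, v), hv⟩ t ht
    have h0 := abs_sub_pow_three_le (f (x + t • v)) ((P ⟨(x, v), hv⟩).eval t)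
    have hS := Finset.sum_nonneg (f := fun j => |B j|) (s := Finset.range N) fun i _ => abs_nonneg _
    have h4 : |f (x + t • v) - (P ⟨(x, v), hv⟩).eval t| ^ 3 ≤ ((4 * K + 1) * t ^ m) ^ 3 := by
      calc _ ≤ 4 * (K * t ^ (3 * m)) := h0.trans (mul_le_mul_of_nonneg_left h1 (by norm_num))
        _ = (4 * K) * (t ^ m) ^ 3 := by rw [← pow_mul]; ring_nf
        _ ≤ (4 * K + 1) ^ 3 * (t ^ m) ^ 3 := by
            refine mul_le_mul_of_nonneg_right ?_ (pow_nonneg (pow_nonneg ht.1 _) _)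
            nlinarith [sq_nonneg (4 * K), mul_nonneg hK0 (sq_nonneg K)]
        _ = _ := by rw [mul_pow]
    have h5 := (pow_le_pow_iff_left₀ (abs_nonneg _)
      (mul_nonneg (by linarith) (pow_nonneg ht.1 _)) three_ne_zero).mp h4
    refine h5.trans (mul_le_mul_of_nonneg_right (by linarith) (pow_nonneg ht.1 _))

open fwdDiff in
/-- The iterated differences of a function whose square and cube are smooth are as small as
those of a smooth function. -/
lemma exists_fwdDiff_bound {f : E → ℝ} (hc : HasCompactSupport f)
    (h2 : ContDiff ℝ ∞ fun x => f x ^ 2) (h3 : ContDiff ℝ ∞ fun x => f x ^ 3) (m : ℕ) :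
    ∃ C : ℝ, ∀ x w : E, ‖w‖ ≤ 1 → |(fwdDiff w)^[m] f x| ≤ C * ‖w‖ ^ m := by
  obtain ⟨C, hC⟩ := exists_uniform_expansion hc h2 h3 m (T := m + 1) (by simp)
  refine ⟨∑ k ∈ Finset.range (m + 1), m.choose k *
    (C * k ^ m + ∑ j ∈ Finset.range (3 * m + 1), C * k ^ j), fun x w hw => ?_⟩
  have hC0 : 0 ≤ C := by
    obtain ⟨P, -, h, -⟩ := hC x 0 (by simp)
    exact (abs_nonneg _).trans (h 0)
  set s := ‖w‖ with hs
  have hs0 : 0 ≤ s := norm_nonneg w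
  have hv : ∃ v : E, ‖v‖ ≤ 1 ∧ w = s • v := by
    by_cases h : w = 0
    · exact ⟨0, by simp, by simp [h]⟩
    · refine ⟨s⁻¹ • w, ?_, ?_⟩
      · rw [norm_smul, norm_inv, norm_norm, inv_mul_cancel₀ (norm_ne_zero_iff.mpr h)]
      · rw [smul_inv_smul₀ (norm_ne_zero_iff.mpr h)]
  obtain ⟨v, hv1, hwv⟩ := hv
  obtain ⟨P, hPdeg, hPC, hPf⟩ := hC x v hv1
  rw [fwdDiff_iter_eq_sum_shift]
  -- the part of the polynomial of degree less than `m` has no `m`-th difference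
  have hvan : ∀ j < m, ∑ k ∈ Finset.range (m + 1),
      ((-1 : ℤ) ^ (m - k) * m.choose k) • ((k : ℝ) ^ j) = 0 := by
    intro j hj
    have := congrFun (fwdDiff_iter_pow_eq_zero_of_lt (R := ℝ) hj) 0
    rw [fwdDiff_iter_eq_sum_shift] at this
    simpa using this
  have hlow : ∑ k ∈ Finset.range (m + 1), ((-1 : ℤ) ^ (m - k) * m.choose k) •
      (∑ j ∈ Finset.range m, P.coeff j * ((k : ℝ) * s) ^ j) = 0 := by
    simp_rw [Finset.smul_sum]
    rw [Finset.sum_comm]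
    refine Finset.sum_eq_zero fun j hj => ?_
    have := hvan j (Finset.mem_range.mp hj)
    rw [← mul_zero (P.coeff j * s ^ j), ← this, Finset.mul_sum]
    refine Finset.sum_congr rfl fun k _ => ?_
    rw [mul_smul_comm, mul_pow]
    congr 1
    ring
  rw [← sub_zero (∑ k ∈ _, _), ← hlow, ← Finset.sum_sub_distrib, Finset.sum_mul]
  refine (Finset.abs_sum_le_sum_abs _ _).trans (Finset.sum_le_sum fun k hk => ?_)
  have hk' : k ≤ m := Nat.lt_succ_iff.mp (Finset.mem_range.mp hk)
  have hks : (k : ℝ) * s ∈ Set.Icc (0 : ℝ) (m + 1) := by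
    refine ⟨by positivity, ?_⟩
    have : (k : ℝ) ≤ m := by exact_mod_cast hk'
    nlinarith
  have h1 := hPf _ hks
  rw [← smul_sub, zsmul_eq_mul, abs_mul, mul_assoc]
  push_cast
  rw [abs_mul, abs_pow, abs_neg, abs_one, one_pow, one_mul, Nat.abs_cast]
  refine mul_le_mul_of_nonneg_left ?_ (Nat.cast_nonneg _)
  have hpt : x + k • w = x + ((k : ℝ) * s) • v := by
    rw [hwv, ← Nat.cast_smul_eq_nsmul ℝ, smul_smul]
  rw [hpt]
  have heval : P.eval ((k : ℝ) * s) = ∑ j ∈ Finset.range m, P.coeff j * ((k : ℝ) * s) ^ j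
      + ∑ j ∈ Finset.Ico m (3 * m + 1), P.coeff j * ((k : ℝ) * s) ^ j := by
    rw [Finset.sum_range_add_sum_Ico _ (by omega)]
    exact Polynomial.eval_eq_sum_range' hPdeg _
  have hsplit : f (x + ((k : ℝ) * s) • v) - ∑ j ∈ Finset.range m, P.coeff j * ((k : ℝ) * s) ^ j
      = (f (x + ((k : ℝ) * s) • v) - P.eval ((k : ℝ) * s))
        + ∑ j ∈ Finset.Ico m (3 * m + 1), P.coeff j * ((k : ℝ) * s) ^ j := by
    rw [heval]; ring
  rw [hsplit, add_mul]
  refine (abs_add_le _ _).trans (add_le_add ?_ ?_)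
  · rw [mul_assoc, ← mul_pow]; exact h1
  · rw [Finset.sum_mul]
    refine (Finset.abs_sum_le_sum_abs _ _).trans ?_
    refine (Finset.sum_le_sum (g := fun j => C * (k : ℝ) ^ j * s ^ m) fun j hj => ?_).trans
      (Finset.sum_le_sum_of_subset_of_nonneg
        (fun j hj => Finset.mem_range.mpr (Finset.mem_Ico.mp hj).2) fun j _ _ => by positivity)
    rw [abs_mul, abs_of_nonneg (by positivity : 0 ≤ ((k : ℝ) * s) ^ j), mul_pow, ← mul_assoc]
    refine mul_le_mul (mul_le_mul_of_nonneg_right (hPC j) (by positivity)) ?_ (by positivity)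
      (by positivity)
    exact pow_le_pow_of_le_one hs0 hw (Finset.mem_Ico.mp hj).1

end Joris

section JorisFourier

open MeasureTheory FourierTransform

variable {E : Type*} [NormedAddCommGroup E] [InnerProductSpace ℝ E] [FiniteDimensional ℝ E]
  [MeasurableSpace E] [BorelSpace E]

lemma integrable_fwdDiff {G : E → ℂ} (hG : Integrable G) (w : E) : Integrable (fwdDiff w G) :=
  (hG.comp_add_right w).sub hG

lemma fourier_fwdDiff {G : E → ℂ} (hG : Integrable G) {w ξ : E} (hw : inner ℝ w ξ = 1 / 2) :
    𝓕 (fwdDiff w G) ξ = -2 * 𝓕 G ξ := by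
  have h1 : 𝓕 (fun v => G (v + w)) ξ = -𝓕 G ξ := by
    have := congrFun (VectorFourier.fourierIntegral_comp_add_right Real.fourierChar volume
      (innerₗ E) G w) ξ
    have h2 : (Real.fourierChar (inner ℝ w ξ) : ℂ) = -1 := by
      rw [Real.fourierChar_apply, hw]
      convert Complex.exp_pi_mul_I using 2
      push_cast
      ring
    calc 𝓕 (fun v => G (v + w)) ξ
        = Real.fourierChar (innerₗ E w ξ) • 𝓕 G ξ := this
      _ = -𝓕 G ξ := by
        rw [Circle.smul_def, innerₗ_apply_apply, h2]; simp
  rw [Real.fourier_eq] at h1 ⊢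
  rw [Real.fourier_eq] at h1 ⊢
  have hi1 := (Real.fourierIntegral_convergent_iff ξ).2 (hG.comp_add_right w)
  have hi2 := (Real.fourierIntegral_convergent_iff ξ).2 hG
  simp only [fwdDiff, smul_sub]
  rw [integral_sub hi1 hi2, h1]
  ring

lemma fourier_fwdDiff_iter {G : E → ℂ} (hG : Integrable G) {w ξ : E} (hw : inner ℝ w ξ = 1 / 2)
    (m : ℕ) : Integrable ((fwdDiff w)^[m] G) ∧
      𝓕 ((fwdDiff w)^[m] G) ξ = (-2) ^ m * 𝓕 G ξ := by
  induction m with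
  | zero => simpa using hG
  | succ m ih =>
    rw [Function.iterate_succ_apply']
    exact ⟨integrable_fwdDiff ih.1 w, by rw [fourier_fwdDiff ih.1 hw, ih.2, pow_succ']; ring⟩

/-- A compactly supported continuous function whose iterated differences of each order `m` are
`O(‖w‖ ^ m)` is smooth: its Fourier transform decreases rapidly. -/
theorem contDiff_of_fwdDiff_bound {f : E → ℝ} (hf : Continuous f) (hc : HasCompactSupport f)
    (hb : ∀ m : ℕ, ∃ C : ℝ, ∀ x w : E, ‖w‖ ≤ 1 → |(fwdDiff w)^[m] f x| ≤ C * ‖w‖ ^ m) :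
    ContDiff ℝ ∞ f := by
  let F : E → ℂ := fun x => (f x : ℂ)
  have hFc : Continuous F := Complex.continuous_ofReal.comp hf
  have hFs : HasCompactSupport F := hc.comp_left (g := fun y : ℝ => (y : ℂ)) (by simp)
  have hF : Integrable F := hFc.integrable_of_hasCompactSupport hFs
  obtain ⟨R, hR⟩ := hc.isCompact.isBounded.subset_closedBall (0 : E)
  have hdecay : ∀ m : ℕ, ∃ C : ℝ, ∀ ξ : E, (1 + ‖ξ‖) ^ m * ‖𝓕 F ξ‖ ≤ C := by
    intro m
    obtain ⟨C, hC⟩ := hb m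
    set V : ℝ := volume.real (Metric.closedBall (0 : E) (R + m))
    refine ⟨2 ^ m * (∫ x, ‖F x‖) + |C| * V, fun ξ => ?_⟩
    have hI : 0 ≤ ∫ x, ‖F x‖ := integral_nonneg fun _ => norm_nonneg _
    have hV : 0 ≤ V := measureReal_nonneg
    rcases lt_or_ge ‖ξ‖ 1 with hξ | hξ
    · have h1 : ‖𝓕 F ξ‖ ≤ ∫ x, ‖F x‖ :=
        VectorFourier.norm_fourierIntegral_le_integral_norm _ _ _ _ _
      have h2 : (1 + ‖ξ‖) ^ m ≤ 2 ^ m := pow_le_pow_left₀ (by positivity) (by linarith) _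
      have := mul_le_mul h2 h1 (norm_nonneg _) (by positivity)
      have := mul_nonneg (abs_nonneg C) hV
      linarith
    · have hξ0 : 0 < ‖ξ‖ := by linarith
      set w : E := (2 * ‖ξ‖ ^ 2)⁻¹ • ξ
      have hw : inner ℝ w ξ = 1 / 2 := by
        rw [real_inner_smul_left, real_inner_self_eq_norm_sq]
        field_simp
      have hwn : ‖w‖ = (2 * ‖ξ‖)⁻¹ := by
        rw [norm_smul, Real.norm_of_nonneg (by positivity)]
        field_simp
      have hw1 : ‖w‖ ≤ 1 := by
        rw [hwn]
        exact inv_le_one_of_one_le₀ (by linarith)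
      obtain ⟨-, h2⟩ := fourier_fwdDiff_iter hF hw m
      have hval : ∀ x, (fwdDiff w)^[m] F x = (((fwdDiff w)^[m] f x : ℝ) : ℂ) := by
        intro x
        rw [fwdDiff_iter_eq_sum_shift, fwdDiff_iter_eq_sum_shift]
        push_cast
        simp [F]
      have hsupp : ∀ x, x ∉ Metric.closedBall (0 : E) (R + m) → (fwdDiff w)^[m] F x = 0 := by
        intro x hx
        rw [hval, fwdDiff_iter_eq_sum_shift, Finset.sum_eq_zero, Complex.ofReal_zero]
        intro k hk
        have hk' : k ≤ m := Nat.lt_succ_iff.mp (Finset.mem_range.mp hk)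
        have : f (x + k • w) = 0 := by
          apply image_eq_zero_of_notMem_tsupport
          intro hmem
          have h3 := hR hmem
          rw [mem_closedBall_zero_iff] at h3 hx
          apply hx
          have h4 : ‖k • w‖ ≤ m := by
            refine (norm_nsmul_le).trans ?_
            have : (k : ℝ) ≤ m := by exact_mod_cast hk'
            nlinarith [norm_nonneg w]
          have h5 := norm_sub_le (x + k • w) (k • w)
          rw [add_sub_cancel_right] at h5
          linarith
        rw [this, smul_zero]
      have h3 : ‖𝓕 ((fwdDiff w)^[m] F) ξ‖ ≤ |C| * ‖w‖ ^ m * V := by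
        rw [Real.fourier_eq, ← setIntegral_eq_integral_of_forall_compl_eq_zero
          (s := Metric.closedBall (0 : E) (R + m))]
        · refine norm_setIntegral_le_of_norm_le_const measure_closedBall_lt_top fun x _ => ?_
          rw [Circle.norm_smul, hval, Complex.norm_real]
          exact (hC x w hw1).trans (mul_le_mul_of_nonneg_right (le_abs_self _) (by positivity))
        · intro x hx
          rw [hsupp x hx, smul_zero]
      rw [h2, norm_mul, norm_pow, norm_neg, Complex.norm_ofNat, hwn] at h3
      have h4 : (1 + ‖ξ‖) ^ m ≤ (2 * ‖ξ‖) ^ m := pow_le_pow_left₀ (by positivity) (by linarith) _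
      have h5 : ‖𝓕 F ξ‖ ≤ 2 ^ m * ‖𝓕 F ξ‖ :=
        le_mul_of_one_le_left (norm_nonneg _) (one_le_pow₀ one_le_two)
      have h6 : (2 * ‖ξ‖) ^ m * (|C| * (2 * ‖ξ‖)⁻¹ ^ m * V) = |C| * V := by
        rw [inv_pow]
        field_simp
      have h7 := mul_le_mul h4 (h5.trans h3) (norm_nonneg _) (by positivity)
      rw [h6] at h7
      have : 0 ≤ (2 : ℝ) ^ m * ∫ x, ‖F x‖ := by positivity
      linarith
  have hcont : Continuous (𝓕 F) :=
    VectorFourier.fourierIntegral_continuous Real.continuous_fourierChar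
      (by exact continuous_inner) hF
  have hint : ∀ n : ℕ, Integrable fun ξ => ‖ξ‖ ^ n * ‖𝓕 F ξ‖ := by
    intro n
    set r := n + (Module.finrank ℝ E + 1) with hr
    obtain ⟨C, hC⟩ := hdecay r
    have h0 : Integrable fun ξ : E => C * (1 + ‖ξ‖) ^ (-((Module.finrank ℝ E + 1 : ℕ) : ℝ)) :=
      (integrable_one_add_norm (by push_cast; linarith)).const_mul C
    refine h0.mono' (by fun_prop) (Filter.Eventually.of_forall fun ξ => ?_)
    have h1 : 0 < 1 + ‖ξ‖ := by positivity
    rw [Real.norm_of_nonneg (by positivity), Real.rpow_neg h1.le, Real.rpow_natCast,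
      ← div_eq_mul_inv, le_div_iff₀ (by positivity)]
    calc ‖ξ‖ ^ n * ‖𝓕 F ξ‖ * (1 + ‖ξ‖) ^ (Module.finrank ℝ E + 1)
        ≤ (1 + ‖ξ‖) ^ n * ‖𝓕 F ξ‖ * (1 + ‖ξ‖) ^ (Module.finrank ℝ E + 1) := by
          gcongr; linarith
      _ = (1 + ‖ξ‖) ^ r * ‖𝓕 F ξ‖ := by rw [hr, pow_add]; ring
      _ ≤ C := hC ξ
  have hFi : Integrable (𝓕 F) := by
    have := hint 0
    simp only [pow_zero, one_mul] at this
    exact (integrable_norm_iff (hcont.aestronglyMeasurable)).mp this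
  have hinv := hFc.fourierInv_fourier_eq hF hFi
  have hsm : ContDiff ℝ ∞ (𝓕 (𝓕 F)) := Real.contDiff_fourier (N := ⊤) fun n _ => hint n
  have hF' : F = fun x => 𝓕 (𝓕 F) (-x) := by
    conv_lhs => rw [← hinv]
    ext x
    exact Real.fourierInv_eq_fourier_neg _ _
  have hFsm : ContDiff ℝ ∞ F := by
    rw [hF']; exact hsm.comp contDiff_neg
  exact Complex.reCLM.contDiff.comp hFsm

/-- A compactly supported function whose square and cube are smooth is smooth. -/
theorem contDiff_of_sq_of_cube {f : E → ℝ} (hc : HasCompactSupport f)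
    (h2 : ContDiff ℝ ∞ fun x => f x ^ 2) (h3 : ContDiff ℝ ∞ fun x => f x ^ 3) :
    ContDiff ℝ ∞ f := by
  refine contDiff_of_fwdDiff_bound ?_ hc fun m => exists_fwdDiff_bound hc h2 h3 m
  rw [continuous_iff_continuousAt]
  intro x
  rw [Metric.continuousAt_iff]
  intro ε hε
  obtain ⟨δ, hδ, h⟩ := Metric.continuousAt_iff.mp h3.continuous.continuousAt (ε ^ 3 / 4)
    (by positivity)
  refine ⟨δ, hδ, fun y hy => ?_⟩
  have h1 := h hy
  rw [Real.dist_eq] at h1 ⊢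
  have h4 := abs_sub_pow_three_le (f y) (f x)
  exact lt_of_pow_lt_pow_left₀ 3 hε.le (by linarith)

end JorisFourier

/-- Joris's theorem: a function on an open set whose square and cube are smooth is smooth. -/
theorem contDiffOn_of_sq_of_cube {E : Type*} [NormedAddCommGroup E] [InnerProductSpace ℝ E]
    [FiniteDimensional ℝ E] {U : Set E} (hU : IsOpen U) {f : E → ℝ}
    (h2 : ContDiffOn ℝ ∞ (fun x => f x ^ 2) U) (h3 : ContDiffOn ℝ ∞ (fun x => f x ^ 3) U) :
    ContDiffOn ℝ ∞ f U := by
  borelize E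
  intro x hx
  obtain ⟨χ, hχs, hχc, hχ, -, hχ1⟩ :=
    exists_contDiff_tsupport_subset (n := ⊤) (hU.mem_nhds hx)
  have hχ' : ContDiff ℝ ∞ χ := hχ
  have hcut : ∀ {k : ℕ}, k ≠ 0 → ContDiffOn ℝ ∞ (fun x => f x ^ k) U →
      ContDiff ℝ ∞ fun x => (χ x * f x) ^ k := by
    intro k hk h
    refine contMDiff_iff_contDiff.mp (contMDiff_of_tsupport fun y hy =>
      contMDiffAt_iff_contDiffAt.mpr ?_)
    have hy' : y ∈ U := by
      apply hχs
      refine closure_mono (Function.support_subset_iff'.mpr fun z hz => ?_) hy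
      rw [Function.notMem_support.mp hz, zero_mul, zero_pow hk]
    simp only [mul_pow]
    exact (hχ'.contDiffAt.pow k).mul (h.contDiffAt (hU.mem_nhds hy'))
  have hsm : ContDiff ℝ ∞ fun x => χ x * f x :=
    contDiff_of_sq_of_cube hχc.mul_right (hcut two_ne_zero h2) (hcut three_ne_zero h3)
  have hne : ∀ᶠ y in nhds x, χ y ≠ 0 :=
    hχ.continuous.continuousAt.eventually_ne (by rw [hχ1]; exact one_ne_zero)
  have hdiv : ContDiffAt ℝ ∞ (fun y => χ y * f y / χ y) x :=
    hsm.contDiffAt.div hχ'.contDiffAt (by rw [hχ1]; exact one_ne_zero)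
  refine (hdiv.congr_of_eventuallyEq ?_).contDiffWithinAt
  filter_upwards [hne] with y hy
  rw [mul_div_cancel_left₀ _ hy]

/-! ### Completely integrable linear systems -/

section Frobenius

open Set Metric

variable {E W : Type*} [NormedAddCommGroup E] [NormedSpace ℝ E]
  [NormedAddCommGroup W] [NormedSpace ℝ W]

lemma exists_linear_ode [CompleteSpace W] {A : ℝ → W →L[ℝ] W} (hA : ContinuousOn A (Icc 0 1))
    (hA1 : ∀ t ∈ Icc (0 : ℝ) 1, ‖A t‖ ≤ 1 / 2) (w : W) :
    ∃ Y : ℝ → W, Y 0 = w ∧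
      ∀ t ∈ Icc (0 : ℝ) 1, HasDerivWithinAt Y (A t (Y t)) (Icc 0 1) t := by
  have hPL : IsPicardLindelof (fun t y => A t y) (⟨0, by simp⟩ : Icc (0 : ℝ) 1) w
      (‖w‖₊ + 1) 0 (‖w‖₊ + 1) (1 / 2) := by
    constructor
    · intro t ht
      refine ((A t).lipschitz.weaken ?_).lipschitzOnWith
      rw [← NNReal.coe_le_coe]
      simpa using hA1 t ht
    · intro x _
      exact hA.clm_apply continuousOn_const
    · intro t ht x hx
      have h1 := (A t).le_of_opNorm_le (hA1 t ht) x
      have h2 : ‖x‖ ≤ ‖w‖ + (‖w‖ + 1) := by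
        have h3 := mem_closedBall_iff_norm.mp hx
        push_cast at h3
        have := norm_le_norm_add_norm_sub' x w
        linarith
      push_cast
      have := norm_nonneg w
      linarith
    · simp
  exact hPL.exists_eq_forall_mem_Icc_hasDerivWithinAt₀

/-- `u` solves the linear total differential equation `du = Ω u` at `x`. -/
def SolvesAt (Ω : E → E →L[ℝ] W →L[ℝ] W) (u : E → W) (x : E) : Prop :=
  HasFDerivAt u ((Ω x).flip (u x)) x

/-- The integrability condition of the equation `du = Ω u`, which says that `d(Ω u)` vanishes
if `du = Ω u`. -/
def IsIntegrableAt (Ω : E → E →L[ℝ] W →L[ℝ] W) (x : E) : Prop :=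
  ∀ v w : E, fderiv ℝ Ω x v w + (Ω x w).comp (Ω x v)
    = fderiv ℝ Ω x w v + (Ω x v).comp (Ω x w)

/-- Two solutions of `du = Ω u` on a convex set that agree at a point are equal. -/
lemma SolvesAt.eqOn {Ω : E → E →L[ℝ] W →L[ℝ] W} {B : Set E} (hB : Convex ℝ B) {K : ℝ}
    (hK : ∀ x ∈ B, ‖Ω x‖ ≤ K) {u₁ u₂ : E → W} (h₁ : ∀ x ∈ B, SolvesAt Ω u₁ x)
    (h₂ : ∀ x ∈ B, SolvesAt Ω u₂ x) {y : E} (hy : y ∈ B) (h : u₁ y = u₂ y) : EqOn u₁ u₂ B := by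
  intro x hx
  have hseg : ∀ t ∈ Icc (0 : ℝ) 1, y + t • (x - y) ∈ B := fun t ht =>
    hB.add_smul_sub_mem hy hx ht
  have hline : ∀ t : ℝ, HasDerivAt (fun t : ℝ => y + t • (x - y)) (x - y) t := fun t => by
    simpa using ((hasDerivAt_id t).smul_const (x - y)).const_add y
  have hder : ∀ u : E → W, (∀ x ∈ B, SolvesAt Ω u x) → ∀ t ∈ Icc (0 : ℝ) 1,
      HasDerivAt (fun t : ℝ => u (y + t • (x - y)))
        (Ω (y + t • (x - y)) (x - y) (u (y + t • (x - y)))) t := by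
    intro u hu t ht
    have h : HasFDerivAt u _ _ := hu _ (hseg t ht)
    exact h.comp_hasDerivAt t (hline t)
  have hK0 : 0 ≤ K := (norm_nonneg _).trans (hK y hy)
  have := ODE_solution_unique_of_mem_Icc_right (a := (0 : ℝ)) (b := 1)
    (v := fun t w => Ω (y + t • (x - y)) (x - y) w) (s := fun _ => univ)
    (K := Real.toNNReal (K * ‖x - y‖))
    (f := fun t : ℝ => u₁ (y + t • (x - y))) (g := fun t : ℝ => u₂ (y + t • (x - y)))
    (fun t ht => ((Ω (y + t • (x - y)) (x - y)).lipschitz.weaken (by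
      refine NNReal.le_toNNReal_of_coe_le ?_
      exact (Ω _).le_of_opNorm_le (hK _ (hseg t (Ico_subset_Icc_self ht))) _)).lipschitzOnWith)
    (fun t ht => (hder u₁ h₁ t ht).continuousAt.continuousWithinAt)
    (fun t ht => (hder u₁ h₁ t (Ico_subset_Icc_self ht)).hasDerivWithinAt)
    (fun _ _ => mem_univ _)
    (fun t ht => (hder u₂ h₂ t ht).continuousAt.continuousWithinAt)
    (fun t ht => (hder u₂ h₂ t (Ico_subset_Icc_self ht)).hasDerivWithinAt)
    (fun _ _ => mem_univ _) (by simpa using h) (right_mem_Icc.mpr zero_le_one)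
  simpa using this

/-- Existence for integrable linear systems on small convex sets. The solution is obtained by
integrating along the rays that start at `y`; if `Y` is the solution along the ray to `x`, then,
by integrability, `Y s + s • Ω h (Y s)` solves the equation along the ray to `x + h` up to
`O(‖h‖ ^ 2)`. -/
lemma exists_solvesAt [CompleteSpace W] {Ω : E → E →L[ℝ] W →L[ℝ] W} {B : Set E}
    (hBo : IsOpen B) (hB : Convex ℝ B) {K C : ℝ} (hK : ∀ x ∈ B, ‖Ω x‖ ≤ K)
    (hsmall : ∀ x ∈ B, ∀ y ∈ B, K * ‖x - y‖ ≤ 1 / 2)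
    (hd : ∀ x ∈ B, DifferentiableAt ℝ Ω x)
    (hC : ∀ x ∈ B, ∀ y ∈ B, ‖fderiv ℝ Ω x - fderiv ℝ Ω y‖ ≤ C * ‖x - y‖)
    (hint : ∀ x ∈ B, IsIntegrableAt Ω x) {y : E} (hy : y ∈ B) (w : W) :
    ∃ u : E → W, u y = w ∧ ∀ x ∈ B, SolvesAt Ω u x := by
  have hK0 : 0 ≤ K := (norm_nonneg _).trans (hK y hy)
  have hseg : ∀ x ∈ B, ∀ t ∈ Icc (0 : ℝ) 1, y + t • (x - y) ∈ B := fun x hx t ht =>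
    hB.add_smul_sub_mem hy hx ht
  have hcont : ContinuousOn Ω B := fun x hx => (hd x hx).continuousAt.continuousWithinAt
  have hline : ∀ (x : E) (t : ℝ), HasDerivAt (fun t : ℝ => y + t • (x - y)) (x - y) t :=
    fun x t => by simpa using ((hasDerivAt_id t).smul_const (x - y)).const_add y
  have hAn : ∀ x ∈ B, ∀ t ∈ Icc (0 : ℝ) 1, ‖Ω (y + t • (x - y)) (x - y)‖ ≤ 1 / 2 := by
    intro x hx t ht
    exact ((Ω _).le_of_opNorm_le (hK _ (hseg x hx t ht)) _).trans (hsmall x hx y hy)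
  have hex : ∀ x : E, ∃ Y : ℝ → W, x ∈ B → Y 0 = w ∧ ∀ t ∈ Icc (0 : ℝ) 1,
      HasDerivWithinAt Y (Ω (y + t • (x - y)) (x - y) (Y t)) (Icc 0 1) t := by
    intro x
    by_cases hx : x ∈ B
    · obtain ⟨Y, h⟩ := exists_linear_ode (A := fun t => Ω (y + t • (x - y)) (x - y))
        ((hcont.comp (fun t _ => (hline x t).continuousAt.continuousWithinAt)
          (hseg x hx)).clm_apply continuousOn_const) (hAn x hx) w
      exact ⟨Y, fun _ => h⟩
    · exact ⟨0, fun h => absurd h hx⟩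
  choose Y hY using hex
  have hY0 : ∀ x ∈ B, Y x 0 = w := fun x hx => (hY x hx).1
  have hYd := fun x hx => (hY x hx).2
  refine ⟨fun x => Y x 1, ?_, fun x hx => ?_⟩
  · have h1 : ∀ t ∈ Icc (0 : ℝ) 1, HasDerivWithinAt (Y y) 0 (Icc 0 1) t := by
      intro t ht
      simpa using hYd y hy t ht
    have h2 := (convex_Icc (0 : ℝ) 1).norm_image_sub_le_of_norm_hasDerivWithin_le (C := 0) h1
      (by simp) (left_mem_Icc.mpr zero_le_one) (right_mem_Icc.mpr zero_le_one)
    rw [zero_mul, norm_le_zero_iff, sub_eq_zero] at h2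
    exact h2.trans (hY0 y hy)
  -- first and second order Taylor estimates for `Ω`
  obtain ⟨D, hD⟩ : ∃ D : ℝ, ∀ z ∈ B, ‖fderiv ℝ Ω z‖ ≤ D := by
    by_cases hE : K = 0
    · refine ⟨0, fun z hz => ?_⟩
      have : fderiv ℝ Ω z = 0 := by
        have h0 : Ω =ᶠ[nhds z] fun _ => 0 := by
          filter_upwards [hBo.mem_nhds hz] with p hp
          exact norm_le_zero_iff.mp (hE ▸ hK p hp)
        rw [h0.fderiv_eq]; simp
      simp [this]
    · have hKp : 0 < K := lt_of_le_of_ne hK0 (Ne.symm hE)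
      refine ⟨|C| * (1 / 2 / K) + ‖fderiv ℝ Ω y‖, fun z hz => ?_⟩
      have h1 := norm_le_norm_add_norm_sub' (fderiv ℝ Ω z) (fderiv ℝ Ω y)
      have h2 := hC z hz y hy
      have h3 : ‖z - y‖ ≤ 1 / 2 / K := by
        rw [le_div_iff₀ hKp, mul_comm]; exact hsmall z hz y hy
      have h4 : C * ‖z - y‖ ≤ |C| * (1 / 2 / K) :=
        mul_le_mul (le_abs_self _) h3 (norm_nonneg _) (abs_nonneg _)
      linarith
  have hD0 : 0 ≤ D := (norm_nonneg _).trans (hD y hy)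
  have hT1 : ∀ p ∈ B, ∀ q ∈ B, ‖Ω q - Ω p‖ ≤ D * ‖q - p‖ := fun p hp q hq =>
    hB.norm_image_sub_le_of_norm_fderiv_le (fun z hz => hd z hz) hD hp hq
  have hT2 : ∀ p ∈ B, ∀ q ∈ B, ‖Ω q - Ω p - fderiv ℝ Ω p (q - p)‖ ≤ |C| * ‖q - p‖ ^ 2 := by
    intro p hp q hq
    have hs : segment ℝ p q ⊆ B := hB.segment_subset hp hq
    have := (convex_segment p q).norm_image_sub_le_of_norm_hasFDerivWithin_le'
      (f := Ω) (f' := fun z => fderiv ℝ Ω z) (φ := fderiv ℝ Ω p) (C := |C| * ‖q - p‖)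
      (fun z hz => (hd z (hs hz)).hasFDerivAt.hasFDerivWithinAt)
      (fun z hz => by
        refine (hC z (hs hz) p hp).trans (mul_le_mul (le_abs_self _) ?_ (norm_nonneg _)
          (abs_nonneg _))
        exact norm_sub_le_of_mem_segment hz)
      (left_mem_segment ℝ p q) (right_mem_segment ℝ p q)
    refine this.trans_eq (by ring)
  -- a bound of the solution along the ray to `x`
  have hYc : ContinuousOn (Y x) (Icc 0 1) := fun t ht => (hYd x hx t ht).continuousWithinAt
  obtain ⟨R, hR⟩ := isCompact_Icc.exists_bound_of_continuousOn hYc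
  have hR0 : 0 ≤ R := (norm_nonneg _).trans (hR 0 (by simp))
  set x' := x - y with hx'
  set κ : ℝ := |C| * ‖x'‖ * R + D * R + D * ‖x'‖ * K * R + K * K * R with hκ
  have hκ0 : 0 ≤ κ := by positivity
  -- the comparison of neighbouring rays
  have hcomp : ∀ h : E, x + h ∈ B →
      ‖Y (x + h) 1 - Y x 1 - Ω x h (Y x 1)‖ ≤ (2 * Real.exp (1 / 2) * κ) * ‖h‖ ^ 2 := by
    intro h hxh
    set Z : ℝ → W := fun s => Y x s + s • Ω (y + s • x') h (Y x s)
    set Z' : ℝ → W := fun s => Ω (y + s • x') x' (Y x s)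
      + (s • (fderiv ℝ Ω (y + s • x') x' h (Y x s)
      + Ω (y + s • x') h (Ω (y + s • x') x' (Y x s))) + Ω (y + s • x') h (Y x s))
    have hZ : ∀ s ∈ Icc (0 : ℝ) 1, HasDerivWithinAt Z (Z' s) (Icc 0 1) s := by
      intro s hs
      have h1 := hYd x hx s hs
      have h2 : HasDerivWithinAt (fun s : ℝ => Ω (y + s • x')) (fderiv ℝ Ω (y + s • x') x')
          (Icc 0 1) s :=
        ((hd _ (hseg x hx s hs)).hasFDerivAt.comp_hasDerivAt s (hline x s)).hasDerivWithinAt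
      have h3 := (h2.clm_apply (hasDerivWithinAt_const s _ h)).clm_apply h1
      have h4 := h1.add ((hasDerivWithinAt_id s (Icc 0 1)).smul h3)
      refine h4.congr_deriv ?_
      simp only [Z', id, map_zero, add_zero, one_smul]
      rfl
    have hY' := hYd (x + h) hxh
    have hici : ∀ {f : ℝ → W} {f' : W} {s : ℝ}, s ∈ Ico (0 : ℝ) 1 →
        HasDerivWithinAt f f' (Icc 0 1) s → HasDerivWithinAt f f' (Ici s) s := by
      intro f f' s hs hf
      exact hf.mono_of_mem_nhdsWithin (Icc_mem_nhdsGE_of_mem hs)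
    have hG := dist_le_of_approx_trajectories_ODE_of_mem (a := (0 : ℝ)) (b := 1)
      (v := fun s u => Ω (y + s • (x + h - y)) (x + h - y) u) (s := fun _ => univ)
      (K := 1 / 2) (δ := 0) (εf := 0) (εg := κ * ‖h‖ ^ 2)
      (f := Y (x + h)) (f' := fun s => Ω (y + s • (x + h - y)) (x + h - y) (Y (x + h) s))
      (g := Z) (g' := Z')
      (fun s hs => ((Ω _ _).lipschitz.weaken (by
        rw [← NNReal.coe_le_coe]
        simpa using hAn (x + h) hxh s (Ico_subset_Icc_self hs))).lipschitzOnWith)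
      (fun s hs => (hY' s hs).continuousWithinAt)
      (fun s hs => hici hs (hY' s (Ico_subset_Icc_self hs)))
      (fun s _ => by simp) (fun _ _ => mem_univ _)
      (fun s hs => (hZ s hs).continuousWithinAt)
      (fun s hs => hici hs (hZ s (Ico_subset_Icc_self hs)))
      ?_ (fun _ _ => mem_univ _) (by simp [Z, hY0 x hx, hY0 _ hxh]) 1
      (right_mem_Icc.mpr zero_le_one)
    · rw [dist_eq_norm, gronwallBound_of_K_ne_0 (by norm_num)] at hG
      have e1 : Y (x + h) 1 - Z 1 = Y (x + h) 1 - Y x 1 - Ω x h (Y x 1) := by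
        simp only [Z, one_smul, hx', add_sub_cancel]
        abel
      rw [e1] at hG
      refine hG.trans ?_
      norm_num
      have : 0 ≤ κ * ‖h‖ ^ 2 := by positivity
      nlinarith [Real.exp_pos (1 / 2)]
    · intro s hs
      have hs' := Ico_subset_Icc_self hs
      set p := y + s • x' with hp
      set q := y + s • (x + h - y) with hq
      have hpB : p ∈ B := hseg x hx s hs'
      have hqB : q ∈ B := hseg _ hxh s hs'
      have hqp : q - p = s • h := by
        rw [hq, hp, hx', add_sub_add_left_eq_sub, ← smul_sub]; congr 1; abel
      have hs1 : |s| ≤ 1 := abs_le.mpr ⟨by linarith [hs.1], hs.2.le⟩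
      have hqpn : ‖q - p‖ ≤ ‖h‖ := by
        rw [hqp, norm_smul, Real.norm_eq_abs]
        exact mul_le_of_le_one_left (norm_nonneg _) hs1
      set u := Y x s with hu
      have hun : ‖u‖ ≤ R := hR s hs'
      have hint' := congrArg (fun T : W →L[ℝ] W => T u) (hint p hpB x' h)
      simp only [add_apply, ContinuousLinearMap.comp_apply] at hint'
      have hxy : x + h - y = x' + h := by rw [hx']; abel
      have e : Z' s - Ω q (x + h - y) (Z s)
          = -((Ω q - Ω p - fderiv ℝ Ω p (q - p)) x' u) - ((Ω q - Ω p) h u)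
            - (s • ((Ω q - Ω p) x' (Ω p h u)) + s • (Ω q h (Ω p h u))) := by
        simp only [Z', Z, hxy, ← hp, ← hu, hint', hqp]
        simp only [map_add, map_smul, add_apply, sub_apply,
          smul_apply, smul_add, smul_sub]
        abel
      rw [dist_eq_norm, e]
      have b1 : ‖(Ω q - Ω p - fderiv ℝ Ω p (q - p)) x' u‖ ≤ |C| * ‖x'‖ * R * ‖h‖ ^ 2 := by
        calc _ ≤ ‖Ω q - Ω p - fderiv ℝ Ω p (q - p)‖ * ‖x'‖ * ‖u‖ :=
              ContinuousLinearMap.le_opNorm₂ _ _ _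
          _ ≤ (|C| * ‖h‖ ^ 2) * ‖x'‖ * R := by
              gcongr
              exact (hT2 p hpB q hqB).trans (by gcongr)
          _ = _ := by ring
      have b2 : ‖(Ω q - Ω p) h u‖ ≤ D * R * ‖h‖ ^ 2 := by
        calc _ ≤ ‖Ω q - Ω p‖ * ‖h‖ * ‖u‖ := ContinuousLinearMap.le_opNorm₂ _ _ _
          _ ≤ (D * ‖h‖) * ‖h‖ * R := by
              gcongr
              exact (hT1 p hpB q hqB).trans (by gcongr)
          _ = _ := by ring
      have b0 : ‖Ω p h u‖ ≤ K * ‖h‖ * R := by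
        calc _ ≤ ‖Ω p‖ * ‖h‖ * ‖u‖ := ContinuousLinearMap.le_opNorm₂ _ _ _
          _ ≤ K * ‖h‖ * R := by gcongr; exact hK p hpB
      have b3 : ‖s • ((Ω q - Ω p) x' (Ω p h u))‖ ≤ D * ‖x'‖ * K * R * ‖h‖ ^ 2 := by
        rw [norm_smul, Real.norm_eq_abs]
        calc _ ≤ 1 * (‖Ω q - Ω p‖ * ‖x'‖ * ‖Ω p h u‖) := by
              gcongr; exact ContinuousLinearMap.le_opNorm₂ _ _ _
          _ ≤ 1 * ((D * ‖h‖) * ‖x'‖ * (K * ‖h‖ * R)) := by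
              gcongr
              exact (hT1 p hpB q hqB).trans (by gcongr)
          _ = _ := by ring
      have b4 : ‖s • (Ω q h (Ω p h u))‖ ≤ K * K * R * ‖h‖ ^ 2 := by
        rw [norm_smul, Real.norm_eq_abs]
        calc _ ≤ 1 * (‖Ω q‖ * ‖h‖ * ‖Ω p h u‖) := by
              gcongr; exact ContinuousLinearMap.le_opNorm₂ _ _ _
          _ ≤ 1 * (K * ‖h‖ * (K * ‖h‖ * R)) := by
              gcongr
              exact hK q hqB
          _ = _ := by ring
      refine (norm_sub_le _ _).trans ?_
      refine (add_le_add ((norm_sub_le _ _).trans (add_le_add (norm_neg _).le le_rfl))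
        (norm_add_le _ _)).trans ?_
      rw [hκ]
      linarith
  rw [SolvesAt, hasFDerivAt_iff_isLittleO_nhds_zero]
  have hO : (fun h : E => Y (x + h) 1 - Y x 1 - (Ω x).flip (Y x 1) h) =O[nhds 0]
      fun h => ‖h‖ ^ 2 := by
    refine Asymptotics.IsBigO.of_bound (2 * Real.exp (1 / 2) * κ) ?_
    have hmem : ∀ᶠ h in nhds (0 : E), x + h ∈ B := by
      refine (continuous_const.add continuous_id).continuousAt.eventually_mem ?_
      simpa using hBo.mem_nhds hx
    filter_upwards [hmem] with h hh
    rw [Real.norm_of_nonneg (by positivity)]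
    exact hcomp h hh
  exact hO.trans_isLittleO (Asymptotics.isLittleO_norm_pow_id one_lt_two)

end Frobenius

section Frobenius

open Set Metric

variable {E W : Type*} [NormedAddCommGroup E] [NormedSpace ℝ E]
  [NormedAddCommGroup W] [NormedSpace ℝ W]

/-- Frobenius' theorem for linear systems: an integrable system `du = Ω u` has solutions with
any initial value on a ball whose size does not depend on the initial value. -/
theorem exists_ball_solvesAt [CompleteSpace W] {Ω : E → E →L[ℝ] W →L[ℝ] W} {U : Set E}
    (hU : IsOpen U) (hΩ : ContDiffOn ℝ ∞ Ω U) (hint : ∀ x ∈ U, IsIntegrableAt Ω x) {x₀ : E}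
    (hx₀ : x₀ ∈ U) :
    ∃ r > 0, ball x₀ r ⊆ U ∧ (∃ K : ℝ, ∀ x ∈ ball x₀ r, ‖Ω x‖ ≤ K) ∧
      ∀ y ∈ ball x₀ r, ∀ w : W, ∃ u : E → W, u y = w ∧ ∀ x ∈ ball x₀ r, SolvesAt Ω u x := by
  have hat : ContDiffAt ℝ ∞ Ω x₀ := hΩ.contDiffAt (hU.mem_nhds hx₀)
  have hf : ContDiffAt ℝ 1 (fderiv ℝ Ω) x₀ :=
    (hat.fderiv_right (m := ∞) (by simp)).of_le (by simp)
  obtain ⟨C, t, ht, hC⟩ := hf.exists_lipschitzOnWith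
  set K : ℝ := ‖Ω x₀‖ + 1 with hK
  have hKp : 0 < K := by positivity
  have hbd : ∀ᶠ x in nhds x₀, ‖Ω x‖ < K :=
    (hat.continuousAt.norm).eventually_lt_const (by rw [hK]; linarith)
  obtain ⟨r, hr, hball⟩ := Metric.mem_nhds_iff.mp
    (Filter.inter_mem (Filter.inter_mem ht hbd) (hU.mem_nhds hx₀))
  set r' := min r (1 / (4 * K)) with hr'
  have hsub : ball x₀ r' ⊆ ball x₀ r := ball_subset_ball (min_le_left _ _)
  refine ⟨r', by positivity, fun x hx => (hball (hsub hx)).2,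
    ⟨K, fun x hx => (hball (hsub hx)).1.2.le⟩, fun y hy w => ?_⟩
  refine exists_solvesAt (K := K) (C := C) isOpen_ball (convex_ball _ _)
    (fun x hx => (hball (hsub hx)).1.2.le) (fun x hx z hz => ?_) (fun x hx => ?_)
    (fun x hx z hz => ?_) (fun x hx => hint x (hball (hsub hx)).2) hy w
  · have h1 : ‖x - z‖ ≤ 2 * (1 / (4 * K)) := by
      have h2 := dist_triangle_right x z x₀
      have h3 := (mem_ball.mp hx).trans_le (min_le_right _ _)
      have h4 := (mem_ball.mp hz).trans_le (min_le_right _ _)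
      rw [← dist_eq_norm]
      linarith
    calc K * ‖x - z‖ ≤ K * (2 * (1 / (4 * K))) := by gcongr
      _ = 1 / 2 := by field_simp; norm_num
  · exact (hΩ.contDiffAt (hU.mem_nhds (hball (hsub hx)).2)).differentiableAt (by simp)
  · have := hC.dist_le_mul x (hball (hsub hx)).1.1 z (hball (hsub hz)).1.1
    rwa [dist_eq_norm, dist_eq_norm] at this

lemma SolvesAt.contDiffOn {Ω : E → E →L[ℝ] W →L[ℝ] W} {V : Set E} (hV : IsOpen V)
    (hΩ : ContDiffOn ℝ ∞ Ω V) {u : E → W} (hu : ∀ x ∈ V, SolvesAt Ω u x) :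
    ContDiffOn ℝ ∞ u V := by
  rw [contDiffOn_infty]
  intro k
  induction k with
  | zero =>
    rw [Nat.cast_zero, contDiffOn_zero]
    exact fun x hx => HasFDerivAt.continuousAt (hu x hx) |>.continuousWithinAt
  | succ k ih =>
    rw [Nat.cast_succ, contDiffOn_succ_iff_fderiv_of_isOpen hV]
    refine ⟨fun x hx => (HasFDerivAt.differentiableAt (hu x hx)).differentiableWithinAt,
      by simp, ?_⟩
    have h1 : ContDiffOn ℝ k (fun x => (Ω x).flip (u x)) V := by
      refine ContDiffOn.clm_apply ?_ ih
      exact (ContinuousLinearMap.flipₗᵢ ℝ E W W).contDiff.comp_contDiffOn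
        (hΩ.of_le (by exact_mod_cast le_top))
    exact h1.congr fun x hx => HasFDerivAt.fderiv (hu x hx)

/-- Two germs of solutions of a linear system that agree at the point are equal. -/
lemma SolvesAt.eventuallyEq {Ω : E → E →L[ℝ] W →L[ℝ] W} {x₀ : E} (hΩ : ContinuousAt Ω x₀)
    {u₁ u₂ : E → W} (h₁ : ∀ᶠ x in nhds x₀, SolvesAt Ω u₁ x)
    (h₂ : ∀ᶠ x in nhds x₀, SolvesAt Ω u₂ x) (h : u₁ x₀ = u₂ x₀) : u₁ =ᶠ[nhds x₀] u₂ := by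
  have hbd : ∀ᶠ x in nhds x₀, ‖Ω x‖ < ‖Ω x₀‖ + 1 :=
    (hΩ.norm).eventually_lt_const (by linarith)
  obtain ⟨r, hr, hball⟩ := Metric.mem_nhds_iff.mp (hbd.and (h₁.and h₂))
  have := SolvesAt.eqOn (convex_ball x₀ r) (fun x hx => (hball hx).1.le)
    (fun x hx => (hball hx).2.1) (fun x hx => (hball hx).2.2) (mem_ball_self hr) h
  exact this.eventuallyEq_of_mem (ball_mem_nhds x₀ hr)

end Frobenius

/-! ### Monodromy and deck transformations -/

section Monodromy

open Set Filter Topology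

variable {X W A : Type*} [TopologicalSpace X] [TopologicalSpace A]

/-- A system of locally constant type on `X` with values in `W`: a notion `P u x` of the function
`u` being flat at `x`, such that flat functions are determined near a point by their value, and
near each point there are flat functions with arbitrary values. -/
structure IsFlatSystem (P : (X → W) → X → Prop) : Prop where
  eventuallyEq : ∀ {u v x}, P u x → P v x → u x = v x → u =ᶠ[𝓝 x] v
  exists_nhds : ∀ x, ∃ V : Set X, IsOpen V ∧ x ∈ V ∧
    (∀ y ∈ V, ∀ w, ∃ u, u y = w ∧ ∀ z ∈ V, P u z) ∧
    ∀ u v, (∀ z ∈ V, P u z) → (∀ z ∈ V, P v z) → ∀ y ∈ V, u y = v y → EqOn u v V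

/-- A map to `W` defined on a space over `X` is flat if it is locally the pull-back of a flat
function. -/
def IsFlatOver (P : (X → W) → X → Prop) (f : A → X) (u : A → W) : Prop :=
  ∀ a, ∃ v, P v (f a) ∧ u =ᶠ[𝓝 a] v ∘ f

/-- The topology on `X × W` whose sheets are the graphs of the flat functions. -/
@[reducible] def sheetTopology (P : (X → W) → X → Prop) : TopologicalSpace (X × W) where
  IsOpen O := ∀ z ∈ O, ∀ v, P v z.1 → v z.1 = z.2 → ∀ᶠ y in 𝓝 z.1, (y, v y) ∈ O
  isOpen_univ := by simp
  isOpen_inter O O' h h' z hz v hv hvz := (h z hz.1 v hv hvz).and (h' z hz.2 v hv hvz)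
  isOpen_sUnion S h z := by
    rintro ⟨O, hO, hz⟩ v hv hvz
    exact (h O hO z hz v hv hvz).mono fun y hy => ⟨O, hO, hy⟩

lemma isOpen_sheet {P : (X → W) → X → Prop} (hP : IsFlatSystem P) {O : Set X} (hO : IsOpen O)
    {s : X → W} (hs : ∀ z ∈ O, P s z) :
    IsOpen[sheetTopology P] {z : X × W | z.1 ∈ O ∧ z.2 = s z.1} := by
  rintro ⟨x, w⟩ ⟨hx, hw⟩ v hv hvx
  filter_upwards [hP.eventuallyEq hv (hs x hx) (hvx.trans hw), hO.mem_nhds hx] with y hy hyO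
  exact ⟨hyO, hy⟩

lemma isCoveringMap_fst [Nonempty W] {P : (X → W) → X → Prop} (hP : IsFlatSystem P) :
    @IsCoveringMap (X × W) X (sheetTopology P) _ Prod.fst := by
  let _ := sheetTopology P
  let _ : TopologicalSpace W := ⊥
  have : DiscreteTopology W := ⟨rfl⟩
  have h := hP.exists_nhds
  choose V hV hxV hex huniq using h
  choose s hs hsP using fun x => hex x x (hxV x)
  have : Nonempty (X → X × W) := ⟨fun x => (x, Classical.arbitrary W)⟩
  refine @IsCoveringMap.mk (X × W) X (sheetTopology P) _ Prod.fst (fun _ => W) _ _ (fun x =>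
    @IsOpen.trivializationDiscrete (X × W) X (sheetTopology P) _ Prod.fst _ W _ _ _
      (fun w => {z | z.1 ∈ V x ∧ z.2 = s x w z.1}) (V x) (hV x) ?_ ?_ ?_ ?_ ?_) hxV
  · intro w O hOV
    constructor
    · intro hO
      convert! isOpen_sheet hP hO (s := s x w) (fun z hz => hsP x w z (hOV hz)) using 1
      ext z
      exact ⟨fun h => ⟨h.1, h.2.2⟩, fun h => ⟨h.1, hOV h.1, h.2⟩⟩
    · intro hO
      rw [isOpen_iff_mem_nhds]
      intro y hy
      have := hO (y, s x w y) ⟨hy, hOV hy, rfl⟩ (s x w) (hsP x w y (hOV hy)) rfl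
      exact this.mono fun z hz => hz.1
  · rintro w ⟨a, b⟩ h ⟨a', b'⟩ h' (rfl : a = a')
    exact Prod.ext rfl (h.2.trans h'.2.symm)
  · exact fun w y hy => ⟨(y, s x w y), ⟨hy, rfl⟩, rfl⟩
  · intro w w' hw
    refine Set.disjoint_left.mpr ?_
    rintro ⟨y, b⟩ h h'
    apply hw
    rw [← hs x w, ← hs x w']
    exact huniq x _ _ (hsP x w) (hsP x w') y h.1 (h.2.symm.trans h'.2) (hxV x)
  · rintro ⟨y, b⟩ hy
    obtain ⟨u, hu, huP⟩ := hex x y hy b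
    refine mem_iUnion.mpr ⟨u x, hy, ?_⟩
    exact hu.symm.trans (huniq x _ _ huP (hsP x _) x (hxV x) (hs x _).symm hy)

/-- Over a simply connected space there is a flat map with any given initial value. -/
theorem exists_isFlatOver [SimplyConnectedSpace A] [LocallyPathConnectedSpace A]
    {P : (X → W) → X → Prop} (hP : IsFlatSystem P) (f : C(A, X)) (a₀ : A) (w₀ : W) :
    ∃ u : A → W, u a₀ = w₀ ∧ IsFlatOver P f u := by
  let _ := sheetTopology P
  have : Nonempty W := ⟨w₀⟩
  obtain ⟨F, ⟨hF0, hF⟩, -⟩ := @IsCoveringMap.existsUnique_continuousMap_lifts (X × W) X A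
    (sheetTopology P) _ _ Prod.fst (isCoveringMap_fst hP) _ _ f a₀ (f a₀, w₀) rfl
  have hF' : ∀ a, (F a).1 = f a := congrFun hF
  refine ⟨fun a => (F a).2, congrArg Prod.snd hF0, fun a => ?_⟩
  obtain ⟨V, hV, hxV, hex, -⟩ := hP.exists_nhds (f a)
  obtain ⟨v, hv, hvP⟩ := hex (f a) hxV (F a).2
  refine ⟨v, hvP _ hxV, ?_⟩
  have h := (isOpen_sheet hP hV hvP).preimage F.continuous
  filter_upwards [h.mem_nhds ⟨by rwa [hF'], by rw [hF', hv]⟩] with b hb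
  rw [Function.comp_apply, ← hF']
  exact hb.2

lemma IsFlatOver.eq [PreconnectedSpace A] {P : (X → W) → X → Prop} (hP : IsFlatSystem P)
    {f : A → X} (hf : Continuous f) {u v : A → W} (hu : IsFlatOver P f u) (hv : IsFlatOver P f v)
    {a₀ : A} (h : u a₀ = v a₀) : u = v := by
  have key : ∀ a, ∃ O ∈ 𝓝 a, ∀ b ∈ O, ∀ c ∈ O, u b = v b → u c = v c := by
    intro a
    obtain ⟨V, hV, hxV, hex, huniq⟩ := hP.exists_nhds (f a)
    have loc : ∀ {w : A → W}, IsFlatOver P f w →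
        ∃ s, (∀ z ∈ V, P s z) ∧ w =ᶠ[𝓝 a] s ∘ f := by
      intro w hw
      obtain ⟨w', hw', hww⟩ := hw a
      obtain ⟨s, hs, hsP⟩ := hex (f a) hxV (w' (f a))
      refine ⟨s, hsP, hww.trans ?_⟩
      exact hf.continuousAt.eventually (hP.eventuallyEq hw' (hsP _ hxV) hs.symm)
    obtain ⟨s, hs, hus⟩ := loc hu
    obtain ⟨t, ht, hvt⟩ := loc hv
    refine ⟨_, (hus.and hvt).and (hf.continuousAt.preimage_mem_nhds (hV.mem_nhds hxV)), ?_⟩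
    rintro b ⟨⟨hb, hb'⟩, hbV⟩ c ⟨⟨hc, hc'⟩, hcV⟩ hbb
    rw [hc, hc']
    exact huniq s t hs ht (f b) hbV (by rw [hb, hb'] at hbb; exact hbb) hcV
  have hclopen : IsClopen {a | u a = v a} := by
    refine ⟨⟨?_⟩, ?_⟩ <;> rw [isOpen_iff_mem_nhds] <;> intro a ha <;>
      obtain ⟨O, hO, hOO⟩ := key a
    · exact mem_of_superset hO fun b hb hbb => ha (hOO b hb a (mem_of_mem_nhds hO) hbb)
    · exact mem_of_superset hO fun b hb => hOO a (mem_of_mem_nhds hO) b hb ha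
  funext a
  exact (Set.ext_iff.mp (hclopen.eq_univ ⟨a₀, h⟩) a).mpr (mem_univ a)

end Monodromy

section Deck

open Topology

variable {M Mt : Type*} [TopologicalSpace M] [TopologicalSpace Mt]

/-- The lift of the covering through itself that moves `x` to the point `y` of the same fibre. -/
lemma exists_homeomorph_of_isCoveringMap [SimplyConnectedSpace Mt] [LocallyPathConnectedSpace Mt]
    {π : C(Mt, M)} (hπ : IsCoveringMap π) {x y : Mt} (hxy : π y = π x) :
    ∃ φ : Mt ≃ₜ Mt, (∀ z, π (φ z) = π z) ∧ φ x = y := by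
  obtain ⟨F, ⟨hF0, hF⟩, -⟩ := hπ.existsUnique_continuousMap_lifts π x y hxy
  obtain ⟨G, ⟨hG0, hG⟩, -⟩ := hπ.existsUnique_continuousMap_lifts π y x hxy.symm
  have hF' : ∀ z, π (F z) = π z := congrFun hF
  have hG' : ∀ z, π (G z) = π z := congrFun hG
  have h1 : G ∘ F = id := hπ.eq_of_comp_eq (G.continuous.comp F.continuous) continuous_id
    (by funext z; simp [hF', hG']) x (by simp [hF0, hG0])
  have h2 : F ∘ G = id := hπ.eq_of_comp_eq (F.continuous.comp G.continuous) continuous_id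
    (by funext z; simp [hF', hG']) y (by simp [hF0, hG0])
  exact ⟨⟨⟨F, G, congrFun h1, congrFun h2⟩, F.continuous, G.continuous⟩, hF', hF0⟩

theorem exists_isDeckTransformationOf [SimplyConnectedSpace Mt] [LocallyPathConnectedSpace Mt]
    {π : C(Mt, M)} (hπ : IsCoveringMap π) {x₀ : Mt} (γ : FundamentalGroup M (π x₀)) :
    ∃ φ : Mt ≃ₜ Mt, IsDeckTransformationOf π x₀ γ φ := by
  obtain ⟨p, hp⟩ := Path.Homotopic.Quotient.mk_surjective γ.toPath
  obtain ⟨Γ, hΓ, hΓ0⟩ := hπ.exists_path_lifts p.symm x₀ (by simp)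
  have hΓ' : ∀ t, π (Γ t) = p.symm t := congrFun hΓ
  obtain ⟨φ, hφ, hφx⟩ := exists_homeomorph_of_isCoveringMap hπ (x := x₀) (y := Γ 1)
    (by rw [hΓ']; simp)
  refine ⟨φ, hφ, (Path.mk Γ hΓ0 hφx.symm).symm, ?_⟩
  have : (((Path.mk Γ hΓ0 hφx.symm).symm.map π.continuous).cast (hφ x₀).symm rfl) = p := by
    ext t
    simp [hΓ']
  rw [this, hp]

theorem IsDeckTransformationOf.eq [PreconnectedSpace Mt] {π : C(Mt, M)} (hπ : IsCoveringMap π)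
    {x₀ : Mt} {γ : FundamentalGroup M (π x₀)} {φ ψ : Mt ≃ₜ Mt}
    (h : IsDeckTransformationOf π x₀ γ φ) (h' : IsDeckTransformationOf π x₀ γ ψ) : φ = ψ := by
  obtain ⟨hφ, c, hc⟩ := h
  obtain ⟨hψ, d, hd⟩ := h'
  have hcd : Path.Homotopic ((c.map π.continuous).cast (hφ x₀).symm rfl)
      ((d.map π.continuous).cast (hψ x₀).symm rfl) := by
    have := hc.symm.trans hd
    exact Path.Homotopic.Quotient.exact this
  have h0 : φ x₀ = ψ x₀ := by
    have := hπ.liftPath_apply_one_eq_of_homotopicRel (hcd.symm₂) x₀ (by simp) (by simp)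
    rw [← (hπ.eq_liftPath_iff' (Γ := (c.symm : C(_, Mt))) (by simp)).mpr
      ⟨by funext t; simp, by simp⟩, ← (hπ.eq_liftPath_iff' (Γ := (d.symm : C(_, Mt)))
      (by simp)).mpr ⟨by funext t; simp, by simp⟩] at this
    simpa using this
  have := hπ.eq_of_comp_eq φ.continuous ψ.continuous
    (by funext z; simp [hφ, hψ]) x₀ h0
  exact Homeomorph.ext (congrFun this)

theorem IsDeckTransformationOf.mul {π : C(Mt, M)}
    {x₀ : Mt} {γ δ : FundamentalGroup M (π x₀)} {φ ψ : Mt ≃ₜ Mt}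
    (h : IsDeckTransformationOf π x₀ γ φ) (h' : IsDeckTransformationOf π x₀ δ ψ) :
    IsDeckTransformationOf π x₀ (γ * δ) (ψ.trans φ) := by
  obtain ⟨hφ, c, rfl⟩ := h
  obtain ⟨hψ, d, rfl⟩ := h'
  refine ⟨fun x => by simp [hφ, hψ], (d.map φ.continuous).trans c, ?_⟩
  rw [FundamentalGroup.mul_def]
  refine (Path.Homotopic.Quotient.mk_trans _ _).symm.trans ?_
  congr 1
  ext t
  refine (Path.trans_apply _ _ _).trans ?_
  change _ = π (((d.map φ.continuous).trans c) t)
  rw [Path.trans_apply]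
  split_ifs <;> simp [hφ]

end Deck

/-! ### Riemannian metrics on open subsets of a vector space -/

section LeviCivita

open Topology

variable {E F₁ F₂ F₃ : Type*} [NormedAddCommGroup E] [NormedSpace ℝ E]
  [NormedAddCommGroup F₁] [NormedSpace ℝ F₁] [NormedAddCommGroup F₂] [NormedSpace ℝ F₂]
  [NormedAddCommGroup F₃] [NormedSpace ℝ F₃]

lemma hasFDerivAt_apply₁ {B : E → F₁ →L[ℝ] F₂} {a : E → F₁} {x : E}
    {B' : E →L[ℝ] F₁ →L[ℝ] F₂} {a' : E →L[ℝ] F₁}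
    (hB : HasFDerivAt B B' x) (ha : HasFDerivAt a a' x) (u : E) :
    fderiv ℝ (fun y => B y (a y)) x u = B' u (a x) + B x (a' u) := by
  rw [(hB.clm_apply ha).fderiv]
  simp [add_comm]

lemma hasFDerivAt_apply₂ {B : E → F₁ →L[ℝ] F₂ →L[ℝ] F₃} {a : E → F₁} {b : E → F₂} {x : E}
    {B' : E →L[ℝ] F₁ →L[ℝ] F₂ →L[ℝ] F₃} {a' : E →L[ℝ] F₁} {b' : E →L[ℝ] F₂}
    (hB : HasFDerivAt B B' x) (ha : HasFDerivAt a a' x) (hb : HasFDerivAt b b' x) (u : E) :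
    fderiv ℝ (fun y => B y (a y) (b y)) x u
      = B' u (a x) (b x) + B x (a' u) (b x) + B x (a x) (b' u) := by
  rw [((hB.clm_apply ha).clm_apply hb).fderiv]
  simp
  abel

/-- On the open set `U`, `G` is a Riemannian metric and `Γ` its Levi-Civita connection: the
covariant derivative of the vector field `X` in the direction `v` is `DX v + Γ v X`. -/
structure IsLeviCivitaOn (G : E → E →L[ℝ] E →L[ℝ] ℝ) (Γ : E → E →L[ℝ] E →L[ℝ] E)
    (U : Set E) : Prop where
  isOpen : IsOpen U
  contDiffOn_metric : ContDiffOn ℝ ∞ G U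
  contDiffOn : ContDiffOn ℝ ∞ Γ U
  symm_metric : ∀ x ∈ U, ∀ u v, G x u v = G x v u
  pos : ∀ x ∈ U, ∀ v, v ≠ 0 → 0 < G x v v
  symm : ∀ x ∈ U, ∀ u v, Γ x u v = Γ x v u
  compat : ∀ x ∈ U, ∀ u v w, fderiv ℝ G x u v w = G x (Γ x u v) w + G x v (Γ x u w)

/-- The curvature operator of the connection `Γ`. -/
def curvature (Γ : E → E →L[ℝ] E →L[ℝ] E) (x : E) (u v : E) : E →L[ℝ] E :=
  fderiv ℝ Γ x u v - fderiv ℝ Γ x v u + (Γ x u).comp (Γ x v) - (Γ x v).comp (Γ x u)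

lemma curvature_apply (Γ : E → E →L[ℝ] E →L[ℝ] E) (x u v w : E) :
    curvature Γ x u v w = fderiv ℝ Γ x u v w - fderiv ℝ Γ x v u w
      + Γ x u (Γ x v w) - Γ x v (Γ x u w) := rfl

lemma curvature_swap (Γ : E → E →L[ℝ] E →L[ℝ] E) (x u v : E) :
    curvature Γ x u v = - curvature Γ x v u := by
  unfold curvature
  abel

lemma hasFDerivAt_of_contDiffOn {f : E → F₁} {U : Set E} (hf : ContDiffOn ℝ ∞ f U) (hU : IsOpen U)
    {x : E} (hx : x ∈ U) : HasFDerivAt f (fderiv ℝ f x) x :=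
  ((hf.contDiffAt (hU.mem_nhds hx)).differentiableAt (by simp)).hasFDerivAt

lemma contDiffOn_fderiv {f : E → F₁} {U : Set E} (hf : ContDiffOn ℝ ∞ f U) (hU : IsOpen U) :
    ContDiffOn ℝ ∞ (fderiv ℝ f) U :=
  hf.fderiv_of_isOpen hU (by simp)

lemma fderiv_fderiv_symm {f : E → F₁} {U : Set E} (hf : ContDiffOn ℝ ∞ f U) (hU : IsOpen U)
    {x : E} (hx : x ∈ U) (u v : E) :
    fderiv ℝ (fderiv ℝ f) x u v = fderiv ℝ (fderiv ℝ f) x v u :=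
  (hf.contDiffAt (hU.mem_nhds hx)).isSymmSndFDerivAt
    (by simpa using WithTop.coe_le_coe.mpr (le_top : (2 : ℕ∞) ≤ ⊤)) u v

variable {G : E → E →L[ℝ] E →L[ℝ] ℝ} {Γ : E → E →L[ℝ] E →L[ℝ] E} {U : Set E} {x : E}

namespace IsLeviCivitaOn

lemma hasFDerivAt_metric (h : IsLeviCivitaOn G Γ U) (hx : x ∈ U) :
    HasFDerivAt G (fderiv ℝ G x) x :=
  hasFDerivAt_of_contDiffOn h.contDiffOn_metric h.isOpen hx

lemma hasFDerivAt (h : IsLeviCivitaOn G Γ U) (hx : x ∈ U) : HasFDerivAt Γ (fderiv ℝ Γ x) x :=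
  hasFDerivAt_of_contDiffOn h.contDiffOn h.isOpen hx

lemma eq_zero (h : IsLeviCivitaOn G Γ U) (hx : x ∈ U) {u : E} (hu : ∀ v, G x u v = 0) : u = 0 := by
  by_contra hne
  exact (h.pos x hx u hne).ne' (hu u)

lemma fderiv_symm (h : IsLeviCivitaOn G Γ U) (hx : x ∈ U) (u v w : E) :
    fderiv ℝ Γ x u v w = fderiv ℝ Γ x u w v := by
  have h1 : (fun y => Γ y v w) =ᶠ[𝓝 x] fun y => Γ y w v := by
    filter_upwards [h.isOpen.mem_nhds hx] with y hy using h.symm y hy v w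
  have h2 := h1.fderiv_eq (𝕜 := ℝ)
  have h3 := fun v w => hasFDerivAt_apply₂ (h.hasFDerivAt hx) (hasFDerivAt_const v x)
    (hasFDerivAt_const w x) u
  have := h3 v w
  rw [h2, h3 w v] at this
  simpa using this.symm

lemma fderiv_curvature (h : IsLeviCivitaOn G Γ U) (hx : x ∈ U) (t u v : E) :
    HasFDerivAt (fun y => curvature Γ y u v) (fderiv ℝ (fun y => curvature Γ y u v) x) x ∧
    fderiv ℝ (fun y => curvature Γ y u v) x t =
      fderiv ℝ (fderiv ℝ Γ) x t u v - fderiv ℝ (fderiv ℝ Γ) x t v u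
      + ((Γ x u).comp (fderiv ℝ Γ x t v) + (fderiv ℝ Γ x t u).comp (Γ x v))
      - ((Γ x v).comp (fderiv ℝ Γ x t u) + (fderiv ℝ Γ x t v).comp (Γ x u)) := by
  have h1 := h.hasFDerivAt hx
  have h2 := hasFDerivAt_of_contDiffOn (contDiffOn_fderiv h.contDiffOn h.isOpen) h.isOpen hx
  have hc := fun u => h1.clm_apply (hasFDerivAt_const u x)
  have hd := fun u v => (h2.clm_apply (hasFDerivAt_const u x)).clm_apply (hasFDerivAt_const v x)
  have := (((hd u v).sub (hd v u)).add ((hc u).clm_comp (hc v))).sub ((hc v).clm_comp (hc u))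
  refine ⟨this.differentiableAt.hasFDerivAt, ?_⟩
  refine (congrArg (fun L => L t) this.fderiv).trans ?_
  simp

/-- The second Bianchi identity. -/
lemma bianchi_second (h : IsLeviCivitaOn G Γ U) (hx : x ∈ U) (t u v : E) :
    (fderiv ℝ (fun y => curvature Γ y u v) x t + (Γ x t).comp (curvature Γ x u v)
        - (curvature Γ x u v).comp (Γ x t))
    + (fderiv ℝ (fun y => curvature Γ y v t) x u + (Γ x u).comp (curvature Γ x v t)
        - (curvature Γ x v t).comp (Γ x u))
    + (fderiv ℝ (fun y => curvature Γ y t u) x v + (Γ x v).comp (curvature Γ x t u)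
        - (curvature Γ x t u).comp (Γ x v)) = 0 := by
  rw [(h.fderiv_curvature hx t u v).2, (h.fderiv_curvature hx u v t).2,
    (h.fderiv_curvature hx v t u).2]
  have hs := fderiv_fderiv_symm h.contDiffOn h.isOpen hx
  rw [hs u t, hs v t, hs v u]
  unfold curvature
  ext w
  simp
  abel

lemma curvature_skew (h : IsLeviCivitaOn G Γ U) (hx : x ∈ U) (u v w z : E) :
    G x (curvature Γ x u v w) z = - G x w (curvature Γ x u v z) := by
  have key : ∀ u v, fderiv ℝ (fderiv ℝ G) x u v w z =
      (fderiv ℝ G x u (Γ x v w) z + G x (fderiv ℝ Γ x u v w) z)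
      + (fderiv ℝ G x u w (Γ x v z) + G x w (fderiv ℝ Γ x u v z)) := by
    intro u v
    have hc := fun z : E => hasFDerivAt_const (𝕜 := ℝ) z x
    have h2 := hasFDerivAt_of_contDiffOn (contDiffOn_fderiv h.contDiffOn_metric h.isOpen)
      h.isOpen hx
    have h3 := fun a => ((h.hasFDerivAt hx).clm_apply (hc v)).clm_apply (hc a)
    have e1 : fderiv ℝ (fderiv ℝ G) x u v w z = fderiv ℝ (fun y => fderiv ℝ G y v w z) x u := by
      have := hasFDerivAt_apply₂ (h2.clm_apply (hc v)) (hc w) (hc z) u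
      rw [this]
      simp
    have e2 : (fun y => fderiv ℝ G y v w z) =ᶠ[𝓝 x]
        fun y => G y (Γ y v w) z + G y w (Γ y v z) := by
      filter_upwards [h.isOpen.mem_nhds hx] with y hy using h.compat y hy v w z
    have d1 := ((h.hasFDerivAt_metric hx).clm_apply (h3 w)).clm_apply (hc z)
    have d2 := ((h.hasFDerivAt_metric hx).clm_apply (hc w)).clm_apply (h3 z)
    rw [e1, ((d1.add d2).congr_of_eventuallyEq e2).fderiv]
    simp
    ring
  have hs := congrArg (fun L => L w z)
    (fderiv_fderiv_symm h.contDiffOn_metric h.isOpen hx u v)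
  simp only [key, h.compat x hx] at hs
  simp only [curvature_apply, map_add, map_sub, add_apply, sub_apply]
  linarith

end IsLeviCivitaOn

/-- The Levi-Civita connection transforms under an isometry like a connection. -/
lemma IsLeviCivitaOn.map_connection {G' : E → E →L[ℝ] E →L[ℝ] ℝ} {Γ' : E → E →L[ℝ] E →L[ℝ] E}
    {U' : Set E} (h : IsLeviCivitaOn G Γ U) (h' : IsLeviCivitaOn G' Γ' U') {φ : E → E}
    (hφ : ContDiffOn ℝ ∞ φ U) (hmaps : Set.MapsTo φ U U')
    (hG : ∀ y ∈ U, ∀ u v, G y u v = G' (φ y) (fderiv ℝ φ y u) (fderiv ℝ φ y v))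
    (hx : x ∈ U) (hsurj : Function.Surjective (fderiv ℝ φ x)) (u v : E) :
    fderiv ℝ φ x (Γ x u v) = fderiv ℝ (fderiv ℝ φ) x u v
      + Γ' (φ x) (fderiv ℝ φ x u) (fderiv ℝ φ x v) := by
  set δ : E → E → E := fun u v => fderiv ℝ φ x (Γ x u v) - fderiv ℝ (fderiv ℝ φ) x u v
      - Γ' (φ x) (fderiv ℝ φ x u) (fderiv ℝ φ x v) with hδ
  suffices hz : δ u v = 0 by
    rw [hδ] at hz
    simp only [sub_eq_zero] at hz
    rw [← hz]
    abel
  have hsym : ∀ u v, δ u v = δ v u := fun u v => by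
    simp only [hδ]
    rw [h.symm x hx u v, fderiv_fderiv_symm hφ h.isOpen hx u v, h'.symm _ (hmaps hx)]
  have hskew : ∀ u v w, G' (φ x) (δ u v) (fderiv ℝ φ x w)
      = - G' (φ x) (δ u w) (fderiv ℝ φ x v) := by
    intro u v w
    have hc := fun z : E => hasFDerivAt_const (𝕜 := ℝ) z x
    have h1 := hasFDerivAt_of_contDiffOn hφ h.isOpen hx
    have h2 := hasFDerivAt_of_contDiffOn (contDiffOn_fderiv hφ h.isOpen) h.isOpen hx
    have e1 := hasFDerivAt_apply₂ (h.hasFDerivAt_metric hx) (hc v) (hc w) u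
    have e2 : (fun y => G y v w) =ᶠ[𝓝 x]
        fun y => G' (φ y) (fderiv ℝ φ y v) (fderiv ℝ φ y w) := by
      filter_upwards [h.isOpen.mem_nhds hx] with y hy using hG y hy v w
    have e3 := hasFDerivAt_apply₂ ((h'.hasFDerivAt_metric (hmaps hx)).comp x h1)
      (h2.clm_apply (hc v)) (h2.clm_apply (hc w)) u
    have e4 := e1.symm.trans ((congrArg (fun L : E →L[ℝ] ℝ => L u) e2.fderiv_eq).trans e3)
    simp [h.compat x hx, h'.compat _ (hmaps hx), hG x hx] at e4
    have e5 := h'.symm_metric _ (hmaps hx) (fderiv ℝ φ x v) (fderiv ℝ φ x (Γ x u w))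
    have e6 := h'.symm_metric _ (hmaps hx) (fderiv ℝ φ x v) (fderiv ℝ (fderiv ℝ φ) x u w)
    have e7 := h'.symm_metric _ (hmaps hx) (fderiv ℝ φ x v)
      (Γ' (φ x) (fderiv ℝ φ x u) (fderiv ℝ φ x w))
    simp only [hδ, map_sub, sub_apply]
    linarith
  refine h'.eq_zero (hmaps hx) fun z => ?_
  obtain ⟨w, rfl⟩ := hsurj z
  have a1 := hskew u v w
  have a2 := hskew w u v
  have a3 := hskew v w u
  rw [hsym w u] at a2
  rw [hsym v w] at a3
  rw [hsym v u] at a3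
  have a4 := hskew w v u
  linarith

lemma IsLeviCivitaOn.map_curvature {G' : E → E →L[ℝ] E →L[ℝ] ℝ} {Γ' : E → E →L[ℝ] E →L[ℝ] E}
    {U' : Set E} (h : IsLeviCivitaOn G Γ U) (h' : IsLeviCivitaOn G' Γ' U') {φ : E → E}
    (hφ : ContDiffOn ℝ ∞ φ U) (hmaps : Set.MapsTo φ U U')
    (hG : ∀ y ∈ U, ∀ u v, G y u v = G' (φ y) (fderiv ℝ φ y u) (fderiv ℝ φ y v))
    (hsurj : ∀ y ∈ U, Function.Surjective (fderiv ℝ φ y)) (hx : x ∈ U) (u v w : E) :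
    fderiv ℝ φ x (curvature Γ x u v w)
      = curvature Γ' (φ x) (fderiv ℝ φ x u) (fderiv ℝ φ x v) (fderiv ℝ φ x w) := by
  have law := fun y hy => h.map_connection h' hφ hmaps hG (x := y) hy (hsurj y hy)
  have hc := fun z : E => hasFDerivAt_const (𝕜 := ℝ) z x
  have h1 := hasFDerivAt_of_contDiffOn hφ h.isOpen hx
  have hφ2 := contDiffOn_fderiv hφ h.isOpen
  have h2 := hasFDerivAt_of_contDiffOn hφ2 h.isOpen hx
  have h3 := hasFDerivAt_of_contDiffOn (contDiffOn_fderiv hφ2 h.isOpen) h.isOpen hx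
  have key : ∀ u v, fderiv ℝ (fderiv ℝ φ) x u (Γ x v w) + fderiv ℝ φ x (fderiv ℝ Γ x u v w)
      = fderiv ℝ (fderiv ℝ (fderiv ℝ φ)) x u v w
        + (fderiv ℝ Γ' (φ x) (fderiv ℝ φ x u) (fderiv ℝ φ x v) (fderiv ℝ φ x w)
        + Γ' (φ x) (fderiv ℝ (fderiv ℝ φ) x u v) (fderiv ℝ φ x w)
        + Γ' (φ x) (fderiv ℝ φ x v) (fderiv ℝ (fderiv ℝ φ) x u w)) := by
    intro u v
    have e1 := hasFDerivAt_apply₁ h2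
      (((h.hasFDerivAt hx).clm_apply (hc v)).clm_apply (hc w)) u
    have e2 : (fun y => fderiv ℝ φ y (Γ y v w)) =ᶠ[𝓝 x] fun y => fderiv ℝ (fderiv ℝ φ) y v w
        + Γ' (φ y) (fderiv ℝ φ y v) (fderiv ℝ φ y w) := by
      filter_upwards [h.isOpen.mem_nhds hx] with y hy using law y hy v w
    have d1 := (h3.clm_apply (hc v)).clm_apply (hc w)
    have d2 := ((((h'.hasFDerivAt (hmaps hx)).comp x h1).clm_apply
      (h2.clm_apply (hc v))).clm_apply (h2.clm_apply (hc w)))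
    have e4 := e1.symm.trans (congrArg (fun L : E →L[ℝ] E => L u)
      ((d1.add d2).congr_of_eventuallyEq e2).fderiv)
    simp at e4
    rw [e4]
    abel
  have k1 := key u v
  have k2 := key v u
  have hs3 : fderiv ℝ (fderiv ℝ (fderiv ℝ φ)) x u v w
      = fderiv ℝ (fderiv ℝ (fderiv ℝ φ)) x v u w := by
    rw [fderiv_fderiv_symm hφ2 h.isOpen hx]
  have l1 := law x hx u (Γ x v w)
  have l2 := law x hx v (Γ x u w)
  rw [law x hx v w] at l1
  rw [law x hx u w] at l2
  rw [fderiv_fderiv_symm hφ h.isOpen hx v u] at k2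
  simp only [map_add] at l1 l2
  simp only [curvature_apply, map_add, map_sub, l1, l2]
  rw [hs3] at k1
  have k3 := sub_eq_zero.mpr k1
  have k4 := sub_eq_zero.mpr k2
  have k5 := k3.trans k4.symm
  rw [← sub_eq_zero] at k5 ⊢
  rw [← k5]
  abel

end LeviCivita

section Codazzi

open Topology Module

variable {E F : Type*} [NormedAddCommGroup E] [NormedSpace ℝ E]
  [NormedAddCommGroup F] [NormedSpace ℝ F]

/-- The covariant derivative `(∇_u S)(v, w)` of a bilinear form. -/
def covDeriv (Γ : E → E →L[ℝ] E →L[ℝ] E) (S : E → E →L[ℝ] E →L[ℝ] ℝ) (x u v w : E) : ℝ :=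
  fderiv ℝ S x u v w - S x (Γ x u v) w - S x v (Γ x u w)

/-- The Codazzi equation: the covariant derivative of the bilinear form `S` is symmetric. -/
def IsCodazziAt (Γ : E → E →L[ℝ] E →L[ℝ] E) (S : E → E →L[ℝ] E →L[ℝ] ℝ) (x : E) : Prop :=
  ∀ u v w, covDeriv Γ S x u v w = covDeriv Γ S x v u w

/-- The Kulkarni-Nomizu product `(S ∧ G)(u, v, w, z)` of two bilinear forms. -/
def kulkarni (S G : E →L[ℝ] E →L[ℝ] ℝ) (u v w z : E) : ℝ :=
  S v w * G u z - S u w * G v z + G v w * S u z - G u w * S v z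

lemma exists_unit_orthogonal [FiniteDimensional ℝ E] {b : E →L[ℝ] E →L[ℝ] ℝ}
    (hb : ∀ v, v ≠ 0 → 0 < b v v) {k : ℕ} (hk : k < finrank ℝ E) (v : Fin k → E) :
    ∃ u, b u u = 1 ∧ ∀ i, b (v i) u = 0 := by
  let f : E →ₗ[ℝ] (Fin k → ℝ) := LinearMap.pi fun i => (b (v i)).toLinearMap
  obtain ⟨u, hu, hne⟩ := (Submodule.ne_bot_iff _).mp
    (LinearMap.ker_ne_bot_of_finrank_lt (f := f) (by simpa using hk))
  have hp := hb u hne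
  refine ⟨(√(b u u))⁻¹ • u, ?_, fun i => ?_⟩
  · simp only [map_smul, smul_apply, smul_eq_mul]
    rw [← mul_assoc, ← mul_inv, Real.mul_self_sqrt hp.le, inv_mul_cancel₀ hp.ne']
  · have : b (v i) u = 0 := congrFun (LinearMap.mem_ker.mp hu) i
    rw [map_smul, this, smul_zero]

/-- The algebra by which the second Bianchi identity yields the vanishing of the Cotton tensor in
dimension at least four. -/
lemma eq_zero_of_cyclic [FiniteDimensional ℝ E] (hn : 4 ≤ finrank ℝ E) {G : E →L[ℝ] E →L[ℝ] ℝ}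
    (hG : ∀ v, v ≠ 0 → 0 < G v v) (hsymm : ∀ u v, G u v = G v u) {C : E → E → E → ℝ}
    (hC : ∀ u v w, C u v w = - C v u w)
    (h : ∀ t u v w z, C t v w * G u z + C v u w * G t z + C u t w * G v z
      - (C t v z * G u w + C v u z * G t w + C u t z * G v w) = 0) (t v w : E) :
    C t v w = 0 := by
  have key : ∀ t v w u, G u u = 1 → G t u = 0 → G v u = 0 → G w u = 0 →
      C t v w = C u t u * G v w - C u v u * G t w := by
    intro t v w u h1 h2 h3 h4
    have := h t u v w u
    rw [h1, h2, h3, hsymm u w, h4, hC v u u] at this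
    linarith
  have flip : ∀ u u' t, G u u = 1 → G u' u' = 1 → G u u' = 0 → G t u = 0 → G t u' = 0 →
      C u' t u' = - C u t u := by
    intro u u' t h1 h2 h3 h4 h5
    have := key u' t u' u h1 (by rw [hsymm, h3]) h4 (by rw [hsymm, h3])
    rw [h5, h2] at this
    linarith
  have zero : ∀ u t, G u u = 1 → G t u = 0 → C u t u = 0 := by
    intro u t h1 h2
    obtain ⟨u', h1', h2'⟩ := exists_unit_orthogonal hG (k := 2) (by omega) ![u, t]
    obtain ⟨u'', h1'', h2''⟩ := exists_unit_orthogonal hG (k := 3) (by omega) ![u, u', t]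
    have a1 : G u u' = 0 := h2' 0
    have a2 : G t u' = 0 := h2' 1
    have a3 : G u u'' = 0 := h2'' 0
    have a4 : G u' u'' = 0 := h2'' 1
    have a5 : G t u'' = 0 := h2'' 2
    have e1 := flip u u' t h1 h1' a1 h2 a2
    have e2 := flip u' u'' t h1' h1'' a4 a2 a5
    have e3 := flip u u'' t h1 h1'' a3 h2 a5
    linarith
  obtain ⟨u, h1, h2⟩ := exists_unit_orthogonal hG (k := 3) (by omega) ![t, v, w]
  rw [key t v w u h1 (h2 0) (h2 1) (h2 2), zero u t h1 (h2 0), zero u v h1 (h2 1)]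
  ring

variable {G S : E → E →L[ℝ] E →L[ℝ] ℝ} {Γ : E → E →L[ℝ] E →L[ℝ] E} {U : Set E} {x : E}

/-- In dimension at least four, a bilinear form whose Kulkarni-Nomizu product with the metric is
the curvature tensor satisfies the Codazzi equation. -/
theorem IsLeviCivitaOn.isCodazziAt [FiniteDimensional ℝ E] (hn : 4 ≤ finrank ℝ E)
    (h : IsLeviCivitaOn G Γ U) (hS : ContDiffOn ℝ ∞ S U)
    (hR : ∀ x ∈ U, ∀ u v w z, G x (curvature Γ x u v w) z = kulkarni (S x) (G x) u v w z)
    (hx : x ∈ U) : IsCodazziAt Γ S x := by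
  have hc := fun z : E => hasFDerivAt_const (𝕜 := ℝ) z x
  have dS := hasFDerivAt_of_contDiffOn hS h.isOpen hx
  have dG := h.hasFDerivAt_metric hx
  have hDR : ∀ t u v w z, G x (fderiv ℝ (fun y => curvature Γ y u v) x t w
      + Γ x t (curvature Γ x u v w) - curvature Γ x u v (Γ x t w)) z
      = covDeriv Γ S x t v w * G x u z - covDeriv Γ S x t u w * G x v z
        + G x v w * covDeriv Γ S x t u z - G x u w * covDeriv Γ S x t v z
        + kulkarni (S x) (G x) (Γ x t u) v w z + kulkarni (S x) (G x) u (Γ x t v) w z := by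
    intro t u v w z
    have dR := (h.fderiv_curvature hx t u v).1
    have e1 := hasFDerivAt_apply₂ dG (dR.clm_apply (hc w)) (hc z) t
    have s := fun a b => (dS.clm_apply (hc a)).clm_apply (hc b)
    have g := fun a b => (dG.clm_apply (hc a)).clm_apply (hc b)
    have d := ((((s v w).mul (g u z)).sub ((s u w).mul (g v z))).add
      ((g v w).mul (s u z))).sub ((g u w).mul (s v z))
    have e2 : (fun y => G y (curvature Γ y u v w) z) =ᶠ[𝓝 x]
        fun y => kulkarni (S y) (G y) u v w z := by
      filter_upwards [h.isOpen.mem_nhds hx] with y hy using hR y hy u v w z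
    have e3 := e1.symm.trans (congrArg (fun L : E →L[ℝ] ℝ => L t)
      (d.congr_of_eventuallyEq e2).fderiv)
    simp [h.compat x hx] at e3
    have r1 := hR x hx u v w (Γ x t z)
    have r2 := hR x hx u v (Γ x t w) z
    simp only [kulkarni] at r1 r2 ⊢
    simp only [map_add, map_sub, add_apply, sub_apply, covDeriv, r2]
    rw [r1] at e3
    linear_combination e3
  have hcyc := fun t u v w z => congrArg (fun L => G x (L w) z) (h.bianchi_second hx t u v)
  have hB : ∀ t u v w z, (covDeriv Γ S x t v w - covDeriv Γ S x v t w) * G x u z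
      + (covDeriv Γ S x v u w - covDeriv Γ S x u v w) * G x t z
      + (covDeriv Γ S x u t w - covDeriv Γ S x t u w) * G x v z
      - ((covDeriv Γ S x t v z - covDeriv Γ S x v t z) * G x u w
      + (covDeriv Γ S x v u z - covDeriv Γ S x u v z) * G x t w
      + (covDeriv Γ S x u t z - covDeriv Γ S x t u z) * G x v w) = 0 := by
    intro t u v w z
    have e := hcyc t u v w z
    simp only [add_apply, sub_apply, ContinuousLinearMap.comp_apply, map_add, zero_apply,
      map_zero] at e
    have e1 := hDR t u v w z
    have e2 := hDR u v t w z
    have e3 := hDR v t u w z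
    simp only [map_add, map_sub, add_apply, sub_apply] at e e1 e2 e3
    rw [h.symm x hx u t] at e2
    rw [h.symm x hx v t, h.symm x hx v u] at e3
    simp only [kulkarni] at e1 e2 e3
    linear_combination e - e1 - e2 - e3
  intro u v w
  refine sub_eq_zero.mp (eq_zero_of_cyclic hn (h.pos x hx) (h.symm_metric x hx)
    (C := fun u v w => covDeriv Γ S x u v w - covDeriv Γ S x v u w)
    (fun u v w => by ring) hB u v w)

end Codazzi

section BilinearMaps

open Module

variable {E E' F : Type*} [NormedAddCommGroup E] [NormedSpace ℝ E] [FiniteDimensional ℝ E]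
  [NormedAddCommGroup E'] [NormedSpace ℝ E'] [FiniteDimensional ℝ E']
  [NormedAddCommGroup F] [NormedSpace ℝ F]

/-- A bilinear map of finite dimensional spaces as a continuous bilinear map. -/
def toBilin (B : E →ₗ[ℝ] E' →ₗ[ℝ] F) : E →L[ℝ] E' →L[ℝ] F :=
  LinearMap.toContinuousLinearMap ((LinearMap.toContinuousLinearMap
    (𝕜 := ℝ) (E := E') (F' := F)).toLinearMap ∘ₗ B)

@[simp] lemma toBilin_apply (B : E →ₗ[ℝ] E' →ₗ[ℝ] F) (u : E) (v : E') :
    toBilin B u v = B u v := rfl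

lemma contDiffOn_bilin {X : Type*} [NormedAddCommGroup X] [NormedSpace ℝ X]
    {B : X → E →L[ℝ] E' →L[ℝ] F} {U : Set X}
    (h : ∀ u v, ContDiffOn ℝ ∞ (fun x => B x u v) U) : ContDiffOn ℝ ∞ B U :=
  contDiffOn_clm_apply.mpr fun u => contDiffOn_clm_apply.mpr fun v => h u v

end BilinearMaps

/-! ### Conformally flat metrics -/

section Conformal

open Topology Module
open scoped RealInnerProductSpace Gradient

variable {E : Type*} [NormedAddCommGroup E] [InnerProductSpace ℝ E] [FiniteDimensional ℝ E]

/-- The Levi-Civita connection of the metric `exp (2 φ) ⟪·, ·⟫`. -/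
def conformalConnection (φ : E → ℝ) (x : E) : E →L[ℝ] E →L[ℝ] E :=
  toBilin <| LinearMap.mk₂ ℝ
    (fun u v => fderiv ℝ φ x u • v + fderiv ℝ φ x v • u - ⟪u, v⟫ • ∇ φ x)
    (fun u u' v => by simp only [map_add, inner_add_left]; module)
    (fun c u v => by simp only [map_smul, inner_smul_left, smul_eq_mul, conj_trivial]; module)
    (fun u v v' => by simp only [map_add, inner_add_right]; module)
    (fun c u v => by simp only [map_smul, inner_smul_right, smul_eq_mul]; module)

lemma conformalConnection_apply (φ : E → ℝ) (x u v : E) : conformalConnection φ x u v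
    = fderiv ℝ φ x u • v + fderiv ℝ φ x v • u - ⟪u, v⟫ • ∇ φ x := rfl

/-- The Schouten tensor of the metric `exp (2 φ) ⟪·, ·⟫`. -/
def conformalSchouten (φ : E → ℝ) (x : E) : E →L[ℝ] E →L[ℝ] ℝ :=
  toBilin <| LinearMap.mk₂ ℝ
    (fun u v => - fderiv ℝ (fderiv ℝ φ) x u v + fderiv ℝ φ x u * fderiv ℝ φ x v
      - ⟪∇ φ x, ∇ φ x⟫ * (1 / 2) * ⟪u, v⟫)
    (fun u u' v => by simp only [map_add, inner_add_left, add_apply]; ring)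
    (fun c u v => by
      simp only [map_smul, inner_smul_left, smul_eq_mul, conj_trivial, smul_apply]; ring)
    (fun u v v' => by simp only [map_add, inner_add_right]; ring)
    (fun c u v => by simp only [map_smul, inner_smul_right, smul_eq_mul]; ring)

lemma conformalSchouten_apply (φ : E → ℝ) (x u v : E) : conformalSchouten φ x u v
    = - fderiv ℝ (fderiv ℝ φ) x u v + fderiv ℝ φ x u * fderiv ℝ φ x v
      - ⟪∇ φ x, ∇ φ x⟫ * (1 / 2) * ⟪u, v⟫ := rfl

variable {φ : E → ℝ} {G : E → E →L[ℝ] E →L[ℝ] ℝ} {U : Set E} {x : E}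

lemma contDiffOn_gradient (hU : IsOpen U) (hφ : ContDiffOn ℝ ∞ φ U) : ContDiffOn ℝ ∞ (∇ φ) U :=
  (InnerProductSpace.toDual ℝ E).symm.contDiff.comp_contDiffOn (contDiffOn_fderiv hφ hU)

lemma inner_gradient (φ : E → ℝ) (x u : E) : ⟪∇ φ x, u⟫ = fderiv ℝ φ x u := by
  rw [gradient, InnerProductSpace.toDual_symm_apply]

lemma inner_fderiv_gradient (hU : IsOpen U) (hφ : ContDiffOn ℝ ∞ φ U) (hx : x ∈ U) (u w : E) :
    ⟪fderiv ℝ (∇ φ) x u, w⟫ = fderiv ℝ (fderiv ℝ φ) x u w := by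
  have h := (InnerProductSpace.toDual ℝ E).symm.toContinuousLinearEquiv.toContinuousLinearMap
    |>.hasFDerivAt.comp x (hasFDerivAt_of_contDiffOn (contDiffOn_fderiv hφ hU) hU hx)
  have e : fderiv ℝ (∇ φ) x u
      = (InnerProductSpace.toDual ℝ E).symm (fderiv ℝ (fderiv ℝ φ) x u) := by
    exact congrArg (fun L : E →L[ℝ] E => L u) h.fderiv
  rw [e, InnerProductSpace.toDual_symm_apply]

theorem isLeviCivitaOn_conformal (hU : IsOpen U) (hφ : ContDiffOn ℝ ∞ φ U)
    (hG : ∀ x ∈ U, ∀ u v, G x u v = Real.exp (2 * φ x) * ⟪u, v⟫) :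
    IsLeviCivitaOn G (conformalConnection φ) U := by
  have hf := contDiffOn_fderiv hφ hU
  have hgr := contDiffOn_gradient hU hφ
  refine ⟨hU, contDiffOn_bilin fun u v => ?_, contDiffOn_bilin fun u v => ?_, fun x hx u v => ?_,
    fun x hx v hv => ?_, fun x hx u v => ?_, fun x hx u v w => ?_⟩
  · refine ContDiffOn.congr ?_ fun x hx => hG x hx u v
    exact ((contDiffOn_const.mul hφ).exp).mul contDiffOn_const
  · have := fun u => hf.clm_apply (contDiffOn_const (c := u))
    exact (((this u).smul contDiffOn_const).add ((this v).smul contDiffOn_const)).sub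
      (contDiffOn_const.smul hgr)
  · rw [hG x hx, hG x hx, real_inner_comm]
  · rw [hG x hx]
    have := real_inner_self_pos.mpr hv
    positivity
  · simp only [conformalConnection_apply, real_inner_comm u v]
    abel
  · have hGs : ContDiffOn ℝ ∞ G U := contDiffOn_bilin fun u v =>
      ContDiffOn.congr (((contDiffOn_const.mul hφ).exp).mul contDiffOn_const)
        fun x hx => hG x hx u v
    have hc := fun z : E => hasFDerivAt_const (𝕜 := ℝ) z x
    have e1 := hasFDerivAt_apply₂ (hasFDerivAt_of_contDiffOn hGs hU hx) (hc v) (hc w) u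
    have d := (((hasFDerivAt_of_contDiffOn hφ hU hx).const_mul 2).exp).mul_const ⟪v, w⟫
    have e2 : (fun y => G y v w) =ᶠ[𝓝 x] fun y => Real.exp (2 * φ y) * ⟪v, w⟫ := by
      filter_upwards [hU.mem_nhds hx] with y hy using hG y hy v w
    have e3 := e1.symm.trans (congrArg (fun L : E →L[ℝ] ℝ => L u)
      (d.congr_of_eventuallyEq e2).fderiv)
    simp at e3
    rw [e3, hG x hx, hG x hx]
    simp only [conformalConnection_apply, inner_add_left, inner_sub_left, inner_smul_left,
      inner_add_right, inner_sub_right, inner_smul_right, conj_trivial, inner_gradient,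
      real_inner_comm (∇ φ x) v, real_inner_comm u v]
    ring

/-- The curvature tensor of a conformally flat metric is the Kulkarni-Nomizu product of the
metric and the Schouten tensor. -/
theorem curvature_conformalConnection (hU : IsOpen U) (hφ : ContDiffOn ℝ ∞ φ U)
    (hG : ∀ x ∈ U, ∀ u v, G x u v = Real.exp (2 * φ x) * ⟪u, v⟫) (hx : x ∈ U) (u v w z : E) :
    G x (curvature (conformalConnection φ) x u v w) z
      = kulkarni (conformalSchouten φ x) (G x) u v w z := by
  have hLC := isLeviCivitaOn_conformal hU hφ hG
  have hc := fun z : E => hasFDerivAt_const (𝕜 := ℝ) z x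
  have da := hasFDerivAt_of_contDiffOn (contDiffOn_fderiv hφ hU) hU hx
  have dg := hasFDerivAt_of_contDiffOn (contDiffOn_gradient hU hφ) hU hx
  have hD : ∀ u v, fderiv ℝ (conformalConnection φ) x u v w
      = fderiv ℝ (fderiv ℝ φ) x u v • w + fderiv ℝ (fderiv ℝ φ) x u w • v
        - ⟪v, w⟫ • fderiv ℝ (∇ φ) x u := by
    intro u v
    have e1 := hasFDerivAt_apply₂ (hLC.hasFDerivAt hx) (hc v) (hc w) u
    have d := (((da.clm_apply (hc v)).smul_const w).add ((da.clm_apply (hc w)).smul_const v)).sub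
      (dg.const_smul ⟪v, w⟫)
    have := e1.symm.trans (congrArg (fun L : E →L[ℝ] E => L u) d.fderiv)
    simpa using this
  have hs := fderiv_fderiv_symm hφ hU hx u v
  rw [hG x hx]
  simp only [curvature_apply, hD, hs, conformalConnection_apply, kulkarni, hG x hx,
    conformalSchouten_apply, inner_add_left, inner_sub_left, inner_smul_left, conj_trivial,
    inner_gradient, map_add, map_sub, map_smul, inner_fderiv_gradient hU hφ hx, real_inner_comm u v]
  rw [← inner_gradient φ x (∇ φ x), real_inner_comm (∇ φ x) u, real_inner_comm (∇ φ x) v,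
    inner_gradient, inner_gradient, inner_gradient]
  ring

theorem isCodazziAt_conformalSchouten (hU : IsOpen U) (hφ : ContDiffOn ℝ ∞ φ U) (hx : x ∈ U) :
    ContDiffOn ℝ ∞ (conformalSchouten φ) U ∧
    IsCodazziAt (conformalConnection φ) (conformalSchouten φ) x := by
  have hf := contDiffOn_fderiv hφ hU
  have hff := contDiffOn_fderiv hf hU
  have hgr := contDiffOn_gradient hU hφ
  have hS : ContDiffOn ℝ ∞ (conformalSchouten φ) U := by
    refine contDiffOn_bilin fun u v => ?_
    have := fun u => hf.clm_apply (contDiffOn_const (c := u))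
    exact (((hff.clm_apply contDiffOn_const).clm_apply contDiffOn_const).neg.add
      ((this u).mul (this v))).sub (((hgr.inner ℝ hgr).mul contDiffOn_const).mul contDiffOn_const)
  refine ⟨hS, ?_⟩
  have hc := fun z : E => hasFDerivAt_const (𝕜 := ℝ) z x
  have da := hasFDerivAt_of_contDiffOn hf hU hx
  have dda := hasFDerivAt_of_contDiffOn hff hU hx
  have dg := hasFDerivAt_of_contDiffOn hgr hU hx
  have hD : ∀ u v w, fderiv ℝ (conformalSchouten φ) x u v w
      = - fderiv ℝ (fderiv ℝ (fderiv ℝ φ)) x u v w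
        + (fderiv ℝ (fderiv ℝ φ) x u v * fderiv ℝ φ x w
          + fderiv ℝ φ x v * fderiv ℝ (fderiv ℝ φ) x u w)
        - fderiv ℝ (fderiv ℝ φ) x u (∇ φ x) * ⟪v, w⟫ := by
    intro u v w
    have e1 := hasFDerivAt_apply₂ (hasFDerivAt_of_contDiffOn hS hU hx) (hc v) (hc w) u
    have d := ((((dda.clm_apply (hc v)).clm_apply (hc w)).neg.add
      ((da.clm_apply (hc v)).mul (da.clm_apply (hc w)))).sub
      (((dg.inner ℝ dg).mul_const (1 / 2)).mul_const ⟪v, w⟫))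
    have e2 : (fun y => conformalSchouten φ y v w) =ᶠ[𝓝 x] _ :=
      Filter.Eventually.of_forall fun y => conformalSchouten_apply φ y v w
    have := e1.symm.trans (congrArg (fun L : E →L[ℝ] ℝ => L u)
      (d.congr_of_eventuallyEq e2).fderiv)
    simp [inner_fderiv_gradient hU hφ hx, real_inner_comm (fderiv ℝ (∇ φ) x u) (∇ φ x)] at this
    rw [this]
    ring
  intro u v w
  have s2 := fderiv_fderiv_symm hφ hU hx
  have s3 : fderiv ℝ (fderiv ℝ (fderiv ℝ φ)) x u v w
      = fderiv ℝ (fderiv ℝ (fderiv ℝ φ)) x v u w := by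
    rw [fderiv_fderiv_symm hf hU hx]
  simp only [covDeriv, hD, conformalConnection_apply, map_add, map_sub, map_smul, add_apply,
    sub_apply, smul_apply, smul_eq_mul, conformalSchouten_apply, inner_gradient, s3, s2 v u]
  rw [real_inner_comm (∇ φ x) v, real_inner_comm (∇ φ x) u]
  simp only [inner_gradient, s2 (∇ φ x), real_inner_comm u v]
  rw [real_inner_comm w u, real_inner_comm w v]
  ring

end Conformal

/-! ### Recovering the Schouten tensor from the curvature -/

section Curvature

open Topology

variable {E : Type*} [NormedAddCommGroup E] [NormedSpace ℝ E]

/-- The endomorphism `u ↦ R(u, v)w`. -/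
def curvatureEnd (Γ : E → E →L[ℝ] E →L[ℝ] E) (x v w : E) : E →L[ℝ] E :=
  ((fderiv ℝ Γ x).flip v).flip w - (fderiv ℝ Γ x v).flip w
    + (Γ x).flip (Γ x v w) - (Γ x v).comp ((Γ x).flip w)

lemma curvatureEnd_apply (Γ : E → E →L[ℝ] E →L[ℝ] E) (x u v w : E) :
    curvatureEnd Γ x v w u = curvature Γ x u v w := rfl

lemma IsCodazziAt.congr {Γ : E → E →L[ℝ] E →L[ℝ] E} {x : E}
    {S S' : E → E →L[ℝ] E →L[ℝ] ℝ} (h : IsCodazziAt Γ S x) (hS : S' =ᶠ[𝓝 x] S) :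
    IsCodazziAt Γ S' x := by
  intro u v w
  have := h u v w
  unfold covDeriv at this ⊢
  rwa [hS.fderiv_eq, hS.eq_of_nhds]

end Curvature

section Schouten

open Topology Module

variable {E : Type*} [NormedAddCommGroup E] [NormedSpace ℝ E] [FiniteDimensional ℝ E]

/-- The trace, as a continuous linear form on endomorphisms. -/
def traceCLM (E : Type*) [NormedAddCommGroup E] [NormedSpace ℝ E] [FiniteDimensional ℝ E] :
    (E →L[ℝ] E) →L[ℝ] ℝ :=
  LinearMap.toContinuousLinearMap
    (LinearMap.trace ℝ E ∘ₗ (ContinuousLinearMap.coeLM ℝ : (E →L[ℝ] E) →ₗ[ℝ] E →ₗ[ℝ] E))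

lemma traceCLM_apply (L : E →L[ℝ] E) : traceCLM E L = LinearMap.trace ℝ E L := rfl

@[simp] lemma traceCLM_id : traceCLM E (ContinuousLinearMap.id ℝ E) = finrank ℝ E := by
  rw [traceCLM_apply]
  exact LinearMap.trace_id ℝ E

@[simp] lemma traceCLM_smulRight (f : E →L[ℝ] ℝ) (v : E) :
    traceCLM E (f.smulRight v) = f v := by
  rw [traceCLM_apply]
  exact LinearMap.trace_smulRight f.toLinearMap v

lemma exists_equiv_of_pos {b : E →L[ℝ] E →L[ℝ] ℝ} (hb : ∀ v, v ≠ 0 → 0 < b v v) :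
    ∃ e : E ≃L[ℝ] (E →L[ℝ] ℝ), (e : E →L[ℝ] E →L[ℝ] ℝ) = b := by
  have hinj : Function.Injective b.toLinearMap := by
    rw [← LinearMap.ker_eq_bot, LinearMap.ker_eq_bot']
    intro v hv
    by_contra hne
    have := hb v hne
    have h0 : b v = 0 := hv
    rw [h0] at this
    simp at this
  have hfin : finrank ℝ E = finrank ℝ (E →L[ℝ] ℝ) := by
    rw [← (LinearMap.toContinuousLinearMap (𝕜 := ℝ) (E := E) (F' := ℝ)).finrank_eq]
    exact (Subspace.dual_finrank_eq (K := ℝ) (V := E)).symm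
  exact ⟨(LinearEquiv.ofInjectiveOfFinrankEq b.toLinearMap hinj hfin).toContinuousLinearEquiv, rfl⟩

/-- The endomorphism that corresponds to the bilinear form `S` by means of the metric `b`. -/
def sharp (b S : E →L[ℝ] E →L[ℝ] ℝ) : E →L[ℝ] E := (ContinuousLinearMap.inverse b).comp S

lemma apply_sharp {b : E →L[ℝ] E →L[ℝ] ℝ} (hb : ∀ v, v ≠ 0 → 0 < b v v)
    (S : E →L[ℝ] E →L[ℝ] ℝ) (u : E) : b (sharp b S u) = S u := by
  obtain ⟨e, rfl⟩ := exists_equiv_of_pos hb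
  simp [sharp]

lemma eq_of_apply_eq {b : E →L[ℝ] E →L[ℝ] ℝ} (hb : ∀ v, v ≠ 0 → 0 < b v v) {u v : E}
    (h : ∀ w, b u w = b v w) : u = v := by
  obtain ⟨e, rfl⟩ := exists_equiv_of_pos hb
  exact e.injective (ContinuousLinearMap.ext h)

variable {G : E → E →L[ℝ] E →L[ℝ] ℝ} {Γ : E → E →L[ℝ] E →L[ℝ] E} {U : Set E} {x : E}

lemma IsLeviCivitaOn.contDiffOn_sharp (h : IsLeviCivitaOn G Γ U) {S : E → E →L[ℝ] E →L[ℝ] ℝ}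
    (hS : ContDiffOn ℝ ∞ S U) : ContDiffOn ℝ ∞ (fun x => sharp (G x) (S x)) U := by
  refine ContDiffOn.clm_comp (fun x hx => ?_) hS
  obtain ⟨e, he⟩ := exists_equiv_of_pos (h.pos x hx)
  have h1 := contDiffAt_map_inverse (𝕜 := ℝ) (n := ∞) e
  rw [he] at h1
  exact (h1.comp x (h.contDiffOn_metric.contDiffAt (h.isOpen.mem_nhds hx))).contDiffWithinAt

/-- The Ricci tensor. -/
def ricci (Γ : E → E →L[ℝ] E →L[ℝ] E) (x : E) : E →L[ℝ] E →L[ℝ] ℝ :=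
  toBilin <| LinearMap.mk₂ ℝ (fun v w => traceCLM E (curvatureEnd Γ x v w))
    (fun v v' w => by
      rw [← map_add]; congr 1; ext u
      simp only [curvatureEnd_apply, add_apply, curvature_apply, map_add]; abel)
    (fun c v w => by
      rw [← map_smul]; congr 1; ext u
      simp only [curvatureEnd_apply, smul_apply, curvature_apply, map_smul]; module)
    (fun v w w' => by
      rw [← map_add]; congr 1; ext u
      simp only [curvatureEnd_apply, add_apply, map_add])
    (fun c v w => by
      rw [← map_smul]; congr 1; ext u
      simp only [curvatureEnd_apply, smul_apply, map_smul])

lemma ricci_apply (Γ : E → E →L[ℝ] E →L[ℝ] E) (x v w : E) :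
    ricci Γ x v w = traceCLM E (curvatureEnd Γ x v w) := rfl

lemma IsLeviCivitaOn.contDiffOn_ricci (h : IsLeviCivitaOn G Γ U) :
    ContDiffOn ℝ ∞ (ricci Γ) U := by
  refine contDiffOn_bilin fun v w => (traceCLM E).contDiff.comp_contDiffOn ?_
  refine contDiffOn_clm_apply.mpr fun u => ?_
  have h1 := fun u v => (h.contDiffOn.clm_apply (contDiffOn_const (c := u))).clm_apply
    (contDiffOn_const (c := v))
  have h2 := fun u v => ((contDiffOn_fderiv h.contDiffOn h.isOpen).clm_apply
    (contDiffOn_const (c := u))).clm_apply (contDiffOn_const (c := v))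
  have h3 := fun u v w => (h.contDiffOn.clm_apply (contDiffOn_const (c := u))).clm_apply (h1 v w)
  exact ((((h2 u v).clm_apply contDiffOn_const).sub ((h2 v u).clm_apply contDiffOn_const)).add
    (h3 u v w)).sub (h3 v u w)

/-- The Schouten tensor of a metric, in terms of the Ricci tensor. -/
def schouten (G : E → E →L[ℝ] E →L[ℝ] ℝ) (Γ : E → E →L[ℝ] E →L[ℝ] E) (x : E) :
    E →L[ℝ] E →L[ℝ] ℝ :=
  (1 / ((finrank ℝ E : ℝ) - 2)) • (ricci Γ x
    - (traceCLM E (sharp (G x) (ricci Γ x)) / (2 * (finrank ℝ E : ℝ) - 2)) • G x)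

lemma IsLeviCivitaOn.contDiffOn_schouten (h : IsLeviCivitaOn G Γ U) :
    ContDiffOn ℝ ∞ (schouten G Γ) U :=
  ContDiffOn.smul (f := fun _ => (1 / ((finrank ℝ E : ℝ) - 2))) contDiffOn_const
    (h.contDiffOn_ricci.sub ((((traceCLM E).contDiff.comp_contDiffOn
    (h.contDiffOn_sharp h.contDiffOn_ricci)).div_const _).smul h.contDiffOn_metric))

/-- If the curvature tensor is the Kulkarni-Nomizu product of `G` and a bilinear form `S`, then
`S` is the Schouten tensor. -/
theorem IsLeviCivitaOn.eq_schouten (h : IsLeviCivitaOn G Γ U) (hn : 3 ≤ finrank ℝ E) (hx : x ∈ U)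
    {S : E →L[ℝ] E →L[ℝ] ℝ}
    (hR : ∀ u v w z, G x (curvature Γ x u v w) z = kulkarni S (G x) u v w z) :
    S = schouten G Γ x := by
  have hpos := h.pos x hx
  set A := sharp (G x) S with hA
  have hAS : ∀ u z, G x (A u) z = S u z := fun u z => by rw [hA, apply_sharp hpos]
  have hric : ricci Γ x = ((finrank ℝ E : ℝ) - 2) • S + traceCLM E A • G x := by
    ext v w
    have e : curvatureEnd Γ x v w = S v w • ContinuousLinearMap.id ℝ E
        - (S.flip w).smulRight v + G x v w • A - ((G x).flip w).smulRight (A v) := by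
      ext u
      refine eq_of_apply_eq hpos fun z => ?_
      rw [curvatureEnd_apply, hR]
      simp [kulkarni, hAS]
    rw [ricci_apply, e]
    simp [hAS]
    ring
  have hsh : sharp (G x) (ricci Γ x)
      = ((finrank ℝ E : ℝ) - 2) • A + traceCLM E A • ContinuousLinearMap.id ℝ E := by
    ext u
    refine eq_of_apply_eq hpos fun z => ?_
    rw [apply_sharp hpos, hric]
    simp [hAS]
  have h3 : (3 : ℝ) ≤ finrank ℝ E := by exact_mod_cast hn
  have h2 : (finrank ℝ E : ℝ) - 2 ≠ 0 := by linarith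
  have h1 : 2 * (finrank ℝ E : ℝ) - 2 ≠ 0 := by linarith
  have htr : traceCLM E (sharp (G x) (ricci Γ x)) / (2 * (finrank ℝ E : ℝ) - 2)
      = traceCLM E A := by
    rw [hsh, div_eq_iff h1]
    simp
    ring
  rw [schouten, htr, hric, add_sub_cancel_right, smul_smul, one_div, inv_mul_cancel₀ h2, one_smul]

end Schouten

/-! ### Metrics whose Schouten tensor has two eigenvalues -/

section QC

open Topology Module

variable {E : Type*} [NormedAddCommGroup E] [NormedSpace ℝ E]

/-- The bilinear form `(H / 2) b + (N - H) b(ξ, ·) ⊗ b(ξ, ·)`. -/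
def qcSchouten (b : E →L[ℝ] E →L[ℝ] ℝ) (H N : ℝ) (ξ : E) : E →L[ℝ] E →L[ℝ] ℝ :=
  (H / 2) • b + (N - H) • (b ξ).smulRight (b ξ)

@[simp] lemma qcSchouten_apply (b : E →L[ℝ] E →L[ℝ] ℝ) (H N : ℝ) (ξ u v : E) :
    qcSchouten b H N ξ u v = H / 2 * b u v + (N - H) * (b ξ u * b ξ v) := by
  simp [qcSchouten]

/-- The metric `G` on the open set `U` has horizontal and vertical curvatures `H` and `N` with
respect to the unit vector `ξ`, and its Schouten tensor satisfies the Codazzi equation. No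
regularity of `H`, `N` and `ξ` is assumed. -/
structure IsQCOn (G : E → E →L[ℝ] E →L[ℝ] ℝ) (Γ : E → E →L[ℝ] E →L[ℝ] E) (U : Set E)
    (H N : E → ℝ) (ξ : E → E) : Prop extends IsLeviCivitaOn G Γ U where
  unit : ∀ x ∈ U, G x (ξ x) (ξ x) = 1
  curv : ∀ x ∈ U, ∀ u v w z, G x (curvature Γ x u v w) z
    = kulkarni (qcSchouten (G x) (H x) (N x) (ξ x)) (G x) u v w z
  codazzi : ∀ x ∈ U, IsCodazziAt Γ (fun y => qcSchouten (G y) (H y) (N y) (ξ y)) x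

namespace IsQCOn

variable [FiniteDimensional ℝ E] {G : E → E →L[ℝ] E →L[ℝ] ℝ} {Γ : E → E →L[ℝ] E →L[ℝ] E}
  {U : Set E} {H N : E → ℝ} {ξ : E → E} {x : E}

lemma contDiffOn_qcSchouten (h : IsQCOn G Γ U H N ξ) (hn : 3 ≤ finrank ℝ E) :
    ContDiffOn ℝ ∞ (fun x => qcSchouten (G x) (H x) (N x) (ξ x)) U :=
  h.contDiffOn_schouten.congr fun x hx => h.eq_schouten hn hx (h.curv x hx)

lemma sharp_qcSchouten (h : IsQCOn G Γ U H N ξ) (hx : x ∈ U) :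
    sharp (G x) (qcSchouten (G x) (H x) (N x) (ξ x))
      = (H x / 2) • ContinuousLinearMap.id ℝ E + (N x - H x) • (G x (ξ x)).smulRight (ξ x) := by
  ext u
  refine eq_of_apply_eq (h.pos x hx) fun z => ?_
  rw [apply_sharp (h.pos x hx)]
  simp

/-- The vertical and the horizontal curvature are smooth: the square and the cube of their
difference are, up to constants, traces of powers of the trace-free part of the Schouten tensor. -/
theorem contDiffOn_curvatures (h : IsQCOn G Γ U H N ξ) (hn : 3 ≤ finrank ℝ E)
    {E₀ : Type*} [NormedAddCommGroup E₀] [InnerProductSpace ℝ E₀] [FiniteDimensional ℝ E₀]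
    (e : E₀ ≃L[ℝ] E) :
    ContDiffOn ℝ ∞ (fun x => N x - H x) U ∧ ContDiffOn ℝ ∞ H U := by
  set m : ℝ := ((finrank ℝ E : ℕ) : ℝ) with hm
  have h3 : (3 : ℝ) ≤ m := by rw [hm]; exact_mod_cast hn
  have hm0 : m ≠ 0 := by linarith
  set A : E → E →L[ℝ] E := fun x => sharp (G x) (qcSchouten (G x) (H x) (N x) (ξ x)) with hA
  have hAs : ContDiffOn ℝ ∞ A U := h.contDiffOn_sharp (h.contDiffOn_qcSchouten hn)
  have htr : ∀ {B : E → E →L[ℝ] E}, ContDiffOn ℝ ∞ B U →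
      ContDiffOn ℝ ∞ (fun x => traceCLM E (B x)) U :=
    fun hB => (traceCLM E).contDiff.comp_contDiffOn hB
  have htA : ∀ x ∈ U, traceCLM E (A x) = m * (H x / 2) + (N x - H x) := by
    intro x hx
    simp only [hA, h.sharp_qcSchouten hx, map_add, map_smul, traceCLM_id, traceCLM_smulRight,
      h.unit x hx, smul_eq_mul]
    ring
  set T : E → E →L[ℝ] E := fun x => A x - (traceCLM E (A x) / m) • ContinuousLinearMap.id ℝ E
    with hT
  have hTs : ContDiffOn ℝ ∞ T U := hAs.sub (((htr hAs).div_const _).smul contDiffOn_const)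
  have hTx : ∀ x ∈ U, T x = (N x - H x) • ((G x (ξ x)).smulRight (ξ x)
      - (1 / m) • ContinuousLinearMap.id ℝ E) := by
    intro x hx
    change A x - (traceCLM E (A x) / m) • _ = _
    rw [htA x hx]
    simp only [hA, h.sharp_qcSchouten hx]
    ext u
    simp
    match_scalars <;> field_simp
    ring
  have h2 : ContDiffOn ℝ ∞ (fun x => (N x - H x) ^ 2) U := by
    refine ((htr (hTs.clm_comp hTs)).div_const (1 - 1 / m)).congr fun x hx => ?_
    have hne : 1 - 1 / m ≠ 0 := by
      have : 1 / m < 1 := by rw [div_lt_one] <;> linarith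
      linarith
    have e : (T x).comp (T x) = (N x - H x) ^ 2 • ((1 - 2 / m) • (G x (ξ x)).smulRight (ξ x)
        + (1 / m ^ 2) • ContinuousLinearMap.id ℝ E) := by
      rw [hTx x hx]
      ext u
      simp [h.unit x hx]
      match_scalars <;> field_simp
      ring
    rw [e, eq_div_iff hne]
    simp only [map_add, map_smul, traceCLM_id, traceCLM_smulRight, h.unit x hx, smul_eq_mul, ← hm]
    field_simp
    ring
  have hcube : ContDiffOn ℝ ∞ (fun x => (N x - H x) ^ 3) U := by
    refine ((htr (hTs.clm_comp (hTs.clm_comp hTs))).div_const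
      ((m - 1) * (m - 2) / m ^ 2)).congr fun x hx => ?_
    have hne : (m - 1) * (m - 2) / m ^ 2 ≠ 0 :=
      div_ne_zero (mul_ne_zero (by linarith) (by linarith)) (pow_ne_zero _ hm0)
    have e : (T x).comp ((T x).comp (T x)) = (N x - H x) ^ 3 •
        ((1 - 3 / m + 3 / m ^ 2) • (G x (ξ x)).smulRight (ξ x)
        - (1 / m ^ 3) • ContinuousLinearMap.id ℝ E) := by
      rw [hTx x hx]
      ext u
      simp [h.unit x hx]
      match_scalars <;> field_simp
      ring
    rw [e, eq_div_iff hne]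
    simp only [map_sub, map_smul, traceCLM_id, traceCLM_smulRight, h.unit x hx, smul_eq_mul,
      ← hm]
    field_simp
    ring
  have hmu : ContDiffOn ℝ ∞ (fun x => N x - H x) U := by
    have hpre := h.isOpen.preimage e.continuous
    have hmaps : Set.MapsTo e (e ⁻¹' U) U := fun _ h => h
    have := contDiffOn_of_sq_of_cube hpre (f := fun y => N (e y) - H (e y))
      (h2.comp e.contDiff.contDiffOn hmaps) (hcube.comp e.contDiff.contDiffOn hmaps)
    have h' := this.comp (g := fun y => N (e y) - H (e y)) (f := e.symm) (s := U)
      e.symm.contDiff.contDiffOn (fun x hx => by simpa using hx)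
    exact h'.congr fun x hx => by simp
  refine ⟨hmu, ((((htr hAs).sub hmu).mul (contDiffOn_const (c := 2 / m)))).congr fun x hx => ?_⟩
  simp only [htA x hx]
  field_simp
  ring

end IsQCOn

end QC

/-! ### The equations of Gauss and Codazzi -/

section GaussCodazzi

open Topology Module

variable {E : Type*} [NormedAddCommGroup E] [NormedSpace ℝ E]

/-- The prospective second fundamental form. -/
def secondForm (b : E →L[ℝ] E →L[ℝ] ℝ) (H N κ : ℝ) (ξ : E) : E →L[ℝ] E →L[ℝ] ℝ :=
  √(H + κ) • b + ((N - H) / √(H + κ)) • (b ξ).smulRight (b ξ)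

@[simp] lemma secondForm_apply (b : E →L[ℝ] E →L[ℝ] ℝ) (H N κ : ℝ) (ξ u v : E) :
    secondForm b H N κ ξ u v
      = √(H + κ) * b u v + (N - H) / √(H + κ) * (b ξ u * b ξ v) := by
  simp [secondForm]

/-- The shape operator: the endomorphism that corresponds to `secondForm`. -/
def shapeOperator (b : E →L[ℝ] E →L[ℝ] ℝ) (H N κ : ℝ) (ξ : E) : E →L[ℝ] E :=
  √(H + κ) • ContinuousLinearMap.id ℝ E + ((N - H) / √(H + κ)) • (b ξ).smulRight ξ

lemma shapeOperator_apply (b : E →L[ℝ] E →L[ℝ] ℝ) (H N κ : ℝ) (ξ u : E) :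
    shapeOperator b H N κ ξ u = √(H + κ) • u + ((N - H) / √(H + κ)) • (b ξ u • ξ) := by
  simp [shapeOperator]

lemma apply_shapeOperator (b : E →L[ℝ] E →L[ℝ] ℝ) (H N κ : ℝ) (ξ u v : E) :
    b (shapeOperator b H N κ ξ u) v = secondForm b H N κ ξ u v := by
  simp [shapeOperator_apply]

lemma secondForm_symm {b : E →L[ℝ] E →L[ℝ] ℝ} (hb : ∀ u v, b u v = b v u) (H N κ : ℝ)
    (ξ u v : E) : secondForm b H N κ ξ u v = secondForm b H N κ ξ v u := by
  rw [secondForm_apply, secondForm_apply, hb u v]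
  ring

lemma contDiffOn_sqrt {U : Set E} {H : E → ℝ} {κ : ℝ} (hH : ContDiffOn ℝ ∞ H U)
    (hκ : ∀ y ∈ U, 0 < H y + κ) : ContDiffOn ℝ ∞ (fun y => √(H y + κ)) U :=
  (hH.add contDiffOn_const).sqrt fun y hy => (hκ y hy).ne'

namespace IsQCOn

variable [FiniteDimensional ℝ E] {G : E → E →L[ℝ] E →L[ℝ] ℝ} {Γ : E → E →L[ℝ] E →L[ℝ] E}
  {U : Set E} {H N : E → ℝ} {ξ : E → E} {x : E} {κ : ℝ}

/-- The Gauss equation. -/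
lemma gauss (h : IsQCOn G Γ U H N ξ) (hx : x ∈ U) (hκ : 0 < H x + κ) (u v w : E) :
    curvature Γ x u v w
      = secondForm (G x) (H x) (N x) κ (ξ x) v w • shapeOperator (G x) (H x) (N x) κ (ξ x) u
      - secondForm (G x) (H x) (N x) κ (ξ x) u w • shapeOperator (G x) (H x) (N x) κ (ξ x) v
      - κ • (G x v w • u - G x u w • v) := by
  refine eq_of_apply_eq (h.pos x hx) fun z => ?_
  rw [h.curv x hx]
  set l := √(H x + κ) with hl
  have hl0 : l ≠ 0 := (Real.sqrt_pos.mpr hκ).ne'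
  have hl2 : l ^ 2 = H x + κ := Real.sq_sqrt hκ.le
  have hH : H x = l ^ 2 - κ := by linarith
  simp only [map_sub, map_smul, sub_apply, smul_apply, apply_shapeOperator, smul_eq_mul,
    kulkarni, qcSchouten_apply, secondForm_apply, ← hl]
  rw [hH]
  field_simp
  ring

/-- The covariant derivative of the Schouten tensor on vectors orthogonal to `ξ`: the remaining
part of the Schouten tensor has rank one. -/
lemma covDeriv_qcSchouten (h : IsQCOn G Γ U H N ξ) (hn : 3 ≤ finrank ℝ E)
    (hH : ContDiffOn ℝ ∞ H U) (hx : x ∈ U) (hμ : N x ≠ H x) (u v w : E)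
    (hv : G x (ξ x) v = 0) (hw : G x (ξ x) w = 0) :
    covDeriv Γ (fun y => qcSchouten (G y) (H y) (N y) (ξ y)) x u v w
      = fderiv ℝ H x u / 2 * G x v w := by
  set S := fun y => qcSchouten (G y) (H y) (N y) (ξ y) with hS
  have hc := fun z : E => hasFDerivAt_const (𝕜 := ℝ) z x
  have dS := hasFDerivAt_of_contDiffOn (h.contDiffOn_qcSchouten hn) h.isOpen hx
  have dG := h.hasFDerivAt_metric hx
  have dH := hasFDerivAt_of_contDiffOn hH h.isOpen hx
  set B : E → E → E → ℝ := fun a b y => S y a b - H y * (1 / 2) * G y a b with hB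
  have dB : ∀ a b, ∃ D : E →L[ℝ] ℝ, HasFDerivAt (B a b) D x ∧
      D u = fderiv ℝ S x u a b
        - (H x * (1 / 2) * fderiv ℝ G x u a b + G x a b * (1 / 2 * fderiv ℝ H x u)) := by
    intro a b
    refine ⟨_, ((dS.clm_apply (hc a)).clm_apply (hc b)).sub
      ((dH.mul_const (1 / 2)).mul ((dG.clm_apply (hc a)).clm_apply (hc b))), ?_⟩
    simp [hS]
  choose D hD hDu using dB
  have e : B v w * B (ξ x) (ξ x) = B v (ξ x) * B w (ξ x) := by
    funext y
    simp only [hB, hS, qcSchouten_apply, Pi.mul_apply]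
    ring
  have d1 := (hD v w).mul (hD (ξ x) (ξ x))
  rw [e] at d1
  have d3 := congrArg (fun L : E →L[ℝ] ℝ => L u)
    (d1.unique ((hD v (ξ x)).mul (hD w (ξ x))))
  have hs := h.symm_metric x hx
  have hvS : ∀ z, S x v z = H x / 2 * G x v z := fun z => by simp [hS, hv]
  have hwS : ∀ z, S x z w = H x / 2 * G x z w := fun z => by simp [hS, hw]
  have b1 : B v w x = 0 := by simp only [hB, hvS]; ring
  have b2 : B v (ξ x) x = 0 := by simp only [hB, hvS]; ring
  have b3 : B w (ξ x) x = 0 := by simp [hB, hS, hs w (ξ x), hw]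
  have b4 : B (ξ x) (ξ x) x = N x - H x := by
    simp only [hB, hS, qcSchouten_apply, h.unit x hx]; ring
  simp only [add_apply, smul_apply, smul_eq_mul, b1, b2, b3, b4, hDu, zero_mul, zero_add] at d3
  have hne : N x - H x ≠ 0 := sub_ne_zero.mpr hμ
  rcases mul_eq_zero.mp d3 with d5 | d5
  · exact absurd d5 hne
  · rw [covDeriv, hvS, hwS]
    have := h.compat x hx u v w
    rw [this] at d5
    linear_combination d5

/-- The horizontal curvature is constant in the directions orthogonal to `ξ`. -/
lemma fderiv_horizontal (h : IsQCOn G Γ U H N ξ) (hn : 3 ≤ finrank ℝ E)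
    (hH : ContDiffOn ℝ ∞ H U) (hx : x ∈ U) (hμ : N x ≠ H x) (u : E) :
    fderiv ℝ H x u = G x (ξ x) u * fderiv ℝ H x (ξ x) := by
  have key : ∀ u, G x (ξ x) u = 0 → fderiv ℝ H x u = 0 := by
    intro u hu
    obtain ⟨v, hv1, hv⟩ := exists_unit_orthogonal (h.pos x hx) (k := 2) (by omega) ![ξ x, u]
    have hv2 : G x (ξ x) v = 0 := hv 0
    have hv3 : G x u v = 0 := hv 1
    have := h.codazzi x hx u v v
    rw [h.covDeriv_qcSchouten hn hH hx hμ u v v hv2 hv2,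
      h.covDeriv_qcSchouten hn hH hx hμ v u v hu hv2, hv1, hv3] at this
    linarith
  have := key (u - G x (ξ x) u • ξ x) (by simp [h.unit x hx])
  rw [map_sub, map_smul, smul_eq_mul] at this
  linarith

lemma contDiffOn_shapeOperator (h : IsQCOn G Γ U H N ξ) (hn : 3 ≤ finrank ℝ E)
    (hH : ContDiffOn ℝ ∞ H U) (hκ : ∀ y ∈ U, 0 < H y + κ) :
    ContDiffOn ℝ ∞ (fun y => shapeOperator (G y) (H y) (N y) κ (ξ y)) U := by
  have hl := contDiffOn_sqrt hH hκ
  have hl0 : ∀ y ∈ U, √(H y + κ) ≠ 0 := fun y hy => (Real.sqrt_pos.mpr (hκ y hy)).ne'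
  have hA := h.contDiffOn_sharp (h.contDiffOn_qcSchouten hn)
  refine ((hl.smul (contDiffOn_const (c := ContinuousLinearMap.id ℝ E))).add
    ((hl.inv hl0).smul (hA.sub ((hH.div_const 2).smul
      (contDiffOn_const (c := ContinuousLinearMap.id ℝ E)))))).congr fun y hy => ?_
  simp only [Pi.smul_apply', Pi.inv_apply, h.sharp_qcSchouten hy,
    add_sub_cancel_left, shapeOperator, smul_smul]
  rw [div_eq_inv_mul]

lemma contDiffOn_secondForm (h : IsQCOn G Γ U H N ξ) (hn : 3 ≤ finrank ℝ E)
    (hH : ContDiffOn ℝ ∞ H U) (hκ : ∀ y ∈ U, 0 < H y + κ) :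
    ContDiffOn ℝ ∞ (fun y => secondForm (G y) (H y) (N y) κ (ξ y)) U :=
  (h.contDiffOn_metric.clm_comp (h.contDiffOn_shapeOperator hn hH hκ)).congr fun y _ => by
    ext u v
    exact (apply_shapeOperator _ _ _ _ _ _ _).symm

/-- The Codazzi equation for the prospective second fundamental form. -/
theorem isCodazziAt_secondForm (h : IsQCOn G Γ U H N ξ) (hn : 3 ≤ finrank ℝ E)
    (hH : ContDiffOn ℝ ∞ H U) (hκ : ∀ y ∈ U, 0 < H y + κ) (hx : x ∈ U) :
    IsCodazziAt Γ (fun y => secondForm (G y) (H y) (N y) κ (ξ y)) x := by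
  have hc := fun z : E => hasFDerivAt_const (𝕜 := ℝ) z x
  have dS := hasFDerivAt_of_contDiffOn (h.contDiffOn_qcSchouten hn) h.isOpen hx
  have dG := h.hasFDerivAt_metric hx
  have dH := hasFDerivAt_of_contDiffOn hH h.isOpen hx
  have dh := hasFDerivAt_of_contDiffOn (h.contDiffOn_secondForm hn hH hκ) h.isOpen hx
  have dl := (dH.add_const κ).sqrt (hκ x hx).ne'
  have hl0 : 0 < √(H x + κ) := Real.sqrt_pos.mpr (hκ x hx)
  have hcov : ∀ u v w, covDeriv Γ (fun y => secondForm (G y) (H y) (N y) κ (ξ y)) x u v w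
      = covDeriv Γ (fun y => qcSchouten (G y) (H y) (N y) (ξ y)) x u v w / √(H x + κ)
        - fderiv ℝ H x u / (2 * √(H x + κ) ^ 3) * ((N x - H x) * (G x (ξ x) v * G x (ξ x) w)) := by
    intro u v w
    have dB := ((dS.clm_apply (hc v)).clm_apply (hc w)).sub
      ((dH.mul_const (1 / 2)).mul ((dG.clm_apply (hc v)).clm_apply (hc w)))
    have e1 := hasFDerivAt_apply₂ dh (hc v) (hc w) u
    have e2 : (fun y => secondForm (G y) (H y) (N y) κ (ξ y) v w) =ᶠ[𝓝 x]
        fun y => √(H y + κ) * G y v w + (√(H y + κ))⁻¹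
          * (qcSchouten (G y) (H y) (N y) (ξ y) v w - H y * (1 / 2) * G y v w) := by
      refine Filter.Eventually.of_forall fun y => ?_
      simp only [secondForm_apply, qcSchouten_apply]
      ring
    have d := (dl.mul ((dG.clm_apply (hc v)).clm_apply (hc w))).add
      (((hasDerivAt_inv hl0.ne').comp_hasFDerivAt x dl).mul dB)
    have e3 := e1.symm.trans (congrArg (fun L : E →L[ℝ] ℝ => L u)
      (d.congr_of_eventuallyEq e2).fderiv)
    simp at e3
    have := h.compat x hx u v w
    simp only [covDeriv, e3, secondForm_apply, qcSchouten_apply, this]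
    field_simp
    ring
  intro u v w
  rw [hcov, hcov, h.codazzi x hx u v w]
  by_cases hμ : N x = H x
  · simp [hμ]
  · rw [h.fderiv_horizontal hn hH hx hμ u, h.fderiv_horizontal hn hH hx hμ v]
    ring

end IsQCOn

end GaussCodazzi

/-! ### The linear system of an immersed hypersurface -/

section Bonnet

open Topology Module

variable {E V : Type*} [NormedAddCommGroup E] [NormedSpace ℝ E] [FiniteDimensional ℝ E]
  [NormedAddCommGroup V] [NormedSpace ℝ V] [FiniteDimensional ℝ V]

/-- The values of an immersed hypersurface: position, differential and unit normal. -/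
abbrev Jet (E V : Type*) [NormedAddCommGroup E] [NormedSpace ℝ E]
    [NormedAddCommGroup V] [NormedSpace ℝ V] := V × (E →L[ℝ] V) × V

/-- The structure equations of a hypersurface with metric `b`, connection `Γ`, second fundamental
form `h` and shape operator `A`: the derivative of its jet `(F, Φ, ν)` in the direction `v` is
`(Φ v, Φ (Γ v ·) + h(v, ·) ν + κ b(v, ·) F, -Φ (A v))`. The last term of the second component is
the normal component with respect to the hyperboloid `⟨x, x⟩ = -1 / κ`. -/
def structureMap (V : Type*) [NormedAddCommGroup V] [NormedSpace ℝ V] [FiniteDimensional ℝ V]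
    (κ : ℝ) (Γ : E →L[ℝ] E →L[ℝ] E) (h b : E →L[ℝ] E →L[ℝ] ℝ) (A : E →L[ℝ] E) :
    E →L[ℝ] Jet E V →L[ℝ] Jet E V :=
  toBilin <| LinearMap.mk₂ ℝ (fun v (p : Jet E V) =>
    (p.2.1 v, p.2.1.comp (Γ v) + (h v).smulRight p.2.2 + κ • (b v).smulRight p.1, - p.2.1 (A v)))
    (fun u v p => by
      refine Prod.ext (by simp) (Prod.ext ?_ (by simp; abel))
      ext w; simp; module)
    (fun c v p => by
      refine Prod.ext (by simp) (Prod.ext ?_ (by simp))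
      ext w; simp; module)
    (fun v p q => by
      refine Prod.ext (by simp) (Prod.ext ?_ (by simp; abel))
      ext w; simp; module)
    (fun c v p => by
      refine Prod.ext (by simp) (Prod.ext ?_ (by simp))
      ext w; simp; module)

lemma structureMap_apply (κ : ℝ) (Γ : E →L[ℝ] E →L[ℝ] E) (h b : E →L[ℝ] E →L[ℝ] ℝ)
    (A : E →L[ℝ] E) (v : E) (p : Jet E V) :
    structureMap V κ Γ h b A v p = (p.2.1 v,
      p.2.1.comp (Γ v) + (h v).smulRight p.2.2 + κ • (b v).smulRight p.1, - p.2.1 (A v)) := rfl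

/-- The structure equations for a metric with two curvatures. -/
def bonnetSystem (V : Type*) [NormedAddCommGroup V] [NormedSpace ℝ V] [FiniteDimensional ℝ V]
    (κ : ℝ) (G : E → E →L[ℝ] E →L[ℝ] ℝ) (Γ : E → E →L[ℝ] E →L[ℝ] E)
    (H N : E → ℝ) (ξ : E → E) (x : E) : E →L[ℝ] Jet E V →L[ℝ] Jet E V :=
  structureMap V κ (Γ x) (secondForm (G x) (H x) (N x) κ (ξ x)) (G x)
    (shapeOperator (G x) (H x) (N x) κ (ξ x))

variable {G : E → E →L[ℝ] E →L[ℝ] ℝ} {Γ : E → E →L[ℝ] E →L[ℝ] E}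
  {U : Set E} {H N : E → ℝ} {ξ : E → E} {x : E} {κ : ℝ}

namespace IsQCOn

theorem contDiffOn_bonnetSystem (h : IsQCOn G Γ U H N ξ) (hn : 3 ≤ finrank ℝ E)
    (hH : ContDiffOn ℝ ∞ H U) (hκ : ∀ y ∈ U, 0 < H y + κ) :
    ContDiffOn ℝ ∞ (bonnetSystem V κ G Γ H N ξ) U := by
  have hA := h.contDiffOn_shapeOperator hn hH hκ
  have hh := h.contDiffOn_secondForm hn hH hκ
  refine contDiffOn_bilin fun v p => ?_
  refine contDiffOn_const.prodMk (ContDiffOn.prodMk ?_ ?_)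
  · refine contDiffOn_clm_apply.mpr fun z => ?_
    have h1 := fun {B : E → E →L[ℝ] E →L[ℝ] ℝ} (hB : ContDiffOn ℝ ∞ B U) =>
      (hB.clm_apply (contDiffOn_const (c := v))).clm_apply (contDiffOn_const (c := z))
    have h2 := (h.contDiffOn.clm_apply (contDiffOn_const (c := v))).clm_apply
      (contDiffOn_const (c := z))
    exact ((p.2.1.contDiff.comp_contDiffOn h2).add ((h1 hh).smul contDiffOn_const)).add
      (ContDiffOn.smul (f := fun _ => κ) contDiffOn_const
        ((h1 h.contDiffOn_metric).smul contDiffOn_const))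
  · exact (p.2.1.contDiff.comp_contDiffOn (hA.clm_apply contDiffOn_const)).neg

/-- The structure equations are integrable, by the equations of Gauss and Codazzi. -/
theorem isIntegrableAt_bonnetSystem (h : IsQCOn G Γ U H N ξ) (hn : 3 ≤ finrank ℝ E)
    (hH : ContDiffOn ℝ ∞ H U) (hκ : ∀ y ∈ U, 0 < H y + κ) (hx : x ∈ U) :
    IsIntegrableAt (bonnetSystem V κ G Γ H N ξ) x := by
  have hc := fun z : E => hasFDerivAt_const (𝕜 := ℝ) z x
  have hcp := fun p : Jet E V => hasFDerivAt_const (𝕜 := ℝ) p x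
  set h' := fun y => secondForm (G y) (H y) (N y) κ (ξ y) with hh'
  set A := fun y => shapeOperator (G y) (H y) (N y) κ (ξ y) with hA
  have dh : HasFDerivAt h' (fderiv ℝ h' x) x :=
    hasFDerivAt_of_contDiffOn (h.contDiffOn_secondForm hn hH hκ) h.isOpen hx
  have dA : HasFDerivAt A (fderiv ℝ A x) x :=
    hasFDerivAt_of_contDiffOn (h.contDiffOn_shapeOperator hn hH hκ) h.isOpen hx
  have dG := h.hasFDerivAt_metric hx
  have dΓ := h.hasFDerivAt hx
  have dΩ := hasFDerivAt_of_contDiffOn (h.contDiffOn_bonnetSystem (V := V) hn hH hκ) h.isOpen hx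
  have hsymm := h.symm_metric x hx
  have hAh : ∀ y u v, G y (A y u) v = h' y u v := fun y u v => apply_shapeOperator _ _ _ _ _ _ _
  have hh_symm : ∀ u v, h' x u v = h' x v u := secondForm_symm hsymm _ _ _ _
  have hcod : ∀ u v w, fderiv ℝ h' x u v w - h' x v (Γ x u w)
      = fderiv ℝ h' x v u w - h' x u (Γ x v w) := by
    intro u v w
    have := h.isCodazziAt_secondForm hn hH hκ hx u v w
    simp only [covDeriv] at this
    rw [h.symm x hx u v] at this
    linarith
  have hDA : ∀ u v, fderiv ℝ A x u v + Γ x u (A x v) = fderiv ℝ A x v u + Γ x v (A x u) := by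
    have key : ∀ u v z, G x (fderiv ℝ A x u v + Γ x u (A x v)) z
        = fderiv ℝ h' x u v z - h' x v (Γ x u z) := by
      intro u v z
      have e1 := hasFDerivAt_apply₂ dG (dA.clm_apply (hc v)) (hc z) u
      have e2 := hasFDerivAt_apply₂ dh (hc v) (hc z) u
      simp only [hAh] at e1
      have e3 := e1.symm.trans e2
      simp [h.compat x hx, hAh] at e3
      rw [map_add, add_apply]
      linarith
    intro u v
    refine eq_of_apply_eq (h.pos x hx) fun z => ?_
    rw [key, key, hcod]
  have comp : ∀ {V' : Type _} [NormedAddCommGroup V'] [NormedSpace ℝ V'] (L : Jet E V →L[ℝ] V')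
      (u v : E) (p : Jet E V) (D : E →L[ℝ] V'),
      HasFDerivAt (fun y => L (bonnetSystem V κ G Γ H N ξ y v p)) D x →
      L (fderiv ℝ (bonnetSystem V κ G Γ H N ξ) x u v p) = D u := by
    intro V' _ _ L u v p D hD
    have := L.hasFDerivAt.comp x ((dΩ.clm_apply (hc v)).clm_apply (hcp p))
    have := congrArg (fun M : E →L[ℝ] V' => M u) (this.unique hD)
    simpa using this
  have D1 : ∀ u v p, (fderiv ℝ (bonnetSystem V κ G Γ H N ξ) x u v p).1 = 0 := fun u v p =>
    comp (ContinuousLinearMap.fst ℝ _ _) u v p 0 (hasFDerivAt_const _ _)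
  have D3 : ∀ u v p, (fderiv ℝ (bonnetSystem V κ G Γ H N ξ) x u v p).2.2
      = - p.2.1 (fderiv ℝ A x u v) := fun u v p => by
    refine (comp ((ContinuousLinearMap.snd ℝ _ _).comp (ContinuousLinearMap.snd ℝ _ _)) u v p _
      ((p.2.1.hasFDerivAt.comp x (dA.clm_apply (hc v))).neg)).trans ?_
    simp [hA]
  have D2 : ∀ u v p z, (fderiv ℝ (bonnetSystem V κ G Γ H N ξ) x u v p).2.1 z
      = p.2.1 (fderiv ℝ Γ x u v z) + fderiv ℝ h' x u v z • p.2.2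
        + κ • fderiv ℝ G x u v z • p.1 := fun u v p z => by
    refine (comp ((ContinuousLinearMap.apply ℝ V z).comp
      ((ContinuousLinearMap.fst ℝ _ _).comp (ContinuousLinearMap.snd ℝ _ _))) u v p _
      (((p.2.1.hasFDerivAt.comp x ((dΓ.clm_apply (hc v)).clm_apply (hc z))).add
        (((dh.clm_apply (hc v)).clm_apply (hc z)).smul_const p.2.2)).add
        ((((dG.clm_apply (hc v)).clm_apply (hc z)).smul_const p.1).const_smul κ))).trans ?_
    simp [hh']
  have hΩ : ∀ v p, bonnetSystem V κ G Γ H N ξ x v p = (p.2.1 v,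
      p.2.1.comp (Γ x v) + (h' x v).smulRight p.2.2 + κ • (G x v).smulRight p.1,
      - p.2.1 (A x v)) := fun v p => rfl
  intro v w
  refine ContinuousLinearMap.ext fun p => ?_
  refine Prod.ext ?_ (Prod.ext ?_ ?_)
  · simp [D1, hΩ, h.symm x hx v w, hh_symm v w, hsymm v w]
  · ext z
    have hg := congrArg p.2.1 (h.gauss hx (hκ x hx) v w z)
    rw [curvature_apply] at hg
    simp only [map_sub, map_add, map_smul] at hg
    change _ = h' x w z • p.2.1 (A x v) - h' x v z • p.2.1 (A x w) - _ at hg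
    have hg' : p.2.1 (fderiv ℝ Γ x v w z) = p.2.1 (fderiv ℝ Γ x w v z)
        - p.2.1 (Γ x v (Γ x w z)) + p.2.1 (Γ x w (Γ x v z)) + h' x w z • p.2.1 (A x v)
        - h' x v z • p.2.1 (A x w) - κ • (G x w z • p.2.1 v - G x v z • p.2.1 w) := by
      rw [← sub_eq_zero] at hg ⊢
      rw [← hg]
      abel
    have hc1 : fderiv ℝ h' x v w z = fderiv ℝ h' x w v z - h' x v (Γ x w z)
        + h' x w (Γ x v z) := by linarith [hcod v w z]
    have hc2 : fderiv ℝ G x v w z = fderiv ℝ G x w v z - G x v (Γ x w z)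
        + G x w (Γ x v z) := by
      rw [h.compat x hx, h.compat x hx, h.symm x hx v w]
      ring
    simp only [add_apply, ContinuousLinearMap.comp_apply, Prod.snd_add, Prod.fst_add, D2, hΩ,
      ContinuousLinearMap.smulRight_apply, smul_apply, hg', hc1, hc2]
    module
  · have e1 := congrArg p.2.1 (hDA v w)
    simp only [map_add] at e1
    have e2 : h' x v (A x w) = h' x w (A x v) := by
      rw [← hAh, ← hAh, hsymm]
    have e3 : G x v (A x w) = G x w (A x v) := by
      rw [hsymm, hAh, hsymm w, hAh, hh_symm]
    have e4 : p.2.1 (fderiv ℝ A x v w) = p.2.1 (fderiv ℝ A x w v) + p.2.1 (Γ x w (A x v))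
        - p.2.1 (Γ x v (A x w)) := by
      rw [← e1]
      abel
    simp only [add_apply, ContinuousLinearMap.comp_apply, Prod.snd_add, D3, hΩ,
      ContinuousLinearMap.smulRight_apply, smul_apply, e4, e2, e3]
    module

end IsQCOn

/-- The pull-back of a solution of the structure equations by an isometry is a solution. -/
theorem SolvesAt.comp_isometry {G' : E → E →L[ℝ] E →L[ℝ] ℝ} {Γ' : E → E →L[ℝ] E →L[ℝ] E}
    {U' : Set E} {H' N' : E → ℝ} {ξ' : E → E}
    (h : IsLeviCivitaOn G Γ U) (h' : IsLeviCivitaOn G' Γ' U') {φ : E → E}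
    (hφ : ContDiffOn ℝ ∞ φ U) (hmaps : Set.MapsTo φ U U')
    (hG : ∀ y ∈ U, ∀ u v, G y u v = G' (φ y) (fderiv ℝ φ y u) (fderiv ℝ φ y v))
    (hx : x ∈ U) (hsurj : Function.Surjective (fderiv ℝ φ x)) (hH : H x = H' (φ x))
    (hN : N x = N' (φ x)) (hξ : fderiv ℝ φ x (ξ x) = ξ' (φ x)) {u : E → Jet E V}
    (hu : SolvesAt (bonnetSystem V κ G' Γ' H' N' ξ') u (φ x)) :
    SolvesAt (bonnetSystem V κ G Γ H N ξ)
      (fun y => ((u (φ y)).1, (u (φ y)).2.1.comp (fderiv ℝ φ y), (u (φ y)).2.2)) x := by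
  have d1 := hasFDerivAt_of_contDiffOn hφ h.isOpen hx
  have d2 := hasFDerivAt_of_contDiffOn (contDiffOn_fderiv hφ h.isOpen) h.isOpen hx
  have du : HasFDerivAt u _ (φ x) := hu
  have dc := du.comp x d1
  have hlaw := h.map_connection h' hφ hmaps hG hx hsurj
  have hη : ∀ v, G x (ξ x) v = G' (φ x) (ξ' (φ x)) (fderiv ℝ φ x v) := fun v => by
    rw [hG x hx, hξ]
  have hsf : ∀ v w, secondForm (G x) (H x) (N x) κ (ξ x) v w
      = secondForm (G' (φ x)) (H' (φ x)) (N' (φ x)) κ (ξ' (φ x))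
        (fderiv ℝ φ x v) (fderiv ℝ φ x w) := fun v w => by
    simp only [secondForm_apply, hη, hG x hx, hH, hN]
  have hsh : ∀ v, fderiv ℝ φ x (shapeOperator (G x) (H x) (N x) κ (ξ x) v)
      = shapeOperator (G' (φ x)) (H' (φ x)) (N' (φ x)) κ (ξ' (φ x)) (fderiv ℝ φ x v) :=
    fun v => by
    simp only [shapeOperator_apply, map_add, map_smul, hξ, hη, hH, hN]
  have key := (hasFDerivAt_fst.comp x dc).prodMk
    (((hasFDerivAt_fst.comp x (hasFDerivAt_snd.comp x dc)).clm_comp d2).prodMk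
      (hasFDerivAt_snd.comp x (hasFDerivAt_snd.comp x dc)))
  refine HasFDerivAt.congr_fderiv key ?_
  refine ContinuousLinearMap.ext fun v => ?_
  refine Prod.ext ?_ (Prod.ext ?_ ?_)
  · simp [bonnetSystem, structureMap_apply]
  · ext w
    simp [bonnetSystem, structureMap_apply, hlaw, hsf, hG x hx]
    abel
  · simp [bonnetSystem, structureMap_apply, hsh]

end Bonnet

/-! ### Curvature tensors that are constant on a cone of planes -/

section Algebra

open Module

variable {E : Type*} [NormedAddCommGroup E] [NormedSpace ℝ E]

/-- The algebraic identities of a curvature tensor. -/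
structure IsCurvatureTensor (T : E → E → E → E → ℝ) : Prop where
  add : ∀ u u' v w z, T (u + u') v w z = T u v w z + T u' v w z
  smul : ∀ (c : ℝ) u v w z, T (c • u) v w z = c * T u v w z
  skew : ∀ u v w z, T u v w z = - T v u w z
  skew' : ∀ u v w z, T u v w z = - T u v z w
  bianchi : ∀ u v w z, T u v w z + T v w u z + T w u v z = 0

namespace IsCurvatureTensor

variable {T T' : E → E → E → E → ℝ}

lemma pair (h : IsCurvatureTensor T) (u v w z : E) : T u v w z = T w z u v := by
  have h1 := h.bianchi u v w z
  have h2 := h.bianchi v w z u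
  have h3 := h.bianchi w z u v
  have h4 := h.bianchi z u v w
  have s := h.skew
  have s' := h.skew'
  linarith [s' v w z u, s' w z v u, s z v w u, s' v z u w, s z u w v, s' u z w v, s z u v w,
    s u w z v, s' w u z v, s' u v z w]

lemma add₂ (h : IsCurvatureTensor T) (u v v' w z : E) :
    T u (v + v') w z = T u v w z + T u v' w z := by
  rw [h.skew, h.add, h.skew u v, h.skew u v']
  ring

lemma smul₂ (h : IsCurvatureTensor T) (c : ℝ) (u v w z : E) :
    T u (c • v) w z = c * T u v w z := by
  rw [h.skew, h.smul, h.skew u v]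
  ring

lemma add₃ (h : IsCurvatureTensor T) (u v w w' z : E) :
    T u v (w + w') z = T u v w z + T u v w' z := by
  rw [h.pair, h.add, h.pair w, h.pair w']

lemma smul₃ (h : IsCurvatureTensor T) (c : ℝ) (u v w z : E) :
    T u v (c • w) z = c * T u v w z := by
  rw [h.pair, h.smul, h.pair w]

lemma add₄ (h : IsCurvatureTensor T) (u v w z z' : E) :
    T u v w (z + z') = T u v w z + T u v w z' := by
  rw [h.pair, h.add₂, h.pair w, h.pair w]

lemma smul₄ (h : IsCurvatureTensor T) (c : ℝ) (u v w z : E) :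
    T u v w (c • z) = c * T u v w z := by
  rw [h.pair, h.smul₂, h.pair w]

lemma self (h : IsCurvatureTensor T) (u w z : E) : T u u w z = 0 := by
  linarith [h.skew u u w z]

lemma self' (h : IsCurvatureTensor T) (u v w : E) : T u v w w = 0 := by
  linarith [h.skew' u v w w]

lemma flip (h : IsCurvatureTensor T) (u v w z : E) : T u v w z = T z w v u := by
  rw [h.pair, h.skew, h.skew']
  ring

lemma sub (h : IsCurvatureTensor T) (h' : IsCurvatureTensor T') :
    IsCurvatureTensor fun u v w z => T u v w z - T' u v w z where
  add u u' v w z := by rw [h.add, h'.add]; ring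
  smul c u v w z := by rw [h.smul, h'.smul]; ring
  skew u v w z := by rw [h.skew, h'.skew]; ring
  skew' u v w z := by rw [h.skew', h'.skew']; ring
  bianchi u v w z := by linarith [h.bianchi u v w z, h'.bianchi u v w z]

/-- A curvature tensor is determined by its sectional curvatures. -/
lemma eq_zero (h : IsCurvatureTensor T) (h0 : ∀ u v, T u v v u = 0) (u v w z : E) :
    T u v w z = 0 := by
  have h1 : ∀ u v w, T u v v w = 0 := by
    intro u v w
    have := h0 (u + w) v
    rw [h.add, h.add₄, h.add₄, h0, h0, h.flip w v v u] at this
    linarith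
  have h2 : ∀ u v w z, T u v w z = - T u w v z := by
    intro u v w z
    have := h1 u (v + w) z
    rw [h.add₂, h.add₃, h.add₃, h1, h1] at this
    linarith
  have h3 := h.bianchi u v w z
  rw [h2 v w u z, h.skew v u w z, h2 w u v z, h.skew w v u z, h2 v w u z, h.skew v u w z] at h3
  linarith

/-- If the sectional curvatures of the planes that contain `ξ` and of those that are orthogonal
to `ξ` vanish, and so do the mixed terms, then the tensor vanishes. -/
lemma eq_zero_of_split (h : IsCurvatureTensor T) {b : E →L[ℝ] E →L[ℝ] ℝ} {ξ : E} (hξ : b ξ ξ = 1)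
    (h1 : ∀ v, b ξ v = 0 → T ξ v v ξ = 0)
    (h2 : ∀ v a, b ξ v = 0 → b ξ a = 0 → T ξ v v a = 0)
    (h3 : ∀ v a, b ξ v = 0 → b ξ a = 0 → T a v v a = 0) (u v w z : E) : T u v w z = 0 := by
  refine h.eq_zero (fun u v => ?_) u v w z
  have key : ∀ u v, b ξ v = 0 → T u v v u = 0 := by
    intro u v hv
    set a := u - b ξ u • ξ with ha
    have hu : u = b ξ u • ξ + a := by rw [ha]; abel
    have haξ : b ξ a = 0 := by simp [ha, hξ]
    have e := h.flip a v v ξ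
    rw [hu, h.add, h.add₄, h.add₄, h.smul, h.smul, h.smul₄, h.smul₄, h1 v hv, h3 v a hv haξ, e,
      h2 v a hv haξ]
    ring
  by_cases hα : b ξ u = 0
  · linarith [h.pair v u u v, key v u hα, h.skew u v v u, h.skew' v u v u]
  · have := key u (v - (b ξ v / b ξ u) • u) (by simp; field_simp; simp)
    rw [sub_eq_add_neg, ← neg_smul, h.add₂, h.add₃, h.add₃, h.smul₂, h.smul₂, h.smul₃, h.smul₃,
      h.self, h.self, h.self'] at this
    linarith

end IsCurvatureTensor

lemma isCurvatureTensor_kulkarni {S b : E →L[ℝ] E →L[ℝ] ℝ} (hS : ∀ u v, S u v = S v u)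
    (hb : ∀ u v, b u v = b v u) : IsCurvatureTensor (kulkarni S b) where
  add u u' v w z := by simp [kulkarni]; ring
  smul c u v w z := by simp [kulkarni]; ring
  skew u v w z := by simp [kulkarni]; ring
  skew' u v w z := by simp [kulkarni]; ring
  bianchi u v w z := by
    simp only [kulkarni]
    rw [hS u w, hS v u, hS w v, hb u w, hb v u, hb w v]
    ring

lemma qcSchouten_symm {b : E →L[ℝ] E →L[ℝ] ℝ} (hb : ∀ u v, b u v = b v u) (H N : ℝ)
    (ξ u v : E) : qcSchouten b H N ξ u v = qcSchouten b H N ξ v u := by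
  rw [qcSchouten_apply, qcSchouten_apply, hb u v]
  ring

/-- The sectional curvature of an orthonormal pair. -/
lemma kulkarni_qcSchouten {b : E →L[ℝ] E →L[ℝ] ℝ} (hb : ∀ u v, b u v = b v u) (H N : ℝ)
    (ξ : E) {u v : E} (hu : b u u = 1) (hv : b v v = 1) (huv : b u v = 0) :
    kulkarni (qcSchouten b H N ξ) b u v v u = H + (N - H) * (b ξ u ^ 2 + b ξ v ^ 2) := by
  simp only [kulkarni, qcSchouten_apply, hu, hv, huv, hb v u]
  ring

variable {b : E →L[ℝ] E →L[ℝ] ℝ} {T : E → E → E → E → ℝ}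

lemma exists_eq_smul_unit (hb : ∀ v, v ≠ 0 → 0 < b v v) {v : E} (hv : v ≠ 0) :
    ∃ (c : ℝ) (e : E), c ≠ 0 ∧ b e e = 1 ∧ v = c • e := by
  have hp := hb v hv
  have hs := (Real.sqrt_pos.mpr hp).ne'
  refine ⟨√(b v v), (√(b v v))⁻¹ • v, hs, ?_, by rw [smul_smul, mul_inv_cancel₀ hs, one_smul]⟩
  simp only [map_smul, smul_apply, smul_eq_mul]
  rw [← mul_assoc, ← mul_inv, Real.mul_self_sqrt hp.le, inv_mul_cancel₀ hp.ne']

/-- A curvature tensor whose sectional curvature is constant on the cone of planes that make the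
angle `θ` with `ξ`, where `0 < θ < π / 2`, is the Kulkarni-Nomizu product of the metric and a
bilinear form with eigenvector `ξ` and one more eigenvalue. -/
theorem exists_eq_kulkarni [FiniteDimensional ℝ E] (hn : 3 ≤ finrank ℝ E)
    (hb : ∀ v, v ≠ 0 → 0 < b v v) (hsymm : ∀ u v, b u v = b v u) (h : IsCurvatureTensor T)
    {ξ : E} (hξ : b ξ ξ = 1) {θ : ℝ} (hθ : θ ∈ Set.Ioo 0 (Real.pi / 2))
    (hcone : ∀ u v u' v', b u u = 1 → b v v = 1 → b u v = 0 →
      b u' u' = 1 → b v' v' = 1 → b u' v' = 0 →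
      b ξ u ^ 2 + b ξ v ^ 2 = Real.cos θ ^ 2 → b ξ u' ^ 2 + b ξ v' ^ 2 = Real.cos θ ^ 2 →
      T u v v u = T u' v' v' u') :
    ∃ H N : ℝ, ∀ u v w z, T u v w z = kulkarni (qcSchouten b H N ξ) b u v w z := by
  set c := Real.cos θ with hc
  set s := Real.sin θ with hs
  have hc0 : 0 < c := Real.cos_pos_of_mem_Ioo ⟨by linarith [hθ.1, Real.pi_pos], hθ.2⟩
  have hs0 : 0 < s := Real.sin_pos_of_pos_of_lt_pi hθ.1 (by linarith [hθ.2, Real.pi_pos])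
  have hcs : c ^ 2 + s ^ 2 = 1 := Real.cos_sq_add_sin_sq θ
  have hon : ∀ a v (t : ℝ), b a a = 1 → b v v = 1 → b a v = 0 → b ξ a = 0 → b ξ v = 0 →
      t ^ 2 = s ^ 2 →
      b (c • ξ + t • a) (c • ξ + t • a) = 1 ∧ b (c • ξ + t • a) v = 0 ∧
      b ξ (c • ξ + t • a) ^ 2 + b ξ v ^ 2 = c ^ 2 ∧
      T (c • ξ + t • a) v v (c • ξ + t • a)
        = c ^ 2 * T ξ v v ξ + 2 * (c * t) * T ξ v v a + t ^ 2 * T a v v a := by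
    intro a v t ha hv hav hξa hξv ht
    refine ⟨?_, ?_, ?_, ?_⟩
    · simp only [map_add, map_smul, add_apply, smul_apply, smul_eq_mul, ha, hξ, hξa,
        hsymm a ξ]
      linarith
    · simp [hav, hξv]
    · simp [hξ, hξa, hξv]
    · rw [h.add, h.add₄, h.add₄, h.smul, h.smul, h.smul₄, h.smul₄, h.smul, h.smul₄, h.smul,
        h.smul₄, h.flip a v v ξ]
      ring
  have hmix : ∀ a v, b a a = 1 → b v v = 1 → b a v = 0 → b ξ a = 0 → b ξ v = 0 →
      T ξ v v a = 0 := by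
    intro a v ha hv hav hξa hξv
    obtain ⟨p1, p2, p3, p4⟩ := hon a v s ha hv hav hξa hξv rfl
    obtain ⟨q1, q2, q3, q4⟩ := hon a v (-s) ha hv hav hξa hξv (by ring)
    have := hcone _ _ _ _ p1 hv p2 q1 hv q2 p3 q3
    rw [p4, q4] at this
    have h4 : c * s * T ξ v v a = 0 := by linarith
    exact (mul_eq_zero.mp h4).resolve_left (mul_pos hc0 hs0).ne'
  have hval : ∀ a v a' v', b a a = 1 → b v v = 1 → b a v = 0 → b ξ a = 0 → b ξ v = 0 →
      b a' a' = 1 → b v' v' = 1 → b a' v' = 0 → b ξ a' = 0 → b ξ v' = 0 →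
      c ^ 2 * T ξ v v ξ + s ^ 2 * T a v v a = c ^ 2 * T ξ v' v' ξ + s ^ 2 * T a' v' v' a' := by
    intro a v a' v' ha hv hav hξa hξv ha' hv' hav' hξa' hξv'
    obtain ⟨p1, p2, p3, p4⟩ := hon a v s ha hv hav hξa hξv rfl
    obtain ⟨q1, q2, q3, q4⟩ := hon a' v' s ha' hv' hav' hξa' hξv' rfl
    have := hcone _ _ _ _ p1 hv p2 q1 hv' q2 p3 q3
    rw [p4, q4, hmix a v ha hv hav hξa hξv, hmix a' v' ha' hv' hav' hξa' hξv'] at this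
    linarith
  have hNN : ∀ a v, b a a = 1 → b v v = 1 → b a v = 0 → b ξ a = 0 → b ξ v = 0 →
      T ξ v v ξ = T ξ a a ξ := by
    intro a v ha hv hav hξa hξv
    have := hval a v v a ha hv hav hξa hξv hv ha (by rw [hsymm, hav]) hξv hξa
    have e : T v a a v = T a v v a := by rw [h.skew, h.skew', neg_neg]
    rw [e] at this
    have h4 : c ^ 2 * (T ξ v v ξ - T ξ a a ξ) = 0 := by linarith
    exact sub_eq_zero.mp ((mul_eq_zero.mp h4).resolve_left (pow_pos hc0 2).ne')
  -- The quadratic form `v ↦ T ξ v v ξ` takes equal values on orthonormal vectors, so its polar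
  -- form vanishes on them.
  have hpolar : ∀ a v, b a a = 1 → b v v = 1 → b a v = 0 → b ξ a = 0 → b ξ v = 0 →
      T ξ a v ξ = 0 := by
    intro a v ha hv hav hξa hξv
    set r := (√2)⁻¹ with hr
    have hr2 : r * r = 1 / 2 := by
      rw [hr, ← mul_inv, Real.mul_self_sqrt (by norm_num)]
      norm_num
    have hva : b v a = 0 := by rw [hsymm, hav]
    have e1 : ∀ t : ℝ, t * t = 1 → b (r • (a + t • v)) (r • (a + t • v)) = 1 := by
      intro t ht
      simp only [map_add, map_smul, add_apply, smul_apply, smul_eq_mul, ha, hv, hav, hva]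
      linear_combination (1 + t * t) * hr2 + (1 / 2) * ht
    have e2 : b (r • (a + (1 : ℝ) • v)) (r • (a + (-1 : ℝ) • v)) = 0 := by
      simp only [map_add, map_smul, add_apply, smul_apply, smul_eq_mul, ha, hv, hav, hva]
      ring
    have e3 : ∀ t : ℝ, b ξ (r • (a + t • v)) = 0 := fun t => by simp [hξa, hξv]
    have e4 : ∀ t : ℝ, T ξ (r • (a + t • v)) (r • (a + t • v)) ξ
        = r * r * (T ξ a a ξ + 2 * t * T ξ a v ξ + t * t * T ξ v v ξ) := by
      intro t
      have : T ξ v a ξ = T ξ a v ξ := by rw [h.flip]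
      rw [h.smul₂, h.smul₃, h.add₂, h.add₃, h.add₃, h.smul₂, h.smul₂, h.smul₃, h.smul₃, this]
      ring
    have := hNN _ _ (e1 1 (by norm_num)) (e1 (-1) (by norm_num)) e2 (e3 1) (e3 (-1))
    rw [e4, e4, hr2] at this
    linarith
  obtain ⟨a₀, ha₀, ha₀ξ'⟩ := exists_unit_orthogonal hb (k := 1) (by omega) ![ξ]
  have ha₀ξ : b ξ a₀ = 0 := ha₀ξ' 0
  obtain ⟨v₀, hv₀, hv₀'⟩ := exists_unit_orthogonal hb (k := 2) (by omega) ![ξ, a₀]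
  have hv₀ξ : b ξ v₀ = 0 := hv₀' 0
  have hav₀ : b a₀ v₀ = 0 := hv₀' 1
  set N := T ξ a₀ a₀ ξ with hN
  have hNv : ∀ v, b ξ v = 0 → T ξ v v ξ = N * b v v := by
    intro v hv
    set w := v - b a₀ v • a₀ with hw
    have hvw : v = b a₀ v • a₀ + w := by rw [hw]; abel
    by_cases hw0 : w = 0
    · rw [hvw, hw0, add_zero, h.smul₂, h.smul₃]
      simp only [map_smul, smul_apply, smul_eq_mul, ha₀]
      rw [← hN]
      ring
    · obtain ⟨β, e, hβ, he, hwe⟩ := exists_eq_smul_unit hb hw0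
      have h1 : b a₀ w = 0 := by simp [hw, ha₀]
      have h2 : b ξ w = 0 := by simp [hw, hv, ha₀ξ]
      have h3 : b a₀ e = 0 := by simpa [hwe, hβ] using h1
      have h4 : b ξ e = 0 := by simpa [hwe, hβ] using h2
      have h5 : T ξ e a₀ ξ = T ξ a₀ e ξ := by rw [h.flip]
      rw [hvw, hwe, h.add₂, h.add₃, h.add₃, h.smul₂, h.smul₃, h.smul₂, h.smul₃, h.smul₂, h.smul₃,
        h.smul₂, h.smul₃, h5, hpolar a₀ e ha₀ he h3 ha₀ξ h4, hNN a₀ e ha₀ he h3 ha₀ξ h4]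
      simp only [map_add, map_smul, add_apply, smul_apply, smul_eq_mul, ha₀, he, h3, hsymm e a₀]
      ring
  set H := T a₀ v₀ v₀ a₀ with hH
  have hHH : ∀ a v, b a a = 1 → b v v = 1 → b a v = 0 → b ξ a = 0 → b ξ v = 0 →
      T a v v a = H := by
    intro a v ha hv hav hξa hξv
    have := hval a v a₀ v₀ ha hv hav hξa hξv ha₀ hv₀ hav₀ ha₀ξ hv₀ξ
    rw [hNv v hξv, hNv v₀ hv₀ξ, hv, hv₀] at this
    have h4 : s ^ 2 * (T a v v a - H) = 0 := by linarith
    exact sub_eq_zero.mp ((mul_eq_zero.mp h4).resolve_left (pow_pos hs0 2).ne')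
  refine ⟨H, N, fun u v w z => sub_eq_zero.mp ?_⟩
  have hK := isCurvatureTensor_kulkarni (qcSchouten_symm hsymm H N ξ) hsymm
  have hD := h.sub hK
  have hD3 : ∀ a v, b a a = 1 → b v v = 1 → b a v = 0 → b ξ a = 0 → b ξ v = 0 →
      T a v v a - kulkarni (qcSchouten b H N ξ) b a v v a = 0 := by
    intro a v ha hv hav hξa hξv
    rw [hHH a v ha hv hav hξa hξv, kulkarni_qcSchouten hsymm H N ξ ha hv hav, hξa, hξv]
    ring
  have hD2 : ∀ a v, b a a = 1 → b v v = 1 → b a v = 0 → b ξ a = 0 → b ξ v = 0 →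
      T ξ v v a - kulkarni (qcSchouten b H N ξ) b ξ v v a = 0 := by
    intro a v ha hv hav hξa hξv
    rw [hmix a v ha hv hav hξa hξv]
    simp [kulkarni, hξa, hξv]
  have split : ∀ v a, v ≠ 0 → b ξ v = 0 → b ξ a = 0 → ∃ (α β γ : ℝ) (e f : E), γ ≠ 0 ∧ v = γ • e ∧
      a = α • v + β • f ∧ (β ≠ 0 → b f f = 1 ∧ b e e = 1 ∧ b f e = 0 ∧ b ξ f = 0 ∧ b ξ e = 0) := by
    intro v a hv0 hv ha
    obtain ⟨γ, e, hγ, he, hve⟩ := exists_eq_smul_unit hb hv0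
    have hξe : b ξ e = 0 := by simpa [hve, hγ] using hv
    set w := a - b e a • e with hw
    have haw : a = (b e a / γ) • v + w := by
      rw [hve, smul_smul, div_mul_cancel₀ _ hγ, hw]
      abel
    by_cases hw0 : w = 0
    · exact ⟨b e a / γ, 0, γ, e, 0, hγ, hve, by simpa [hw0] using haw, fun h => absurd rfl h⟩
    · obtain ⟨β, f, hβ, hf, hwf⟩ := exists_eq_smul_unit hb hw0
      have h1 : b e w = 0 := by simp [hw, he]
      have h2 : b ξ w = 0 := by simp [hw, ha, hξe]
      have h3 : b e f = 0 := by simpa [hwf, hβ] using h1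
      have h4 : b ξ f = 0 := by simpa [hwf, hβ] using h2
      exact ⟨b e a / γ, β, γ, e, f, hγ, hve, hwf ▸ haw,
        fun _ => ⟨hf, he, by rw [hsymm, h3], h4, hξe⟩⟩
  refine hD.eq_zero_of_split hξ (fun v hv => ?_) (fun v a hv ha => ?_) (fun v a hv ha => ?_)
    u v w z
  · rw [hNv v hv]
    simp only [kulkarni, qcSchouten_apply, hξ, hv, hsymm v ξ]
    ring
  · by_cases hv0 : v = 0
    · rw [hv0]
      have := hD.smul₂ 0 ξ 0 0 a
      simpa using this
    obtain ⟨α, β, γ, e, f, hγ, hve, haf, hef⟩ := split v a hv0 hv ha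
    have e0 := hD.add₄ ξ v v (α • v) (β • f)
    have e1 := hD.smul₄ α ξ v v v
    have e2 := hD.smul₄ β ξ v v f
    have e3 := hD.self' ξ v v
    rw [← haf] at e0
    by_cases hβ : β = 0
    · rw [e0, e1, e2, e3, hβ]; ring
    · obtain ⟨f1, f2, f3, f4, f5⟩ := hef hβ
      have e4 := hD.smul₂ γ ξ e v f
      have e5 := hD.smul₃ γ ξ e e f
      rw [← hve] at e4 e5
      rw [e0, e1, e2, e3, e4, e5, hD2 f e f1 f2 f3 f4 f5]
      ring
  · by_cases hv0 : v = 0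
    · rw [hv0]
      have := hD.smul₂ 0 a 0 0 a
      simpa using this
    obtain ⟨α, β, γ, e, f, hγ, hve, haf, hef⟩ := split v a hv0 hv ha
    have e0 := hD.add₄ a v v (α • v) (β • f)
    have e0' := hD.add (α • v) (β • f) v v (β • f)
    have e1 := hD.smul₄ α a v v v
    have e2 := hD.smul α v v v (β • f)
    have e3 := hD.self' a v v
    have e3' := hD.self v v (β • f)
    have e6 := hD.smul β f v v (β • f)
    have e7 := hD.smul₄ β f v v f
    rw [← haf] at e0 e0'
    rw [e1, e3, e0', e2, e3', e6, e7] at e0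
    by_cases hβ : β = 0
    · rw [e0, hβ]; ring
    · obtain ⟨f1, f2, f3, f4, f5⟩ := hef hβ
      have e4 := hD.smul₂ γ f e v f
      have e5 := hD.smul₃ γ f e e f
      rw [← hve] at e4 e5
      rw [e0, e4, e5, hD3 f e f1 f2 f3 f4 f5]
      ring

/-- When the two curvatures differ, they are determined by the curvature tensor, and so is the
line through `ξ`. -/
theorem eq_of_kulkarni_eq [FiniteDimensional ℝ E] (hn : 3 ≤ finrank ℝ E)
    (hb : ∀ v, v ≠ 0 → 0 < b v v) (hsymm : ∀ u v, b u v = b v u) {H N H' N' : ℝ} {ξ ξ' : E}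
    (hξ : b ξ ξ = 1) (hξ' : b ξ' ξ' = 1) (hne : N ≠ H)
    (h : ∀ u v w z, kulkarni (qcSchouten b H N ξ) b u v w z
      = kulkarni (qcSchouten b H' N' ξ') b u v w z) :
    H' = H ∧ N' = N ∧ ∀ u v, b ξ' u * b ξ' v = b ξ u * b ξ v := by
  have hK : ∀ u v, b u u = 1 → b v v = 1 → b u v = 0 →
      H + (N - H) * (b ξ u ^ 2 + b ξ v ^ 2) = H' + (N' - H') * (b ξ' u ^ 2 + b ξ' v ^ 2) := by
    intro u v hu hv huv
    rw [← kulkarni_qcSchouten hsymm H N ξ hu hv huv, h,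
      kulkarni_qcSchouten hsymm H' N' ξ' hu hv huv]
  have hne' : N - H ≠ 0 := sub_ne_zero.mpr hne
  set α := b ξ' ξ with hα
  have hw : ξ - α • ξ' = 0 := by
    by_contra hw0
    obtain ⟨β, a, hβ, ha, hwa⟩ := exists_eq_smul_unit hb hw0
    have h1 : b ξ' (ξ - α • ξ') = 0 := by simp [hξ', hα]
    have haξ' : b ξ' a = 0 := by simpa [hwa, hβ] using h1
    have hξe : ξ = α • ξ' + β • a := by rw [← hwa]; abel
    obtain ⟨v, hv, hv'⟩ := exists_unit_orthogonal hb (k := 2) (by omega) ![ξ', a]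
    have hv1 : b ξ' v = 0 := hv' 0
    have hv2 : b a v = 0 := hv' 1
    have f1 : b ξ v = 0 := by rw [hξe]; simp [hv1, hv2]
    have f2 : b ξ a = β := by rw [hξe]; simp [haξ', ha]
    have f3 : b ξ ξ' = α := by rw [hsymm, hα]
    have f4 : α ^ 2 + β ^ 2 = 1 := by
      rw [← hξ]
      nth_rewrite 2 [hξe]
      simp only [map_add, map_smul, smul_eq_mul, f2, f3]
      ring
    have k2 := hK ξ' v hξ' hv hv1
    have k3 := hK ξ' a hξ' ha haξ'
    rw [f1, f3, hξ', hv1] at k2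
    rw [f2, f3, hξ', haξ'] at k3
    have : (N - H) * β ^ 2 = 0 := by linear_combination k3 - k2
    exact hβ (pow_eq_zero_iff (two_ne_zero) |>.mp ((mul_eq_zero.mp this).resolve_left hne'))
  have hξe : ξ = α • ξ' := sub_eq_zero.mp hw
  have hα2 : α ^ 2 = 1 := by
    rw [← hξ, hξe]
    simp only [map_smul, smul_apply, smul_eq_mul, hξ']
    ring
  have hall : ∀ u v, b ξ' u * b ξ' v = b ξ u * b ξ v := by
    intro u v
    rw [hξe]
    simp only [map_smul, smul_apply, smul_eq_mul]
    linear_combination - (b ξ' u * b ξ' v) * hα2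
  have hsq : ∀ u, b ξ' u ^ 2 = b ξ u ^ 2 := fun u => by rw [sq, sq, hall]
  obtain ⟨a, ha, ha'⟩ := exists_unit_orthogonal hb (k := 1) (by omega) ![ξ]
  have haξ : b ξ a = 0 := ha' 0
  obtain ⟨v, hv, hv'⟩ := exists_unit_orthogonal hb (k := 2) (by omega) ![ξ, a]
  have hvξ : b ξ v = 0 := hv' 0
  have k1 := hK a v ha hv (hv' 1)
  have k2 := hK ξ a hξ ha haξ
  rw [hsq, hsq, haξ, hvξ] at k1
  rw [hsq, hsq, haξ, hξ] at k2
  exact ⟨by linarith, by linarith, hall⟩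

end Algebra

/-! ### Riemannian metrics in the charts of a manifold -/

section Charts

open Topology Module

variable {n : ℕ} {M : Type*} [TopologicalSpace M]

/-- The change of charts. -/
def transition (e e' : OpenPartialHomeomorph M (EuclideanSpace ℝ (Fin n)))
    (y : EuclideanSpace ℝ (Fin n)) : EuclideanSpace ℝ (Fin n) := e' (e.symm y)

variable {e e' : OpenPartialHomeomorph M (EuclideanSpace ℝ (Fin n))}

lemma symm_transition {y : EuclideanSpace ℝ (Fin n)} (hy : y ∈ (e.symm.trans e').source) :
    e'.symm (transition e e' y) = e.symm y := e'.left_inv hy.2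

variable [ChartedSpace (EuclideanSpace ℝ (Fin n)) M]

/-- The differential of the inverse of a chart. The tangent spaces of `M` are, by definition, copies
of the model space, so that it is an endomorphism of the latter. -/
def chartFrame (e : OpenPartialHomeomorph M (EuclideanSpace ℝ (Fin n)))
    (y : EuclideanSpace ℝ (Fin n)) : EuclideanSpace ℝ (Fin n) →L[ℝ] EuclideanSpace ℝ (Fin n) :=
  mfderiv (𝓡 n) (𝓡 n) e.symm y

/-- The differential of a chart. -/
def chartCoframe (e : OpenPartialHomeomorph M (EuclideanSpace ℝ (Fin n)))
    (q : M) : EuclideanSpace ℝ (Fin n) →L[ℝ] EuclideanSpace ℝ (Fin n) :=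
  mfderiv (𝓡 n) (𝓡 n) e q

lemma mdifferentiable_of_mem_maximalAtlas (he : e ∈ IsManifold.maximalAtlas (𝓡 n) ∞ M) :
    e.MDifferentiable (𝓡 n) (𝓡 n) :=
  ⟨(contMDiffOn_of_mem_maximalAtlas he).mdifferentiableOn (by simp),
    (contMDiffOn_symm_of_mem_maximalAtlas he).mdifferentiableOn (by simp)⟩

lemma contDiffOn_transition (he : e ∈ IsManifold.maximalAtlas (𝓡 n) ∞ M)
    (he' : e' ∈ IsManifold.maximalAtlas (𝓡 n) ∞ M) :
    ContDiffOn ℝ ∞ (transition e e') (e.symm.trans e').source := by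
  rw [← contMDiffOn_iff_contDiffOn]
  exact (contMDiffOn_of_mem_maximalAtlas he').comp
    ((contMDiffOn_symm_of_mem_maximalAtlas he).mono fun y hy => hy.1) fun y hy => hy.2

lemma chartFrame_chartCoframe (he : e ∈ IsManifold.maximalAtlas (𝓡 n) ∞ M) {q : M}
    (hq : q ∈ e.source) (u : EuclideanSpace ℝ (Fin n)) :
    chartFrame e (e q) (chartCoframe e q u) = u :=
  congrArg (fun L : EuclideanSpace ℝ (Fin n) →L[ℝ] EuclideanSpace ℝ (Fin n) => L u)
    ((mdifferentiable_of_mem_maximalAtlas he).symm_comp_deriv hq)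

lemma chartCoframe_chartFrame (he : e ∈ IsManifold.maximalAtlas (𝓡 n) ∞ M)
    {y : EuclideanSpace ℝ (Fin n)} (hy : y ∈ e.target) (u : EuclideanSpace ℝ (Fin n)) :
    chartCoframe e (e.symm y) (chartFrame e y u) = u :=
  congrArg (fun L : EuclideanSpace ℝ (Fin n) →L[ℝ] EuclideanSpace ℝ (Fin n) => L u)
    ((mdifferentiable_of_mem_maximalAtlas he).comp_symm_deriv hy)

lemma fderiv_transition (he : e ∈ IsManifold.maximalAtlas (𝓡 n) ∞ M)
    (he' : e' ∈ IsManifold.maximalAtlas (𝓡 n) ∞ M) {y : EuclideanSpace ℝ (Fin n)}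
    (hy : y ∈ (e.symm.trans e').source) :
    fderiv ℝ (transition e e') y = (chartCoframe e' (e.symm y)).comp (chartFrame e y) := by
  have := mfderiv_comp (I := 𝓡 n) (I' := 𝓡 n) (I'' := 𝓡 n) y
    ((mdifferentiable_of_mem_maximalAtlas he').mdifferentiableAt hy.2)
    ((mdifferentiable_of_mem_maximalAtlas he).mdifferentiableAt_symm hy.1)
  rw [mfderiv_eq_fderiv] at this
  exact this

lemma chartFrame_transition (he : e ∈ IsManifold.maximalAtlas (𝓡 n) ∞ M)
    (he' : e' ∈ IsManifold.maximalAtlas (𝓡 n) ∞ M) {y : EuclideanSpace ℝ (Fin n)}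
    (hy : y ∈ (e.symm.trans e').source) (u : EuclideanSpace ℝ (Fin n)) :
    chartFrame e' (transition e e' y) (fderiv ℝ (transition e e') y u) = chartFrame e y u := by
  rw [fderiv_transition he he' hy]
  exact chartFrame_chartCoframe he' hy.2 _

lemma surjective_fderiv_transition (he : e ∈ IsManifold.maximalAtlas (𝓡 n) ∞ M)
    (he' : e' ∈ IsManifold.maximalAtlas (𝓡 n) ∞ M) {y : EuclideanSpace ℝ (Fin n)}
    (hy : y ∈ (e.symm.trans e').source) :
    Function.Surjective (fderiv ℝ (transition e e') y) := by
  have h2 : Function.Injective (fderiv ℝ (transition e e') y) := by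
    intro u v huv
    have h1 := chartFrame_transition he he' hy u
    rw [huv, chartFrame_transition he he' hy v] at h1
    rw [← chartCoframe_chartFrame he hy.1 u, ← h1, chartCoframe_chartFrame he hy.1]
  exact LinearMap.surjective_of_injective
    (f := (fderiv ℝ (transition e e') y).toLinearMap) h2

variable [IsManifold (𝓡 n) ∞ M]

/-- The metric at a point, as a bilinear form on the model space. -/
def metricAt (g : SmoothMetric n M) (p : M) :
    EuclideanSpace ℝ (Fin n) →L[ℝ] EuclideanSpace ℝ (Fin n) →L[ℝ] ℝ := g.inner p

/-- The metric in a chart. -/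
def chartMetric (g : SmoothMetric n M) (e : OpenPartialHomeomorph M (EuclideanSpace ℝ (Fin n)))
    (y : EuclideanSpace ℝ (Fin n)) :
    EuclideanSpace ℝ (Fin n) →L[ℝ] EuclideanSpace ℝ (Fin n) →L[ℝ] ℝ :=
  (metricAt g (e.symm y)).bilinearComp (chartFrame e y) (chartFrame e y)

lemma chartMetric_apply (g : SmoothMetric n M)
    (e : OpenPartialHomeomorph M (EuclideanSpace ℝ (Fin n))) (y u v : EuclideanSpace ℝ (Fin n)) :
    chartMetric g e y u v = metricAt g (e.symm y) (chartFrame e y u) (chartFrame e y v) := rfl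

lemma metricAt_symm (g : SmoothMetric n M) (p : M) (u v : EuclideanSpace ℝ (Fin n)) :
    metricAt g p u v = metricAt g p v u := g.symm p u v

lemma metricAt_pos (g : SmoothMetric n M) (p : M) (v : EuclideanSpace ℝ (Fin n)) (hv : v ≠ 0) :
    0 < metricAt g p v v := g.pos p v hv

lemma contDiffOn_chartMetric (g : SmoothMetric n M)
    {e : OpenPartialHomeomorph M (EuclideanSpace ℝ (Fin n))}
    (he : e ∈ IsManifold.maximalAtlas (𝓡 n) ∞ M) : ContDiffOn ℝ ∞ (chartMetric g e) e.target := by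
  refine contDiffOn_bilin fun u v => ?_
  rw [← contMDiffOn_iff_contDiffOn]
  have hs := contMDiffOn_symm_of_mem_maximalAtlas he
  have hvec : ∀ u : EuclideanSpace ℝ (Fin n), ContMDiffOn (𝓡 n) (𝓡 n).tangent ∞
      (fun y => (⟨e.symm y, chartFrame e y u⟩ : TangentBundle (𝓡 n) M)) e.target := by
    intro u
    have h1 := hs.contMDiffOn_tangentMapWithin (m := ∞) (by simp) e.open_target.uniqueMDiffOn
    have h2 : ContMDiffOn (𝓡 n) (𝓡 n).tangent ∞ (fun y : EuclideanSpace ℝ (Fin n) =>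
        (⟨y, u⟩ : TangentBundle (𝓡 n) (EuclideanSpace ℝ (Fin n)))) e.target :=
      contMDiffOn_vectorSpace_iff_contDiffOn.mpr contDiffOn_const
    refine (h1.comp h2 fun y hy => hy).congr fun y hy => ?_
    change _ = tangentMapWithin _ _ _ _ _
    rw [tangentMapWithin, mfderivWithin_of_isOpen e.open_target hy]
    rfl
  intro y hy
  have := ContMDiffWithinAt.clm_bundle_apply₂ (F₁ := EuclideanSpace ℝ (Fin n))
    (F₂ := EuclideanSpace ℝ (Fin n)) (F₃ := ℝ) (E₁ := fun x : M => TangentSpace (𝓡 n) x)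
    (E₂ := fun x : M => TangentSpace (𝓡 n) x) (E₃ := fun _ : M => ℝ)
    (g.contMDiff.comp_contMDiffOn hs y hy) (hvec u y hy) (hvec v y hy)
  simp only [Bundle.contMDiffWithinAt_totalSpace] at this
  exact this.2

lemma chartMetric_transition (g : SmoothMetric n M)
    (he : e ∈ IsManifold.maximalAtlas (𝓡 n) ∞ M)
    (he' : e' ∈ IsManifold.maximalAtlas (𝓡 n) ∞ M) {y : EuclideanSpace ℝ (Fin n)}
    (hy : y ∈ (e.symm.trans e').source) (u v : EuclideanSpace ℝ (Fin n)) :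
    chartMetric g e y u v = chartMetric g e' (transition e e' y)
      (fderiv ℝ (transition e e') y u) (fderiv ℝ (transition e e') y v) := by
  rw [chartMetric_apply, chartMetric_apply, chartFrame_transition he he' hy,
    chartFrame_transition he he' hy, symm_transition hy]

lemma chartMetric_symm (g : SmoothMetric n M) (y u v : EuclideanSpace ℝ (Fin n)) :
    chartMetric g e y u v = chartMetric g e y v u := metricAt_symm _ _ _ _

lemma chartMetric_pos (g : SmoothMetric n M) (he : e ∈ IsManifold.maximalAtlas (𝓡 n) ∞ M)
    {y : EuclideanSpace ℝ (Fin n)} (hy : y ∈ e.target) (v : EuclideanSpace ℝ (Fin n))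
    (hv : v ≠ 0) : 0 < chartMetric g e y v v := by
  refine metricAt_pos _ _ _ fun h => hv ?_
  rw [← chartCoframe_chartFrame he hy v, show chartFrame e y v = 0 from h, map_zero]

end Charts

/-! ### The Levi-Civita connection -/

section Koszul

open Topology Module

variable {E : Type*} [NormedAddCommGroup E] [NormedSpace ℝ E]

/-- The right hand side of Koszul's formula. -/
def koszul (G : E → E →L[ℝ] E →L[ℝ] ℝ) (x u v : E) : E →L[ℝ] ℝ :=
  (1 / 2 : ℝ) • (fderiv ℝ G x u v + fderiv ℝ G x v u - ((fderiv ℝ G x).flip u).flip v)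

lemma koszul_apply (G : E → E →L[ℝ] E →L[ℝ] ℝ) (x u v w : E) : koszul G x u v w
    = (1 / 2 : ℝ) * (fderiv ℝ G x u v w + fderiv ℝ G x v u w - fderiv ℝ G x w u v) := rfl

lemma IsLeviCivitaOn.mono {G : E → E →L[ℝ] E →L[ℝ] ℝ} {Γ : E → E →L[ℝ] E →L[ℝ] E} {U U' : Set E}
    (h : IsLeviCivitaOn G Γ U) (hU' : IsOpen U') (hsub : U' ⊆ U) : IsLeviCivitaOn G Γ U' :=
  ⟨hU', h.contDiffOn_metric.mono hsub, h.contDiffOn.mono hsub,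
    fun x hx => h.symm_metric x (hsub hx),
    fun x hx => h.pos x (hsub hx), fun x hx => h.symm x (hsub hx), fun x hx => h.compat x (hsub hx)⟩

variable [FiniteDimensional ℝ E]

/-- The Levi-Civita connection of a metric. -/
def leviCivita (G : E → E →L[ℝ] E →L[ℝ] ℝ) (x : E) : E →L[ℝ] E →L[ℝ] E :=
  toBilin <| LinearMap.mk₂ ℝ (fun u v => (ContinuousLinearMap.inverse (G x)) (koszul G x u v))
    (fun u u' v => by
      rw [← map_add]; congr 1; ext w
      simp only [koszul_apply, add_apply, map_add]; ring)
    (fun c u v => by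
      rw [← map_smul]; congr 1; ext w
      simp only [koszul_apply, smul_apply, map_smul, smul_eq_mul]; ring)
    (fun u v v' => by
      rw [← map_add]; congr 1; ext w
      simp only [koszul_apply, add_apply, map_add]; ring)
    (fun c u v => by
      rw [← map_smul]; congr 1; ext w
      simp only [koszul_apply, smul_apply, map_smul, smul_eq_mul]; ring)

variable {G : E → E →L[ℝ] E →L[ℝ] ℝ} {U : Set E} {x : E}

lemma apply_leviCivita (hG : ∀ v, v ≠ 0 → 0 < G x v v) (u v w : E) :
    G x (leviCivita G x u v) w = koszul G x u v w := by
  obtain ⟨e, he⟩ := exists_equiv_of_pos hG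
  change G x ((ContinuousLinearMap.inverse (G x)) (koszul G x u v)) w = _
  rw [← he]
  simp

theorem isLeviCivitaOn_leviCivita (hU : IsOpen U) (hG : ContDiffOn ℝ ∞ G U)
    (hsymm : ∀ x ∈ U, ∀ u v, G x u v = G x v u) (hpos : ∀ x ∈ U, ∀ v, v ≠ 0 → 0 < G x v v) :
    IsLeviCivitaOn G (leviCivita G) U := by
  have hD := contDiffOn_fderiv hG hU
  have hDs : ∀ x ∈ U, ∀ u v w, fderiv ℝ G x u v w = fderiv ℝ G x u w v := by
    intro x hx u v w
    have h1 : (fun y => G y v w) =ᶠ[𝓝 x] fun y => G y w v := by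
      filter_upwards [hU.mem_nhds hx] with y hy using hsymm y hy v w
    have h3 := fun v w => hasFDerivAt_apply₂ (hasFDerivAt_of_contDiffOn hG hU hx)
      (hasFDerivAt_const v x) (hasFDerivAt_const w x) u
    have := h3 v w
    rw [h1.fderiv_eq, h3 w v] at this
    simpa using this.symm
  refine ⟨hU, hG, contDiffOn_bilin fun u v => ?_, hsymm, hpos, fun x hx u v => ?_,
    fun x hx u v w => ?_⟩
  · have hinv : ContDiffOn ℝ ∞ (fun x => ContinuousLinearMap.inverse (G x)) U := by
      intro x hx
      obtain ⟨e, he⟩ := exists_equiv_of_pos (hpos x hx)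
      have h1 := contDiffAt_map_inverse (𝕜 := ℝ) (n := ∞) e
      rw [he] at h1
      exact (h1.comp x (hG.contDiffAt (hU.mem_nhds hx))).contDiffWithinAt
    have hk : ContDiffOn ℝ ∞ (fun x => koszul G x u v) U := by
      refine contDiffOn_clm_apply.mpr fun w => ?_
      have := fun u v w => ((hD.clm_apply (contDiffOn_const (c := u))).clm_apply
        (contDiffOn_const (c := v))).clm_apply (contDiffOn_const (c := w))
      exact contDiffOn_const.mul (((this u v w).add (this v u w)).sub (this w u v))
    exact hinv.clm_apply hk
  · refine eq_of_apply_eq (hpos x hx) fun w => ?_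
    rw [apply_leviCivita (hpos x hx), apply_leviCivita (hpos x hx), koszul_apply, koszul_apply,
      hDs x hx w u v]
    ring
  · rw [apply_leviCivita (hpos x hx), hsymm x hx v, apply_leviCivita (hpos x hx), koszul_apply,
      koszul_apply, hDs x hx u w v, hDs x hx w u v]
    ring

end Koszul

/-! ### Comparison with the coordinate formulas for the curvature -/

section Link

open Topology Module

variable {n : ℕ}

lemma eq_sum_single (u : EuclideanSpace ℝ (Fin n)) :
    u = ∑ i, u i • EuclideanSpace.single i (1 : ℝ) := by
  have := (EuclideanSpace.basisFun (Fin n) ℝ).sum_repr u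
  simpa using this.symm

lemma map_eq_sum_single {F : Type*} [NormedAddCommGroup F] [NormedSpace ℝ F]
    (L : EuclideanSpace ℝ (Fin n) →L[ℝ] F) (u : EuclideanSpace ℝ (Fin n)) :
    L u = ∑ i, u i • L (EuclideanSpace.single i (1 : ℝ)) := by
  conv_lhs => rw [eq_sum_single u]
  simp

lemma eq_sum_of_linear (f : EuclideanSpace ℝ (Fin n) → ℝ) (hadd : ∀ u v, f (u + v) = f u + f v)
    (hsmul : ∀ (c : ℝ) u, f (c • u) = c * f u) (u : EuclideanSpace ℝ (Fin n)) :
    f u = ∑ i, u i * f (EuclideanSpace.single i 1) :=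
  map_eq_sum_single (IsLinearMap.mk' f ⟨hadd, hsmul⟩).toContinuousLinearMap u

lemma IsLeviCivitaOn.isCurvatureTensor {E : Type*} [NormedAddCommGroup E] [NormedSpace ℝ E]
    {G : E → E →L[ℝ] E →L[ℝ] ℝ} {Γ : E → E →L[ℝ] E →L[ℝ] E} {U : Set E}
    (h : IsLeviCivitaOn G Γ U) {x : E} (hx : x ∈ U) :
    IsCurvatureTensor fun u v w z => G x (curvature Γ x u v w) z where
  add u u' v w z := by
    simp only [curvature_apply, map_add, map_sub, add_apply, sub_apply]
    ring
  smul c u v w z := by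
    simp only [curvature_apply, map_add, map_sub, map_smul, add_apply, sub_apply, smul_apply,
      smul_eq_mul]
    ring
  skew u v w z := by rw [curvature_swap]; simp
  skew' u v w z := by rw [h.curvature_skew hx, h.symm_metric x hx w]
  bianchi u v w z := by
    simp only [curvature_apply, map_add, map_sub, add_apply, sub_apply]
    rw [h.symm x hx w u, h.symm x hx w v, h.symm x hx v u, h.fderiv_symm hx w u v,
      h.fderiv_symm hx u v w, h.fderiv_symm hx v w u]
    ring

variable {M : Type*} [TopologicalSpace M]
  [ChartedSpace (EuclideanSpace ℝ (Fin n)) M] [IsManifold (𝓡 n) ∞ M]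

lemma isLeviCivitaOn_chart (g : SmoothMetric n M)
    {e : OpenPartialHomeomorph M (EuclideanSpace ℝ (Fin n))}
    (he : e ∈ IsManifold.maximalAtlas (𝓡 n) ∞ M) :
    IsLeviCivitaOn (chartMetric g e) (leviCivita (chartMetric g e)) e.target :=
  isLeviCivitaOn_leviCivita e.open_target (contDiffOn_chartMetric g he)
    (fun _ _ => chartMetric_symm g _) fun _ hy => chartMetric_pos g he hy

lemma metricMatrix_eq (g : SmoothMetric n M) (p : M) (y : EuclideanSpace ℝ (Fin n)) (i j : Fin n) :
    metricMatrix g p y i j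
      = chartMetric g (chartAt (EuclideanSpace ℝ (Fin n)) p) y (EuclideanSpace.single i 1)
          (EuclideanSpace.single j 1) := rfl

lemma partialDeriv_metricMatrix (g : SmoothMetric n M) (p : M) {y : EuclideanSpace ℝ (Fin n)}
    (hy : y ∈ (chartAt (EuclideanSpace ℝ (Fin n)) p).target) (l i j : Fin n) :
    partialDeriv l (fun z => metricMatrix g p z i j) y
      = fderiv ℝ (chartMetric g (chartAt (EuclideanSpace ℝ (Fin n)) p)) y
        (EuclideanSpace.single l 1) (EuclideanSpace.single i 1) (EuclideanSpace.single j 1) := by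
  have h := hasFDerivAt_apply₂ ((isLeviCivitaOn_chart g
    (IsManifold.chart_mem_maximalAtlas (I := 𝓡 n) (n := ∞) p)).hasFDerivAt_metric hy)
    (hasFDerivAt_const (𝕜 := ℝ) (EuclideanSpace.single i (1 : ℝ)) y)
    (hasFDerivAt_const (𝕜 := ℝ) (EuclideanSpace.single j (1 : ℝ)) y)
    (EuclideanSpace.single l 1)
  simpa [partialDeriv, metricMatrix_eq] using h

lemma christoffel_eq (g : SmoothMetric n M) (p : M) {y : EuclideanSpace ℝ (Fin n)}
    (hy : y ∈ (chartAt (EuclideanSpace ℝ (Fin n)) p).target) (k i j : Fin n) :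
    christoffel g p k i j y = leviCivita (chartMetric g (chartAt (EuclideanSpace ℝ (Fin n)) p)) y
      (EuclideanSpace.single i 1) (EuclideanSpace.single j 1) k := by
  set G := chartMetric g (chartAt (EuclideanSpace ℝ (Fin n)) p) with hG
  have hpos := fun v => chartMetric_pos g
    (IsManifold.chart_mem_maximalAtlas (I := 𝓡 n) (n := ∞) p) hy v
  set A := metricMatrix g p y with hA
  have hmul : ∀ c : EuclideanSpace ℝ (Fin n), ∀ l, A.mulVec (fun i => c i) l
      = G y c (EuclideanSpace.single l 1) := by
    intro c l
    rw [hG, chartMetric_symm, map_eq_sum_single _ c]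
    simp [Matrix.mulVec, dotProduct, hA, metricMatrix_eq, mul_comm]
  have hunit : IsUnit A := by
    rw [← Matrix.mulVec_injective_iff_isUnit]
    rw [← Matrix.coe_mulVecLin, ← LinearMap.ker_eq_bot, LinearMap.ker_eq_bot']
    intro c hc
    have h0 : G y (WithLp.toLp 2 c) = 0 := by
      ext l
      rw [map_eq_sum_single]
      refine Finset.sum_eq_zero fun i _ => ?_
      rw [← hmul (WithLp.toLp 2 c) i]
      have : A.mulVec c i = 0 := congrFun hc i
      simp [this]
    by_contra hne
    have := hpos (WithLp.toLp 2 c) (by simpa using hne)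
    rw [← hG, h0] at this
    simp at this
  set c := leviCivita G y (EuclideanSpace.single i 1) (EuclideanSpace.single j 1) with hc
  have hk : ∀ l, A.mulVec (fun i => c i) l = (1 / 2 : ℝ) *
      (partialDeriv i (fun z => metricMatrix g p z j l) y
      + partialDeriv j (fun z => metricMatrix g p z i l) y
      - partialDeriv l (fun z => metricMatrix g p z i j) y) := by
    intro l
    rw [hmul, hc, apply_leviCivita hpos, koszul_apply, partialDeriv_metricMatrix g p hy,
      partialDeriv_metricMatrix g p hy, partialDeriv_metricMatrix g p hy]
  have h1 : A⁻¹.mulVec (A.mulVec (fun i => c i)) = fun i => c i := by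
    rw [Matrix.mulVec_mulVec, Matrix.nonsing_inv_mul _ ((Matrix.isUnit_iff_isUnit_det _).mp hunit),
      Matrix.one_mulVec]
  have h2 := congrFun h1 k
  rw [← h2, christoffel, Matrix.mulVec, dotProduct, Finset.mul_sum]
  refine Finset.sum_congr rfl fun l _ => ?_
  rw [hk]
  ring

lemma partialDeriv_christoffel (g : SmoothMetric n M) (p : M) {y : EuclideanSpace ℝ (Fin n)}
    (hy : y ∈ (chartAt (EuclideanSpace ℝ (Fin n)) p).target) (l k i j : Fin n) :
    partialDeriv l (christoffel g p k i j) y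
      = fderiv ℝ (leviCivita (chartMetric g (chartAt (EuclideanSpace ℝ (Fin n)) p))) y
        (EuclideanSpace.single l 1) (EuclideanSpace.single i 1) (EuclideanSpace.single j 1) k := by
  have hL := isLeviCivitaOn_chart g
    (IsManifold.chart_mem_maximalAtlas (I := 𝓡 n) (n := ∞) p)
  have he : christoffel g p k i j =ᶠ[𝓝 y] fun y =>
      leviCivita (chartMetric g (chartAt (EuclideanSpace ℝ (Fin n)) p)) y
        (EuclideanSpace.single i 1) (EuclideanSpace.single j 1) k := by
    filter_upwards [hL.isOpen.mem_nhds hy] with z hz using christoffel_eq g p hz k i j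
  rw [partialDeriv, he.fderiv_eq]
  have h1 := ((hL.hasFDerivAt hy).clm_apply
    (hasFDerivAt_const (𝕜 := ℝ) (EuclideanSpace.single i (1 : ℝ)) y)).clm_apply
    (hasFDerivAt_const (𝕜 := ℝ) (EuclideanSpace.single j (1 : ℝ)) y)
  have h2 := (EuclideanSpace.proj k : EuclideanSpace ℝ (Fin n) →L[ℝ] ℝ).hasFDerivAt.comp y h1
  have h3 := congrArg (fun L : EuclideanSpace ℝ (Fin n) →L[ℝ] ℝ =>
    L (EuclideanSpace.single l 1)) h2.fderiv
  refine Eq.trans h3 ?_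
  simp

lemma riemannComponent_eq (g : SmoothMetric n M) (p : M) {y : EuclideanSpace ℝ (Fin n)}
    (hy : y ∈ (chartAt (EuclideanSpace ℝ (Fin n)) p).target) (l i j k : Fin n) :
    riemannComponent g p l i j k y
      = curvature (leviCivita (chartMetric g (chartAt (EuclideanSpace ℝ (Fin n)) p))) y
        (EuclideanSpace.single i 1) (EuclideanSpace.single j 1) (EuclideanSpace.single k 1) l := by
  set Γ := leviCivita (chartMetric g (chartAt (EuclideanSpace ℝ (Fin n)) p)) with hΓ
  have hsum : ∀ a : Fin n, ∀ w : EuclideanSpace ℝ (Fin n),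
      Γ y (EuclideanSpace.single a 1) w l
        = ∑ m, Γ y (EuclideanSpace.single a 1) (EuclideanSpace.single m 1) l * w m := by
    intro a w
    rw [map_eq_sum_single (Γ y (EuclideanSpace.single a 1)) w]
    simp [mul_comm]
  rw [riemannComponent, partialDeriv_christoffel g p hy, partialDeriv_christoffel g p hy,
    curvature_apply]
  simp only [christoffel_eq g p hy, ← hΓ, PiLp.add_apply, PiLp.sub_apply]
  rw [Finset.sum_sub_distrib, ← hsum, ← hsum]
  ring

/-- In the preferred chart at `p`, the coordinate expression of the curvature form agrees with the
curvature of the Levi-Civita connection. -/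
lemma curvatureForm_eq_chartAt (g : SmoothMetric n M) (p : M) (u v w z : EuclideanSpace ℝ (Fin n)) :
    curvatureForm g p u v w z
      = chartMetric g (chartAt (EuclideanSpace ℝ (Fin n)) p)
        (chartAt (EuclideanSpace ℝ (Fin n)) p p)
        (curvature (leviCivita (chartMetric g (chartAt (EuclideanSpace ℝ (Fin n)) p)))
          (chartAt (EuclideanSpace ℝ (Fin n)) p p)
          (chartCoframe (chartAt (EuclideanSpace ℝ (Fin n)) p) p u)
          (chartCoframe (chartAt (EuclideanSpace ℝ (Fin n)) p) p v)
          (chartCoframe (chartAt (EuclideanSpace ℝ (Fin n)) p) p w))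
        (chartCoframe (chartAt (EuclideanSpace ℝ (Fin n)) p) p z) := by
  set e := chartAt (EuclideanSpace ℝ (Fin n)) p with he
  set G := chartMetric g e with hG
  set R := curvature (leviCivita G) (e p) with hR
  have hy : e p ∈ e.target := e.map_source (mem_chart_source _ p)
  have hc : ∀ u : EuclideanSpace ℝ (Fin n), coords p u = chartCoframe e p u := fun u => rfl
  have hp : extChartAt (𝓡 n) p p = e p := rfl
  simp only [curvatureForm, hc, hp]
  generalize chartCoframe e p u = u
  generalize chartCoframe e p v = v
  generalize chartCoframe e p w = w
  generalize chartCoframe e p z = z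
  have h1 : ∀ i j k, G (e p) (R (EuclideanSpace.single i 1) (EuclideanSpace.single j 1)
      (EuclideanSpace.single k 1)) z = ∑ l, ∑ m, riemannComponent g p l i j k (e p)
        * metricMatrix g p (e p) l m * z m := by
    intro i j k
    rw [map_eq_sum_single (G (e p)), sum_apply]
    refine Finset.sum_congr rfl fun l _ => ?_
    rw [map_eq_sum_single _ z]
    refine Finset.sum_congr rfl fun m _ => ?_
    rw [riemannComponent_eq g p hy, metricMatrix_eq]
    simp only [smul_apply, smul_eq_mul]
    ring
  have hT : IsCurvatureTensor fun u v w z => G (e p) (R u v w) z :=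
    (isLeviCivitaOn_chart g (IsManifold.chart_mem_maximalAtlas p)).isCurvatureTensor hy
  rw [show G (e p) (R u v w) z = _ from eq_sum_of_linear (fun u => G (e p) (R u v w) z)
    (hT.add · · v w z) (hT.smul · · v w z) u]
  refine Finset.sum_congr rfl fun i _ => ?_
  rw [eq_sum_of_linear (fun v => G (e p) (R _ v w) z)
    (hT.add₂ _ · · w z) (hT.smul₂ · _ · w z) v, Finset.mul_sum]
  refine Finset.sum_congr rfl fun j _ => ?_
  rw [eq_sum_of_linear (fun w => G (e p) (R _ _ w) z)
    (hT.add₃ _ _ · · z) (hT.smul₃ · _ _ · z) w, Finset.mul_sum, Finset.mul_sum]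
  refine Finset.sum_congr rfl fun k _ => ?_
  rw [h1]
  simp only [Finset.mul_sum]
  refine Finset.sum_congr rfl fun l _ => Finset.sum_congr rfl fun m _ => ?_
  ring

/-- The curvature form in an arbitrary chart. -/
theorem curvatureForm_eq (g : SmoothMetric n M)
    {e : OpenPartialHomeomorph M (EuclideanSpace ℝ (Fin n))}
    (he : e ∈ IsManifold.maximalAtlas (𝓡 n) ∞ M)
    {Γ : EuclideanSpace ℝ (Fin n) →
      EuclideanSpace ℝ (Fin n) →L[ℝ] EuclideanSpace ℝ (Fin n) →L[ℝ] EuclideanSpace ℝ (Fin n)}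
    (hΓ : IsLeviCivitaOn (chartMetric g e) Γ e.target) {q : M} (hq : q ∈ e.source)
    (u v w z : EuclideanSpace ℝ (Fin n)) :
    curvatureForm g q u v w z = chartMetric g e (e q) (curvature Γ (e q) (chartCoframe e q u)
      (chartCoframe e q v) (chartCoframe e q w)) (chartCoframe e q z) := by
  rw [curvatureForm_eq_chartAt]
  set e' := chartAt (EuclideanSpace ℝ (Fin n)) q with he'
  have hm' : e' ∈ IsManifold.maximalAtlas (𝓡 n) ∞ M := IsManifold.chart_mem_maximalAtlas q
  have hq' : q ∈ e'.source := mem_chart_source _ q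
  have hsrc : e q ∈ (e.symm.trans e').source :=
    ⟨e.map_source hq, by simpa [e.left_inv hq] using hq'⟩
  have hτ : transition e e' (e q) = e' q := by rw [transition, e.left_inv hq]
  have hD : ∀ u, fderiv ℝ (transition e e') (e q) (chartCoframe e q u) = chartCoframe e' q u := by
    intro u
    rw [fderiv_transition he hm' hsrc, ContinuousLinearMap.comp_apply,
      chartFrame_chartCoframe he hq, e.left_inv hq]
  have h := (hΓ.mono (e.symm.trans e').open_source fun y hy => hy.1).map_curvature
    (isLeviCivitaOn_chart g hm') (contDiffOn_transition he hm')
    (fun y hy => e'.map_source hy.2)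
    (fun y hy u v => chartMetric_transition g he hm' hy u v)
    (fun y hy => surjective_fderiv_transition he hm' hy) hsrc
    (chartCoframe e q u) (chartCoframe e q v) (chartCoframe e q w)
  rw [hD, hD, hD, hτ] at h
  rw [← h, ← hD z, chartMetric_transition g he hm' hsrc, hτ]

lemma isCurvatureTensor_curvatureForm (g : SmoothMetric n M) (p : M) :
    IsCurvatureTensor (E := EuclideanSpace ℝ (Fin n)) (curvatureForm g p) := by
  have hp := mem_chart_source (EuclideanSpace ℝ (Fin n)) p
  have hT := (isLeviCivitaOn_chart g (IsManifold.chart_mem_maximalAtlas p)).isCurvatureTensor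
    ((chartAt (EuclideanSpace ℝ (Fin n)) p).map_source hp)
  constructor <;> intros <;> simp only [curvatureForm_eq_chartAt, map_add, map_smul]
  · exact hT.add _ _ _ _ _
  · exact hT.smul _ _ _ _ _
  · exact hT.skew _ _ _ _
  · exact hT.skew' _ _ _ _
  · exact hT.bianchi _ _ _ _

lemma sectionalCurvature_eq {g : SmoothMetric n M} {p : M} {u v : EuclideanSpace ℝ (Fin n)}
    (h : IsOrthonormalPair g p u v) : sectionalCurvature g p u v = curvatureForm g p u v v u := by
  have : g.inner p u u * g.inner p v v - g.inner p u v ^ 2 = 1 := by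
    rw [h.1, h.2.1, h.2.2]
    norm_num
  change _ / _ = _
  rw [this, div_one]

end Link

/-! ### The curvature functions of a `1`-QC metric -/

section CurvatureFunctions

open Topology Module

variable {n : ℕ} {M : Type*} [TopologicalSpace M]
  [ChartedSpace (EuclideanSpace ℝ (Fin n)) M] [IsManifold (𝓡 n) ∞ M] {g : SmoothMetric n M}
  {H N : M → ℝ} {ξ : M → EuclideanSpace ℝ (Fin n)}

/-- At each point, `ξ` is a unit vector and the curvature tensor is determined by `ξ` and the
horizontal and vertical curvatures `H` and `N`. At a point where `N = H`, the choice of `ξ` is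
immaterial. -/
structure IsQCField (g : SmoothMetric n M) (H N : M → ℝ) (ξ : M → EuclideanSpace ℝ (Fin n)) :
    Prop where
  unit : ∀ p, metricAt g p (ξ p) (ξ p) = 1
  curv : ∀ (p : M) (u v w z : EuclideanSpace ℝ (Fin n)), curvatureForm g p u v w z
    = kulkarni (qcSchouten (metricAt g p) (H p) (N p) (ξ p)) (metricAt g p) u v w z

lemma ConstantOnCone.exists_eq_kulkarni (hn : 3 ≤ n) {p : M} {η : EuclideanSpace ℝ (Fin n)}
    (hη : metricAt g p η η = 1) {θ : ℝ} (hθ : θ ∈ Set.Ioo 0 (Real.pi / 2))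
    (h : ConstantOnCone g p η θ) :
    ∃ H N : ℝ, ∀ u v w z : EuclideanSpace ℝ (Fin n), curvatureForm g p u v w z
      = kulkarni (qcSchouten (metricAt g p) H N η) (metricAt g p) u v w z := by
  refine OneQC.exists_eq_kulkarni (by simpa using hn) (metricAt_pos g p) (metricAt_symm g p)
    (isCurvatureTensor_curvatureForm g p) hη hθ ?_
  intro u v u' v' hu hv huv hu' hv' huv' hc hc'
  have := h u v u' v' ⟨hu, hv, huv⟩ ⟨hu', hv', huv'⟩ hc hc'
  rwa [sectionalCurvature_eq ⟨hu, hv, huv⟩, sectionalCurvature_eq ⟨hu', hv', huv'⟩] at this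

/-- At an isotropic point every unit vector will do, and every angle. -/
lemma IsOneQC.exists_constantOnCone (hg : IsOneQC g) (hn : 3 ≤ n) (p : M) :
    ∃ η : EuclideanSpace ℝ (Fin n), metricAt g p η η = 1 ∧
      ∃ θ ∈ Set.Ioo 0 (Real.pi / 2), ConstantOnCone g p η θ := by
  by_cases hp : IsIsotropic g p
  · obtain ⟨η, hη, -⟩ := exists_unit_orthogonal (k := 0) (metricAt_pos g p)
      (by rw [finrank_euclideanSpace_fin]; omega) Fin.elim0
    refine ⟨η, hη, Real.pi / 4, ⟨by positivity, by linarith [Real.pi_pos]⟩, ?_⟩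
    exact fun u v u' v' h h' _ _ => hp u v u' v' h h'
  · obtain ⟨U, -, hpU, hU⟩ := hg p hp
    obtain ⟨V, -, hpV, -, L, hL, θ, hθ⟩ := hU p hpU
    obtain ⟨V', -, hpV', -, X, -, hX⟩ := hL p hpV
    obtain ⟨hX0, hLX⟩ := hX p hpV'
    obtain ⟨c, η, hc, hη, hXη⟩ := exists_eq_smul_unit (metricAt_pos g p) hX0
    refine ⟨η, hη, θ p, (hθ p hpV).1, (hθ p hpV).2 η ?_ hη⟩
    have key : ∀ x : EuclideanSpace ℝ (Fin n), x = c • η → η ∈ Submodule.span ℝ {x} := by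
      rintro _ rfl
      exact Submodule.mem_span_singleton.mpr ⟨c⁻¹, inv_smul_smul₀ hc η⟩
    rw [hLX]
    exact key _ hXη

/-- The field `ξ` is chosen pointwise, without any continuity. -/
theorem IsOneQC.exists_isQCField (hg : IsOneQC g) (hn : 3 ≤ n) :
    ∃ (H N : M → ℝ) (ξ : M → EuclideanSpace ℝ (Fin n)), IsQCField g H N ξ := by
  choose ξ hξ θ hθ hc using fun p => hg.exists_constantOnCone hn p
  choose H N hK using fun p => (hc p).exists_eq_kulkarni hn (hξ p) (hθ p)
  exact ⟨H, N, ξ, hξ, hK⟩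

namespace IsQCField

lemma sectionalCurvature_eq (h : IsQCField g H N ξ) {p : M} {u v : EuclideanSpace ℝ (Fin n)}
    (huv : IsOrthonormalPair g p u v) : sectionalCurvature g p u v
      = H p + (N p - H p) * (metricAt g p (ξ p) u ^ 2 + metricAt g p (ξ p) v ^ 2) := by
  rw [OneQC.sectionalCurvature_eq huv, h.curv]
  exact kulkarni_qcSchouten (metricAt_symm g p) _ _ _ huv.1 huv.2.1 huv.2.2

lemma isIsotropic_iff (h : IsQCField g H N ξ) (hn : 3 ≤ n) {p : M} :
    IsIsotropic g p ↔ N p = H p := by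
  constructor
  · intro hp
    obtain ⟨u, hu, hξu⟩ := exists_unit_orthogonal (k := 1) (metricAt_pos g p)
      (by rw [finrank_euclideanSpace_fin]; omega) ![ξ p]
    obtain ⟨v, hv, hξv⟩ := exists_unit_orthogonal (k := 2) (metricAt_pos g p)
      (by rw [finrank_euclideanSpace_fin]; omega) ![ξ p, u]
    have hξu : metricAt g p (ξ p) u = 0 := hξu 0
    have huv : metricAt g p u v = 0 := hξv 1
    have hξv : metricAt g p (ξ p) v = 0 := hξv 0
    have h1 := hp u v (ξ p) u ⟨hu, hv, huv⟩ ⟨h.unit p, hu, hξu⟩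
    rw [h.sectionalCurvature_eq ⟨hu, hv, huv⟩, h.sectionalCurvature_eq ⟨h.unit p, hu, hξu⟩,
      hξu, hξv, h.unit] at h1
    linarith
  · intro hp u v u' v' huv huv'
    rw [h.sectionalCurvature_eq huv, h.sectionalCurvature_eq huv', hp]
    ring

/-- At a non-isotropic point, the distinguished line and the curvatures are unique. -/
lemma eq_of_isDistinguished (h : IsQCField g H N ξ) (hn : 3 ≤ n) {p : M}
    (hp : ¬ IsIsotropic g p) {η : EuclideanSpace ℝ (Fin n)} (hη : IsDistinguished g p η)
    (u v : EuclideanSpace ℝ (Fin n)) :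
    metricAt g p η u * metricAt g p η v = metricAt g p (ξ p) u * metricAt g p (ξ p) v := by
  obtain ⟨hη1, θ, hθ, hc⟩ := hη
  obtain ⟨H', N', hK⟩ := hc.exists_eq_kulkarni hn hη1 hθ
  refine (eq_of_kulkarni_eq (H' := H') (N' := N') (by simpa using hn) (metricAt_pos g p)
    (metricAt_symm g p) (h.unit p) hη1 (fun he => hp ((h.isIsotropic_iff hn).mpr he))
    fun u v w z => ?_).2.2 u v
  rw [← h.curv, hK]

theorem areCurvatureFunctions (h : IsQCField g H N ξ) (hn : 3 ≤ n) :
    AreCurvatureFunctions g H N := by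
  refine fun p => ⟨fun hp u v huv => ?_,
    fun hp (η : EuclideanSpace ℝ (Fin n)) hη => ?_⟩
  · rw [h.sectionalCurvature_eq huv, (h.isIsotropic_iff hn).mp hp]
    exact ⟨by ring, by ring⟩
  · have hu := h.eq_of_isDistinguished hn hp hη
    have hsq : ∀ u, metricAt g p (ξ p) u ^ 2 = metricAt g p η u ^ 2 := fun u => by
      rw [sq, sq, hu]
    refine ⟨fun (u v : EuclideanSpace ℝ (Fin n)) huv hηu hηv => ?_,
      fun (u : EuclideanSpace ℝ (Fin n)) hηu => ?_⟩
    · rw [h.sectionalCurvature_eq huv, hsq, hsq, show metricAt g p η u = 0 from hηu,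
        show metricAt g p η v = 0 from hηv]
      ring
    · rw [h.sectionalCurvature_eq hηu, hsq, hsq, show metricAt g p η η = 1 from hηu.1,
        show metricAt g p η u = 0 from hηu.2.2]
      ring

/-- In a chart `e`, the data of `IsQCField` become those of `IsQCOn`. -/
lemma curv_chart (h : IsQCField g H N ξ) {e : OpenPartialHomeomorph M (EuclideanSpace ℝ (Fin n))}
    (he : e ∈ IsManifold.maximalAtlas (𝓡 n) ∞ M)
    {Γ : EuclideanSpace ℝ (Fin n) →
      EuclideanSpace ℝ (Fin n) →L[ℝ] EuclideanSpace ℝ (Fin n) →L[ℝ] EuclideanSpace ℝ (Fin n)}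
    (hΓ : IsLeviCivitaOn (chartMetric g e) Γ e.target) {y : EuclideanSpace ℝ (Fin n)}
    (hy : y ∈ e.target) (u v w z : EuclideanSpace ℝ (Fin n)) :
    chartMetric g e y (curvature Γ y u v w) z
      = kulkarni (qcSchouten (chartMetric g e y) (H (e.symm y)) (N (e.symm y))
        (chartCoframe e (e.symm y) (ξ (e.symm y)))) (chartMetric g e y) u v w z := by
  have hξ : chartFrame e y (chartCoframe e (e.symm y) (ξ (e.symm y))) = ξ (e.symm y) := by
    have := chartFrame_chartCoframe he (e.map_target hy) (ξ (e.symm y))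
    rwa [e.right_inv hy] at this
  have h1 := curvatureForm_eq g he hΓ (e.map_target hy) (chartFrame e y u) (chartFrame e y v)
    (chartFrame e y w) (chartFrame e y z)
  simp only [e.right_inv hy, chartCoframe_chartFrame he hy] at h1
  rw [← h1, h.curv]
  simp only [kulkarni, qcSchouten_apply, chartMetric_apply, hξ]

lemma unit_chart (h : IsQCField g H N ξ) {e : OpenPartialHomeomorph M (EuclideanSpace ℝ (Fin n))}
    (he : e ∈ IsManifold.maximalAtlas (𝓡 n) ∞ M) {y : EuclideanSpace ℝ (Fin n)}
    (hy : y ∈ e.target) : chartMetric g e y (chartCoframe e (e.symm y) (ξ (e.symm y)))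
      (chartCoframe e (e.symm y) (ξ (e.symm y))) = 1 := by
  have := chartFrame_chartCoframe he (e.map_target hy) (ξ (e.symm y))
  rw [e.right_inv hy] at this
  rw [chartMetric_apply, this, h.unit]

end IsQCField

/-- The chart `e`, with a connection `Γ`, expresses the data of a `1`-QC metric in coordinates. -/
structure IsQCChart (g : SmoothMetric n M) (H N : M → ℝ) (ξ : M → EuclideanSpace ℝ (Fin n))
    (e : OpenPartialHomeomorph M (EuclideanSpace ℝ (Fin n)))
    (Γ : EuclideanSpace ℝ (Fin n) →
      EuclideanSpace ℝ (Fin n) →L[ℝ] EuclideanSpace ℝ (Fin n) →L[ℝ] EuclideanSpace ℝ (Fin n)) :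
    Prop where
  mem : e ∈ IsManifold.maximalAtlas (𝓡 n) ∞ M
  isQCOn : IsQCOn (chartMetric g e) Γ e.target (fun y => H (e.symm y)) (fun y => N (e.symm y))
    (fun y => chartCoframe e (e.symm y) (ξ (e.symm y)))

/-- In dimension at least four, the Codazzi equation for the Schouten tensor follows from the second
Bianchi identity. -/
lemma IsQCField.isQCChart (h : IsQCField g H N ξ) (hn : 4 ≤ n)
    {e : OpenPartialHomeomorph M (EuclideanSpace ℝ (Fin n))}
    (he : e ∈ IsManifold.maximalAtlas (𝓡 n) ∞ M) :
    IsQCChart g H N ξ e (leviCivita (chartMetric g e)) := by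
  have hL := isLeviCivitaOn_chart g he
  have h3 : 3 ≤ finrank ℝ (EuclideanSpace ℝ (Fin n)) := by
    rw [finrank_euclideanSpace_fin]; omega
  have hc := fun y hy => h.curv_chart he hL (y := y) hy
  refine ⟨he, hL, fun y hy => h.unit_chart he hy, hc, fun y hy => ?_⟩
  refine hL.isCodazziAt (by simpa using hn) ?_ hc hy
  exact hL.contDiffOn_schouten.congr fun y hy => hL.eq_schouten h3 hy (hc y hy)

/-- In dimension three, the Codazzi equation for the Schouten tensor holds by conformal flatness. -/
lemma IsQCField.exists_isQCChart_of_isConformallyFlat (h : IsQCField g H N ξ) (hn : 3 ≤ n)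
    (hg : IsConformallyFlat g) (p : M) : ∃ e Γ, p ∈ e.source ∧ IsQCChart g H N ξ e Γ := by
  have h3 : 3 ≤ finrank ℝ (EuclideanSpace ℝ (Fin n)) := by simpa using hn
  obtain ⟨e, he, hp, c, hc⟩ := hg p
  have hG : ∀ y ∈ e.target, ∀ u v, chartMetric g e y u v = c (e.symm y) * inner ℝ u v := by
    intro y hy u v
    have h1 := (hc (e.symm y) (e.map_target hy)).2 (chartFrame e y u) (chartFrame e y v)
    refine h1.trans ?_
    have h2 := chartCoframe_chartFrame he hy
    change _ * inner ℝ (chartCoframe e (e.symm y) (chartFrame e y u))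
      (chartCoframe e (e.symm y) (chartFrame e y v)) = _
    rw [h2, h2]
  set w : EuclideanSpace ℝ (Fin n) := EuclideanSpace.single ⟨0, by omega⟩ 1 with hw
  have hw1 : inner ℝ w w = (1 : ℝ) := by simp [hw]
  have hcs : ContDiffOn ℝ ∞ (fun y => c (e.symm y)) e.target := by
    refine (((contDiffOn_chartMetric g he).clm_apply (contDiffOn_const (c := w))).clm_apply
      (contDiffOn_const (c := w))).congr fun y hy => ?_
    rw [hG y hy, hw1, mul_one]
  set φ : EuclideanSpace ℝ (Fin n) → ℝ := fun y => 1 / 2 * Real.log (c (e.symm y)) with hφ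
  have hφs : ContDiffOn ℝ ∞ φ e.target := contDiffOn_const.mul
    (hcs.log fun y hy => (hc _ (e.map_target hy)).1.ne')
  have hG' : ∀ y ∈ e.target, ∀ u v, chartMetric g e y u v = Real.exp (2 * φ y) * inner ℝ u v := by
    intro y hy u v
    rw [hG y hy, hφ, show 2 * (1 / 2 * Real.log (c (e.symm y))) = Real.log (c (e.symm y)) by ring,
      Real.exp_log (hc _ (e.map_target hy)).1]
  have hL := isLeviCivitaOn_conformal e.open_target hφs hG'
  have hc := fun y hy => h.curv_chart he hL (y := y) hy
  refine ⟨e, conformalConnection φ, hp, he, hL, fun y hy => h.unit_chart he hy, hc,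
    fun y hy => ?_⟩
  refine (isCodazziAt_conformalSchouten e.open_target hφs hy).2.congr ?_
  filter_upwards [e.open_target.mem_nhds hy] with z hz
  rw [hL.eq_schouten h3 hz (hc z hz), ← hL.eq_schouten h3 hz
    (curvature_conformalConnection e.open_target hφs hG' hz)]

theorem IsQCField.exists_isQCChart (h : IsQCField g H N ξ) (hn : 3 ≤ n)
    (hg : n = 3 → IsConformallyFlat g) (p : M) :
    ∃ e Γ, p ∈ e.source ∧ IsQCChart g H N ξ e Γ := by
  by_cases h4 : 4 ≤ n
  · exact ⟨_, _, mem_chart_source _ p, h.isQCChart h4 (IsManifold.chart_mem_maximalAtlas p)⟩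
  · exact h.exists_isQCChart_of_isConformallyFlat hn (hg (by omega)) p

/-- The horizontal curvature is continuous, in fact smooth. -/
theorem continuous_of_isQCChart (hn : 3 ≤ n)
    (hQ : ∀ p, ∃ e Γ, p ∈ e.source ∧ IsQCChart g H N ξ e Γ) : Continuous H := by
  refine continuous_iff_continuousAt.mpr fun p => ?_
  obtain ⟨e, Γ, hp, he, h⟩ := hQ p
  have h1 := (h.contDiffOn_curvatures (by simpa using hn)
    (ContinuousLinearEquiv.refl ℝ (EuclideanSpace ℝ (Fin n)))).2.continuousOn.continuousAt
    (e.open_target.mem_nhds (e.map_source hp))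
  have h2 := h1.comp (e.continuousAt hp)
  refine h2.congr ?_
  filter_upwards [e.open_source.mem_nhds hp] with q hq
  simp [e.left_inv hq]

end CurvatureFunctions

/-! ### The structure equations on a manifold -/

section BonnetManifold

open Topology Module

/-- Precomposition of the differential of a jet with a linear map. -/
def Jet.comp {E V : Type*} [NormedAddCommGroup E] [NormedSpace ℝ E]
    [NormedAddCommGroup V] [NormedSpace ℝ V] (p : Jet E V) (L : E →L[ℝ] E) : Jet E V :=
  (p.1, p.2.1.comp L, p.2.2)

lemma Jet.comp_eq_self {E V : Type*} [NormedAddCommGroup E] [NormedSpace ℝ E]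
    [NormedAddCommGroup V] [NormedSpace ℝ V] (p : Jet E V) {L L' : E →L[ℝ] E}
    (h : ∀ u, L (L' u) = u) : (p.comp L).comp L' = p := by
  refine Prod.ext rfl (Prod.ext ?_ rfl)
  ext u
  exact congrArg p.2.1 (h u)

lemma continuousAt_transition {n : ℕ} {M : Type*} [TopologicalSpace M] {x : M}
    {e e' : OpenPartialHomeomorph M (EuclideanSpace ℝ (Fin n))}
    (hx : x ∈ e.source) (hx' : x ∈ e'.source) :
    (∀ᶠ y in 𝓝 (e x), y ∈ (e.symm.trans e').source) ∧
      Filter.Tendsto (transition e e') (𝓝 (e x)) (𝓝 (e' x)) := by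
  have hmem : e x ∈ (e.symm.trans e').source :=
    ⟨e.map_source hx, by simpa [e.left_inv hx] using hx'⟩
  refine ⟨(e.symm.trans e').open_source.mem_nhds hmem, ?_⟩
  have := (e.symm.trans e').continuousAt hmem
  have h2 : (e.symm.trans e') (e x) = e' x := by simp [e.left_inv hx]
  rw [ContinuousAt, h2] at this
  exact this

variable {n : ℕ} {M : Type*} [TopologicalSpace M]
  [ChartedSpace (EuclideanSpace ℝ (Fin n)) M]
  {H N : M → ℝ} {ξ : M → EuclideanSpace ℝ (Fin n)} {κ : ℝ}
  {V : Type*} [NormedAddCommGroup V] [NormedSpace ℝ V]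
  {e e' : OpenPartialHomeomorph M (EuclideanSpace ℝ (Fin n))}
  {Γ Γ' : EuclideanSpace ℝ (Fin n) →
      EuclideanSpace ℝ (Fin n) →L[ℝ] EuclideanSpace ℝ (Fin n) →L[ℝ] EuclideanSpace ℝ (Fin n)}
  {u v : M → Jet (EuclideanSpace ℝ (Fin n)) V} {x : M}

/-- A field of jets in a chart. -/
def chartJet (e : OpenPartialHomeomorph M (EuclideanSpace ℝ (Fin n)))
    (u : M → Jet (EuclideanSpace ℝ (Fin n)) V) (y : EuclideanSpace ℝ (Fin n)) :
    Jet (EuclideanSpace ℝ (Fin n)) V := (u (e.symm y)).comp (chartFrame e y)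

lemma chartJet_comp_chartCoframe (he : e ∈ IsManifold.maximalAtlas (𝓡 n) ∞ M)
    (hx : x ∈ e.source) : (chartJet e u (e x)).comp (chartCoframe e x) = u x := by
  rw [chartJet, e.left_inv hx]
  exact Jet.comp_eq_self _ (chartFrame_chartCoframe he hx)

lemma chartJet_transition (he : e ∈ IsManifold.maximalAtlas (𝓡 n) ∞ M)
    (he' : e' ∈ IsManifold.maximalAtlas (𝓡 n) ∞ M) {y : EuclideanSpace ℝ (Fin n)}
    (hy : y ∈ (e.symm.trans e').source) :
    (chartJet e' u (transition e e' y)).comp (fderiv ℝ (transition e e') y) = chartJet e u y := by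
  rw [chartJet, chartJet, symm_transition hy]
  refine Prod.ext rfl (Prod.ext ?_ rfl)
  ext w
  exact congrArg (u (e.symm y)).2.1 (chartFrame_transition he he' hy w)

variable [IsManifold (𝓡 n) ∞ M] {g : SmoothMetric n M} [FiniteDimensional ℝ V]

variable (V) in
/-- The structure equations in a chart. -/
def chartSystem (g : SmoothMetric n M) (H N : M → ℝ) (ξ : M → EuclideanSpace ℝ (Fin n)) (κ : ℝ)
    (e : OpenPartialHomeomorph M (EuclideanSpace ℝ (Fin n)))
    (Γ : EuclideanSpace ℝ (Fin n) →
      EuclideanSpace ℝ (Fin n) →L[ℝ] EuclideanSpace ℝ (Fin n) →L[ℝ] EuclideanSpace ℝ (Fin n)) :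
    EuclideanSpace ℝ (Fin n) → EuclideanSpace ℝ (Fin n) →L[ℝ]
      Jet (EuclideanSpace ℝ (Fin n)) V →L[ℝ] Jet (EuclideanSpace ℝ (Fin n)) V :=
  bonnetSystem V κ (chartMetric g e) Γ (fun y => H (e.symm y)) (fun y => N (e.symm y))
    (fun y => chartCoframe e (e.symm y) (ξ (e.symm y)))

/-- The field of jets `u` solves the structure equations near the point `x`. -/
def SolvesNear (g : SmoothMetric n M) (H N : M → ℝ) (ξ : M → EuclideanSpace ℝ (Fin n)) (κ : ℝ)
    (u : M → Jet (EuclideanSpace ℝ (Fin n)) V) (x : M) : Prop :=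
  ∃ e Γ, IsQCChart g H N ξ e Γ ∧ x ∈ e.source ∧
    ∀ᶠ y in 𝓝 (e x), SolvesAt (chartSystem V g H N ξ κ e Γ) (chartJet e u) y

lemma SolvesAt.congr {E W : Type*} [NormedAddCommGroup E] [NormedSpace ℝ E]
    [NormedAddCommGroup W] [NormedSpace ℝ W] {Ω : E → E →L[ℝ] W →L[ℝ] W} {u v : E → W} {x : E}
    (h : SolvesAt Ω u x) (huv : v =ᶠ[𝓝 x] u) : SolvesAt Ω v x := by
  have := HasFDerivAt.congr_of_eventuallyEq h huv
  rwa [← huv.eq_of_nhds] at this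

/-- The structure equations do not depend on the chart. -/
lemma IsQCChart.solvesAt_of_solvesAt (h : IsQCChart g H N ξ e Γ) (h' : IsQCChart g H N ξ e' Γ')
    {y : EuclideanSpace ℝ (Fin n)} (hy : y ∈ (e.symm.trans e').source)
    (hu : SolvesAt (chartSystem V g H N ξ κ e' Γ') (chartJet e' u) (transition e e' y)) :
    SolvesAt (chartSystem V g H N ξ κ e Γ) (chartJet e u) y := by
  have hs := symm_transition hy
  have hξ : fderiv ℝ (transition e e') y (chartCoframe e (e.symm y) (ξ (e.symm y)))
      = chartCoframe e' (e'.symm (transition e e' y)) (ξ (e'.symm (transition e e' y))) := by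
    rw [hs, fderiv_transition h.mem h'.mem hy, ContinuousLinearMap.comp_apply]
    have := chartFrame_chartCoframe h.mem (e.map_target hy.1) (ξ (e.symm y))
    rw [e.right_inv hy.1] at this
    rw [this]
  refine (SolvesAt.comp_isometry (V := V)
    (h.isQCOn.toIsLeviCivitaOn.mono (e.symm.trans e').open_source fun y hy => hy.1)
    h'.isQCOn.toIsLeviCivitaOn (contDiffOn_transition h.mem h'.mem)
    (fun y hy => e'.map_source hy.2)
    (fun y hy => chartMetric_transition g h.mem h'.mem hy) hy
    (surjective_fderiv_transition h.mem h'.mem hy) (by rw [hs]) (by rw [hs]) hξ hu).congr ?_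
  filter_upwards [(e.symm.trans e').open_source.mem_nhds hy] with z hz
  exact (chartJet_transition h.mem h'.mem hz).symm

lemma SolvesNear.eventually_solvesAt (hu : SolvesNear g H N ξ κ u x) (h : IsQCChart g H N ξ e Γ)
    (hx : x ∈ e.source) :
    ∀ᶠ y in 𝓝 (e x), SolvesAt (chartSystem V g H N ξ κ e Γ) (chartJet e u) y := by
  obtain ⟨e', Γ', h', hx', hs⟩ := hu
  obtain ⟨h1, h2⟩ := continuousAt_transition hx hx'
  filter_upwards [h1, h2.eventually hs] with y hy hsy
  exact h.solvesAt_of_solvesAt h' hy hsy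

lemma IsQCChart.contDiffOn_chartSystem (hn : 3 ≤ n) (hκ : ∀ p, 0 < H p + κ)
    (h : IsQCChart g H N ξ e Γ) :
    ContDiffOn ℝ ∞ (chartSystem V g H N ξ κ e Γ) e.target :=
  h.isQCOn.contDiffOn_bonnetSystem (by simpa using hn)
    (h.isQCOn.contDiffOn_curvatures (by simpa using hn)
      (ContinuousLinearEquiv.refl ℝ (EuclideanSpace ℝ (Fin n)))).2 fun _ _ => hκ _

/-- The structure equations are completely integrable. -/
theorem isFlatSystem_solvesNear (hn : 3 ≤ n) (hκ : ∀ p, 0 < H p + κ)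
    (hQ : ∀ p, ∃ e Γ, p ∈ e.source ∧ IsQCChart g H N ξ e Γ) :
    IsFlatSystem (SolvesNear g H N ξ κ : (M → Jet (EuclideanSpace ℝ (Fin n)) V) → M → Prop) where
  eventuallyEq := by
    intro u v x hu hv huv
    obtain ⟨e, Γ, h, hx, hs⟩ := hu
    have hv' := hv.eventually_solvesAt h hx
    have heq := SolvesAt.eventuallyEq
      ((h.contDiffOn_chartSystem (V := V) hn hκ).continuousOn.continuousAt
        (e.open_target.mem_nhds (e.map_source hx))) hs hv'
      (by rw [chartJet, chartJet, e.left_inv hx, huv])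
    filter_upwards [(e.continuousAt hx).eventually heq, e.open_source.mem_nhds hx] with q hq hqe
    rw [← chartJet_comp_chartCoframe h.mem hqe (u := u), hq, chartJet_comp_chartCoframe h.mem hqe]
  exists_nhds := by
    intro x
    obtain ⟨e, Γ, hx, h⟩ := hQ x
    have hH := (h.isQCOn.contDiffOn_curvatures (by simpa using hn)
      (ContinuousLinearEquiv.refl ℝ (EuclideanSpace ℝ (Fin n)))).2
    obtain ⟨r, hr, hball, ⟨K, hK⟩, hsol⟩ := exists_ball_solvesAt e.open_target
      (h.contDiffOn_chartSystem (V := V) (κ := κ) hn hκ)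
      (fun y hy => h.isQCOn.isIntegrableAt_bonnetSystem (by simpa using hn) hH
        (fun _ _ => hκ _) hy) (e.map_source hx)
    refine ⟨e.source ∩ e ⁻¹' Metric.ball (e x) r, e.isOpen_inter_preimage Metric.isOpen_ball,
      ⟨hx, Metric.mem_ball_self hr⟩, fun y hy w => ?_, fun u v hu hv y hy huv z hz => ?_⟩
    · obtain ⟨s, hs, hsolve⟩ := hsol (e y) hy.2 (w.comp (chartFrame e (e y)))
      refine ⟨fun q => (s (e q)).comp (chartCoframe e q), ?_, fun z hz => ⟨e, Γ, h, hz.1, ?_⟩⟩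
      · change (s (e y)).comp _ = w
        rw [hs]
        exact Jet.comp_eq_self _ (chartFrame_chartCoframe h.mem hy.1)
      · filter_upwards [Metric.isOpen_ball.mem_nhds hz.2] with y' hy'
        refine (hsolve y' hy').congr ?_
        filter_upwards [Metric.isOpen_ball.mem_nhds hy'] with y'' hy''
        have ht := hball hy''
        rw [chartJet, e.right_inv ht]
        exact Jet.comp_eq_self _ (chartCoframe_chartFrame h.mem ht)
    · have key : ∀ {u : M → Jet (EuclideanSpace ℝ (Fin n)) V},
          (∀ z ∈ e.source ∩ e ⁻¹' Metric.ball (e x) r, SolvesNear g H N ξ κ u z) →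
          ∀ y ∈ Metric.ball (e x) r,
            SolvesAt (chartSystem V g H N ξ κ e Γ) (chartJet e u) y := by
        intro u hu y hy
        have ht := hball hy
        have hm := e.map_target ht
        have := ((hu (e.symm y) ⟨hm, by simpa [e.right_inv ht] using hy⟩).eventually_solvesAt
          h hm).self_of_nhds
        rwa [e.right_inv ht] at this
      have huv' : chartJet e u (e y) = chartJet e v (e y) := by
        rw [chartJet, chartJet, e.left_inv hy.1, huv]
      have hyb : e y ∈ Metric.ball (e x) r := hy.2
      have heq : chartJet e u (e z) = chartJet e v (e z) :=
        SolvesAt.eqOn (convex_ball _ _) hK (key hu) (key hv) hyb huv' hz.2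
      rw [← chartJet_comp_chartCoframe h.mem hz.1 (u := u), heq,
        chartJet_comp_chartCoframe h.mem hz.1]

end BonnetManifold

/-! ### Conservation of the Gram matrix of a solution -/

section Gram

open Topology Module

variable {E V : Type*} [NormedAddCommGroup E] [NormedSpace ℝ E]
  [NormedAddCommGroup V] [NormedSpace ℝ V]

lemma bilin_ext {F : Type*} [NormedAddCommGroup F] [NormedSpace ℝ F] {b b' : E →L[ℝ] E →L[ℝ] F}
    (h : ∀ X Y, b X Y = b' X Y) : b = b' :=
  ContinuousLinearMap.ext fun X => ContinuousLinearMap.ext (h X)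

/-- The frame of `V` given by a jet `(F, Φ, ν)`. For `κ = 0` the position does not take part. -/
def frameMap (κ : ℝ) (p : Jet E V) : E × ℝ × ℝ →L[ℝ] V :=
  p.2.1.comp (ContinuousLinearMap.fst ℝ E (ℝ × ℝ))
    + ((ContinuousLinearMap.fst ℝ ℝ ℝ).comp (ContinuousLinearMap.snd ℝ E (ℝ × ℝ))).smulRight p.2.2
    + κ • ((ContinuousLinearMap.snd ℝ ℝ ℝ).comp
      (ContinuousLinearMap.snd ℝ E (ℝ × ℝ))).smulRight p.1

lemma frameMap_apply (κ : ℝ) (p : Jet E V) (X : E × ℝ × ℝ) :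
    frameMap κ p X = p.2.1 X.1 + X.2.1 • p.2.2 + κ • X.2.2 • p.1 := rfl

/-- The Gram matrix that the frame of an isometric immersion has. -/
def modelForm (κ : ℝ) (b : E →L[ℝ] E →L[ℝ] ℝ) (X Y : E × ℝ × ℝ) : ℝ :=
  b X.1 Y.1 + X.2.1 * Y.2.1 - κ * (X.2.2 * Y.2.2)

/-- The jet `p` satisfies the algebraic relations of an isometric immersion with unit normal
into the space form of curvature `-κ`, where `b` is the metric on `E` and `B` that on `V`. -/
def IsAdapted (B : V →L[ℝ] V →L[ℝ] ℝ) (κ : ℝ) (b : E →L[ℝ] E →L[ℝ] ℝ) (p : Jet E V) : Prop :=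
  ∀ X Y, B (frameMap κ p X) (frameMap κ p Y) = modelForm κ b X Y

variable [FiniteDimensional ℝ E]

/-- The deviation of the Gram matrix of the frame of a jet from the model. -/
def gramDefect (B : V →L[ℝ] V →L[ℝ] ℝ) (κ : ℝ) (b : E →L[ℝ] E →L[ℝ] ℝ) (p : Jet E V) :
    E × ℝ × ℝ →L[ℝ] E × ℝ × ℝ →L[ℝ] ℝ :=
  toBilin <| LinearMap.mk₂ ℝ
    (fun X Y => B (frameMap κ p X) (frameMap κ p Y) - modelForm κ b X Y)
    (fun X X' Y => by simp [modelForm]; ring) (fun c X Y => by simp [modelForm]; ring)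
    (fun X Y Y' => by simp [modelForm]; ring) (fun c X Y => by simp [modelForm]; ring)

lemma gramDefect_apply (B : V →L[ℝ] V →L[ℝ] ℝ) (κ : ℝ) (b : E →L[ℝ] E →L[ℝ] ℝ) (p : Jet E V)
    (X Y : E × ℝ × ℝ) : gramDefect B κ b p X Y
      = B (frameMap κ p X) (frameMap κ p Y) - modelForm κ b X Y := rfl

lemma gramDefect_eq_zero_iff {B : V →L[ℝ] V →L[ℝ] ℝ} {κ : ℝ} {b : E →L[ℝ] E →L[ℝ] ℝ}
    {p : Jet E V} : gramDefect B κ b p = 0 ↔ IsAdapted B κ b p := by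
  constructor
  · intro h X Y
    have : gramDefect B κ b p X Y = 0 := by rw [h]; rfl
    rwa [gramDefect_apply, sub_eq_zero] at this
  · intro h
    refine bilin_ext fun X Y => ?_
    rw [gramDefect_apply, h X Y, sub_self]
    rfl

/-- The derivative of the frame of a solution, in terms of the frame. -/
def frameConnection (κ : ℝ) (Γ : E →L[ℝ] E →L[ℝ] E) (h b : E →L[ℝ] E →L[ℝ] ℝ)
    (A : E →L[ℝ] E) : E →L[ℝ] E × ℝ × ℝ →L[ℝ] E × ℝ × ℝ :=
  toBilin <| LinearMap.mk₂ ℝ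
    (fun v X => (Γ v X.1 - X.2.1 • A v + κ • X.2.2 • v, h v X.1, b v X.1))
    (fun v v' X => by ext <;> simp; module) (fun c v X => by ext <;> simp; module)
    (fun v X X' => by ext <;> simp; module) (fun c v X => by ext <;> simp; module)

lemma frameConnection_apply (κ : ℝ) (Γ : E →L[ℝ] E →L[ℝ] E) (h b : E →L[ℝ] E →L[ℝ] ℝ)
    (A : E →L[ℝ] E) (v : E) (X : E × ℝ × ℝ) : frameConnection κ Γ h b A v X
      = (Γ v X.1 - X.2.1 • A v + κ • X.2.2 • v, h v X.1, b v X.1) := rfl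

/-- The linear equation for the Gram matrix. -/
def gramSystem (C : E →L[ℝ] E × ℝ × ℝ →L[ℝ] E × ℝ × ℝ) :
    E →L[ℝ] (E × ℝ × ℝ →L[ℝ] E × ℝ × ℝ →L[ℝ] ℝ) →L[ℝ] (E × ℝ × ℝ →L[ℝ] E × ℝ × ℝ →L[ℝ] ℝ) :=
  toBilin <| LinearMap.mk₂ ℝ
    (fun v Z => Z.bilinearComp (C v) (ContinuousLinearMap.id ℝ _)
      + Z.bilinearComp (ContinuousLinearMap.id ℝ _) (C v))
    (fun v v' Z => bilin_ext fun X Y => by simp; ring)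
    (fun c v Z => bilin_ext fun X Y => by simp)
    (fun v Z Z' => bilin_ext fun X Y => by simp; ring)
    (fun c v Z => bilin_ext fun X Y => by simp)

lemma gramSystem_apply (C : E →L[ℝ] E × ℝ × ℝ →L[ℝ] E × ℝ × ℝ) (v : E)
    (Z : E × ℝ × ℝ →L[ℝ] E × ℝ × ℝ →L[ℝ] ℝ) (X Y : E × ℝ × ℝ) :
    gramSystem C v Z X Y = Z (C v X) Y + Z X (C v Y) := rfl

variable [FiniteDimensional ℝ V] {G : E → E →L[ℝ] E →L[ℝ] ℝ} {Γ : E → E →L[ℝ] E →L[ℝ] E}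
  {U : Set E} {H N : E → ℝ} {ξ : E → E} {x : E} {κ : ℝ} {u : E → Jet E V}
  {B : V →L[ℝ] V →L[ℝ] ℝ}

/-- The connection of the frame of a solution. -/
def qcConnection (κ : ℝ) (G : E → E →L[ℝ] E →L[ℝ] ℝ) (Γ : E → E →L[ℝ] E →L[ℝ] E)
    (H N : E → ℝ) (ξ : E → E) (x : E) : E →L[ℝ] E × ℝ × ℝ →L[ℝ] E × ℝ × ℝ :=
  frameConnection κ (Γ x) (secondForm (G x) (H x) (N x) κ (ξ x)) (G x)
    (shapeOperator (G x) (H x) (N x) κ (ξ x))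

lemma SolvesAt.hasFDerivAt_frameMap (hu : SolvesAt (bonnetSystem V κ G Γ H N ξ) u x)
    (X : E × ℝ × ℝ) : ∃ D : E →L[ℝ] V, HasFDerivAt (fun y => frameMap κ (u y) X) D x ∧
      ∀ v, D v = frameMap κ (u x) (qcConnection κ G Γ H N ξ x v X) := by
  have du : HasFDerivAt u _ x := hu
  have d1 := hasFDerivAt_fst.comp x du
  have d2 := hasFDerivAt_fst.comp x (hasFDerivAt_snd.comp x du)
  have d3 := hasFDerivAt_snd.comp x (hasFDerivAt_snd.comp x du)
  refine ⟨_, ((d2.clm_apply (hasFDerivAt_const (𝕜 := ℝ) X.1 x)).add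
    (d3.const_smul X.2.1)).add ((d1.const_smul X.2.2).const_smul κ), fun v => ?_⟩
  simp [bonnetSystem, structureMap_apply, frameMap_apply, qcConnection, frameConnection_apply]
  module

/-- The deviation of the Gram matrix of a solution from the model satisfies a homogeneous linear
equation. -/
theorem IsQCOn.solvesAt_gramDefect (h : IsQCOn G Γ U H N ξ)
    (hu : ∀ y ∈ U, SolvesAt (bonnetSystem V κ G Γ H N ξ) u y) (hus : ContDiffOn ℝ ∞ u U)
    (hx : x ∈ U) :
    SolvesAt (fun y => gramSystem (qcConnection κ G Γ H N ξ y))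
      (fun y => gramDefect B κ (G y) (u y)) x := by
  have hus' : ∀ X, ContDiffOn ℝ ∞ (fun y => frameMap κ (u y) X) U := fun X =>
    ((hus.snd.fst.clm_apply contDiffOn_const).add (hus.snd.snd.const_smul X.2.1)).add
      ((hus.fst.const_smul X.2.2).const_smul κ)
  have hs : ContDiffOn ℝ ∞ (fun y => gramDefect B κ (G y) (u y)) U := by
    refine contDiffOn_bilin fun X Y => ?_
    refine ContDiffOn.sub ((B.contDiff.comp_contDiffOn (hus' X)).clm_apply (hus' Y)) ?_
    exact (((h.contDiffOn_metric.clm_apply contDiffOn_const).clm_apply contDiffOn_const).add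
      contDiffOn_const).sub contDiffOn_const
  have dZ := hasFDerivAt_of_contDiffOn hs h.isOpen hx
  refine dZ.congr_fderiv ?_
  refine ContinuousLinearMap.ext fun t => bilin_ext fun X Y => ?_
  have e1 := hasFDerivAt_apply₂ dZ (hasFDerivAt_const (𝕜 := ℝ) X x)
    (hasFDerivAt_const (𝕜 := ℝ) Y x) t
  obtain ⟨DX, dX, hDX⟩ := (hu x hx).hasFDerivAt_frameMap X
  obtain ⟨DY, dY, hDY⟩ := (hu x hx).hasFDerivAt_frameMap Y
  have h1 := (B.hasFDerivAt.comp x dX).clm_apply dY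
  have h2 := ((h.hasFDerivAt_metric hx).clm_apply (hasFDerivAt_const (𝕜 := ℝ) X.1 x)).clm_apply
    (hasFDerivAt_const (𝕜 := ℝ) Y.1 x)
  have h3 := h1.sub ((h2.add_const (X.2.1 * Y.2.1)).sub_const (κ * (X.2.2 * Y.2.2)))
  have e3 := congrArg (fun L : E →L[ℝ] ℝ => L t) h3.fderiv
  have e4 := e1.symm.trans e3
  have hsym : ∀ v w, G x v w = G x w v := h.symm_metric x hx
  have hA : ∀ v w, G x (shapeOperator (G x) (H x) (N x) κ (ξ x) v) w
      = secondForm (G x) (H x) (N x) κ (ξ x) v w := apply_shapeOperator _ _ _ _ _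
  simp only [map_zero, add_zero, zero_apply] at e4
  rw [e4]
  simp only [ContinuousLinearMap.flip_apply, gramSystem_apply, gramDefect_apply]
  simp [hDX, hDY, h.compat x hx, modelForm, qcConnection, frameConnection_apply,
    -secondForm_apply, hA, hsym X.1]
  ring

theorem IsQCOn.contDiffOn_gramSystem (h : IsQCOn G Γ U H N ξ) (hn : 3 ≤ finrank ℝ E)
    (hH : ContDiffOn ℝ ∞ H U) (hκ : ∀ y ∈ U, 0 < H y + κ) :
    ContDiffOn ℝ ∞ (fun y => gramSystem (qcConnection κ G Γ H N ξ y)) U := by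
  have hA := h.contDiffOn_shapeOperator hn hH hκ
  have hh := h.contDiffOn_secondForm hn hH hκ
  have hC : ∀ v X, ContDiffOn ℝ ∞ (fun y => qcConnection κ G Γ H N ξ y v X) U := by
    intro v X
    exact ((((h.contDiffOn.clm_apply contDiffOn_const).clm_apply contDiffOn_const).sub
      ((hA.clm_apply contDiffOn_const).const_smul X.2.1)).add contDiffOn_const).prodMk
      (((hh.clm_apply contDiffOn_const).clm_apply contDiffOn_const).prodMk
      ((h.contDiffOn_metric.clm_apply contDiffOn_const).clm_apply contDiffOn_const))
  refine contDiffOn_bilin fun v Z => contDiffOn_bilin fun X Y => ?_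
  exact ((Z.contDiff.comp_contDiffOn (hC v X)).clm_apply contDiffOn_const).add
    ((Z X).contDiff.comp_contDiffOn (hC v Y))

end Gram

section BonnetManifold

open Topology Module

variable {n : ℕ} {M : Type*} [TopologicalSpace M]
  [ChartedSpace (EuclideanSpace ℝ (Fin n)) M] [IsManifold (𝓡 n) ∞ M] {g : SmoothMetric n M}
  {H N : M → ℝ} {ξ : M → EuclideanSpace ℝ (Fin n)} {κ : ℝ}
  {V : Type*} [NormedAddCommGroup V] [NormedSpace ℝ V]
  {e e' : OpenPartialHomeomorph M (EuclideanSpace ℝ (Fin n))}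
  {Γ Γ' : EuclideanSpace ℝ (Fin n) →
      EuclideanSpace ℝ (Fin n) →L[ℝ] EuclideanSpace ℝ (Fin n) →L[ℝ] EuclideanSpace ℝ (Fin n)}
  {u v : M → Jet (EuclideanSpace ℝ (Fin n)) V} {x : M} {B : V →L[ℝ] V →L[ℝ] ℝ}

lemma eventually_norm_le {E W : Type*} [NormedAddCommGroup E] [NormedSpace ℝ E]
    [NormedAddCommGroup W] [NormedSpace ℝ W] {Ω : E → E →L[ℝ] W →L[ℝ] W} {x : E}
    (h : ContinuousAt Ω x) : ∀ᶠ y in 𝓝 x, ‖Ω y‖ ≤ ‖Ω x‖ + 1 :=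
  (h.norm.eventually_lt_const (lt_add_one _)).mono fun _ hy => hy.le

/-- The shape operator at a point. -/
def shapeAt (g : SmoothMetric n M) (H N : M → ℝ) (ξ : M → EuclideanSpace ℝ (Fin n)) (κ : ℝ)
    (p : M) : EuclideanSpace ℝ (Fin n) →L[ℝ] EuclideanSpace ℝ (Fin n) :=
  shapeOperator (metricAt g p) (H p) (N p) κ (ξ p)

lemma chartFrame_shapeOperator (he : e ∈ IsManifold.maximalAtlas (𝓡 n) ∞ M) (hx : x ∈ e.source)
    (w : EuclideanSpace ℝ (Fin n)) :
    chartFrame e (e x) (shapeOperator (chartMetric g e (e x)) (H x) (N x) κ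
      (chartCoframe e x (ξ x)) (chartCoframe e x w)) = shapeAt g H N ξ κ x w := by
  simp only [shapeAt, shapeOperator_apply, chartMetric_apply, map_add, map_smul,
    chartFrame_chartCoframe he hx, e.left_inv hx]

lemma isAdapted_chartJet_iff (he : e ∈ IsManifold.maximalAtlas (𝓡 n) ∞ M) (hx : x ∈ e.source) :
    IsAdapted B κ (chartMetric g e (e x)) (chartJet e u (e x))
      ↔ IsAdapted B κ (metricAt g x) (u x) := by
  have key : ∀ X : EuclideanSpace ℝ (Fin n) × ℝ × ℝ, frameMap κ (chartJet e u (e x)) X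
      = frameMap κ (u x) (chartFrame e (e x) X.1, X.2) := fun X => by
    rw [chartJet, e.left_inv hx]
    rfl
  have hm : ∀ X Y : EuclideanSpace ℝ (Fin n) × ℝ × ℝ, modelForm κ (chartMetric g e (e x)) X Y
      = modelForm κ (metricAt g x) (chartFrame e (e x) X.1, X.2)
        (chartFrame e (e x) Y.1, Y.2) := fun X Y => by
    rw [modelForm, chartMetric_apply, e.left_inv hx]
    rfl
  constructor
  · intro h X Y
    have := h (chartCoframe e x X.1, X.2) (chartCoframe e x Y.1, Y.2)
    rw [key, key, hm] at this
    simpa [chartFrame_chartCoframe he hx] using this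
  · intro h X Y
    rw [key, key, hm]
    exact h _ _

variable [FiniteDimensional ℝ V]

lemma SolvesNear.contDiffAt_chartJet (hn : 3 ≤ n) (hκ : ∀ p, 0 < H p + κ)
    (h : IsQCChart g H N ξ e Γ) (hx : x ∈ e.source) (hu : SolvesNear g H N ξ κ u x) :
    ContDiffAt ℝ ∞ (chartJet e u) (e x) := by
  obtain ⟨O, hO, hOo, hxO⟩ := eventually_nhds_iff.mp
    ((hu.eventually_solvesAt h hx).and (e.open_target.mem_nhds (e.map_source hx)))
  exact (SolvesAt.contDiffOn hOo
    ((h.contDiffOn_chartSystem (V := V) hn hκ).mono fun y hy => (hO y hy).2)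
    fun y hy => (hO y hy).1).contDiffAt (hOo.mem_nhds hxO)

/-- The jets of a solution are continuous in each chart. -/
lemma SolvesNear.continuousAt_chartJet (hn : 3 ≤ n) (hκ : ∀ p, 0 < H p + κ)
    (hu : SolvesNear g H N ξ κ u x) (he : e ∈ IsManifold.maximalAtlas (𝓡 n) ∞ M)
    (hx : x ∈ e.source) : ContinuousAt (chartJet e u) (e x) := by
  obtain ⟨e', Γ', h', hx', -⟩ := id hu
  have h1 := (hu.contDiffAt_chartJet hn hκ h' hx').continuousAt
  obtain ⟨h2, h3⟩ := continuousAt_transition hx hx'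
  have hτ : transition e e' (e x) = e' x := by rw [transition, e.left_inv hx]
  have h4 : ContinuousAt (fun y => chartJet e' u (transition e e' y)) (e x) := by
    rw [← hτ] at h1 h3
    exact Filter.Tendsto.comp h1 h3
  have h5 : ContinuousAt (fderiv ℝ (transition e e')) (e x) :=
    ((contDiffOn_fderiv (contDiffOn_transition he h'.mem)
      (e.symm.trans e').open_source).continuousOn).continuousAt
      ((e.symm.trans e').open_source.mem_nhds h2.self_of_nhds)
  have h6 : ContinuousAt (fun y => (chartJet e' u (transition e e' y)).comp
      (fderiv ℝ (transition e e') y)) (e x) :=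
    h4.fst.prodMk ((h4.snd.fst.clm_comp h5).prodMk h4.snd.snd)
  refine h6.congr ?_
  filter_upwards [h2] with y hy using chartJet_transition he h'.mem hy

/-- A solution of the structure equations is a smooth map together with its differential and a
smooth vector field along it, whose differential is given by the shape operator. -/
theorem SolvesNear.hasMFDerivAt (hn : 3 ≤ n) (hκ : ∀ p, 0 < H p + κ)
    (hu : SolvesNear g H N ξ κ u x) :
    (ContMDiffAt (𝓡 n) 𝓘(ℝ, V) ∞ (fun q => (u q).1) x ∧
      HasMFDerivAt (𝓡 n) 𝓘(ℝ, V) (fun q => (u q).1) x (u x).2.1) ∧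
    (ContMDiffAt (𝓡 n) 𝓘(ℝ, V) ∞ (fun q => (u q).2.2) x ∧
      HasMFDerivAt (𝓡 n) 𝓘(ℝ, V) (fun q => (u q).2.2) x
        (-(u x).2.1.comp (shapeAt g H N ξ κ x))) := by
  obtain ⟨e, Γ, h, hx, hs⟩ := id hu
  have hc := hu.contDiffAt_chartJet hn hκ h hx
  have hd : HasFDerivAt (chartJet e u) _ (e x) := hs.self_of_nhds
  have he : ContMDiffAt (𝓡 n) (𝓡 n) ∞ e x :=
    (contMDiffOn_of_mem_maximalAtlas h.mem).contMDiffAt (e.open_source.mem_nhds hx)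
  have hed := (he.mdifferentiableAt (by simp)).hasMFDerivAt
  have key : ∀ (f : EuclideanSpace ℝ (Fin n) → V) (F : M → V)
      (D : EuclideanSpace ℝ (Fin n) →L[ℝ] V) (D' : EuclideanSpace ℝ (Fin n) →L[ℝ] V),
      ContDiffAt ℝ ∞ f (e x) → HasFDerivAt f D (e x) → (∀ q ∈ e.source, f (e q) = F q) →
      (∀ w, D (chartCoframe e x w) = D' w) →
      ContMDiffAt (𝓡 n) 𝓘(ℝ, V) ∞ F x ∧ HasMFDerivAt (𝓡 n) 𝓘(ℝ, V) F x D' := by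
    intro f F D D' hf hD hF hDD
    have heq : F =ᶠ[𝓝 x] f ∘ e := by
      filter_upwards [e.open_source.mem_nhds hx] with q hq using (hF q hq).symm
    refine ⟨(hf.contMDiffAt.comp x he).congr_of_eventuallyEq heq, ?_⟩
    have h1 := (hD.hasMFDerivAt.comp x hed).congr_of_eventuallyEq heq
    have h2 : D.comp (chartCoframe e x) = D' := ContinuousLinearMap.ext hDD
    exact h2 ▸ h1
  have hfr : ∀ q ∈ e.source, chartJet e u (e q) = (u q).comp (chartFrame e (e q)) := fun q hq => by
    rw [chartJet, e.left_inv hq]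
  refine ⟨key _ _ _ _ hc.fst hd.fst (fun q hq => ?_) fun w => ?_,
    key _ _ _ _ hc.snd.snd hd.snd.snd (fun q hq => ?_) fun w => ?_⟩
  · rw [hfr q hq]
    rfl
  · change (chartJet e u (e x)).2.1 (chartCoframe e x w) = _
    rw [hfr x hx]
    exact congrArg (u x).2.1 (chartFrame_chartCoframe h.mem hx w)
  · rw [hfr q hq]
    rfl
  · change -(chartJet e u (e x)).2.1 (shapeOperator _ (H (e.symm (e x))) (N (e.symm (e x))) κ
      (chartCoframe e (e.symm (e x)) (ξ (e.symm (e x)))) (chartCoframe e x w)) = _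
    rw [hfr x hx, e.left_inv hx]
    exact congrArg (fun z => -(u x).2.1 z) (chartFrame_shapeOperator h.mem hx w)

/-- The relations of an isometric immersion propagate along a solution. -/
theorem SolvesNear.eventually_isAdapted_iff (hn : 3 ≤ n) (hκ : ∀ p, 0 < H p + κ)
    (hu : SolvesNear g H N ξ κ u x) (B : V →L[ℝ] V →L[ℝ] ℝ) :
    ∀ᶠ q in 𝓝 x, IsAdapted B κ (metricAt g q) (u q) ↔ IsAdapted B κ (metricAt g x) (u x) := by
  obtain ⟨e, Γ, h, hx, hs⟩ := id hu
  have h3 : 3 ≤ finrank ℝ (EuclideanSpace ℝ (Fin n)) := by simpa using hn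
  have hsys := h.isQCOn.contDiffOn_gramSystem (κ := κ) h3
    (h.isQCOn.contDiffOn_curvatures h3
      (ContinuousLinearEquiv.refl ℝ (EuclideanSpace ℝ (Fin n)))).2 (fun _ _ => hκ _)
  have hcont := hsys.continuousOn.continuousAt (e.open_target.mem_nhds (e.map_source hx))
  have hbd := eventually_norm_le hcont
  obtain ⟨r, hr, hball⟩ := Metric.mem_nhds_iff.mp
    ((hs.and hbd).and (e.open_target.mem_nhds (e.map_source hx)))
  have hQ : IsQCOn (chartMetric g e) Γ (Metric.ball (e x) r) _ _ _ :=
    { h.isQCOn.toIsLeviCivitaOn.mono Metric.isOpen_ball (fun y hy => (hball hy).2) with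
      unit := fun y hy => h.isQCOn.unit y (hball hy).2
      curv := fun y hy => h.isQCOn.curv y (hball hy).2
      codazzi := fun y hy => h.isQCOn.codazzi y (hball hy).2 }
  have hsm := SolvesAt.contDiffOn Metric.isOpen_ball
    ((h.contDiffOn_chartSystem (V := V) hn hκ).mono fun y hy => (hball hy).2)
    fun y hy => (hball hy).1.1
  have hZ := fun y hy => hQ.solvesAt_gramDefect (B := B) (κ := κ) (x := y)
    (fun y hy => (hball hy).1.1) hsm hy
  have h0 : ∀ y : EuclideanSpace ℝ (Fin n), SolvesAt
      (fun y => gramSystem (qcConnection κ (chartMetric g e) Γ (fun y => H (e.symm y))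
        (fun y => N (e.symm y)) (fun y => chartCoframe e (e.symm y) (ξ (e.symm y))) y))
      (fun _ => 0) y := by
    intro y
    refine (hasFDerivAt_const _ y).congr_fderiv ?_
    simp
  have key : ∀ y ∈ Metric.ball (e x) r, ∀ z ∈ Metric.ball (e x) r,
      IsAdapted B κ (chartMetric g e y) (chartJet e u y) →
      IsAdapted B κ (chartMetric g e z) (chartJet e u z) := by
    intro y hy z hz hya
    rw [← gramDefect_eq_zero_iff] at hya ⊢
    exact SolvesAt.eqOn (convex_ball _ _) (fun y hy => (hball hy).1.2) hZ
      (fun y _ => h0 y) hy hya hz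
  filter_upwards [e.open_source.mem_nhds hx,
    (e.continuousAt hx).eventually (Metric.ball_mem_nhds _ hr)] with q hq hqb
  rw [← isAdapted_chartJet_iff h.mem hq, ← isAdapted_chartJet_iff h.mem hx]
  exact ⟨key _ hqb _ (Metric.mem_ball_self hr), key _ (Metric.mem_ball_self hr) _ hqb⟩

end BonnetManifold

/-! ### Frames of a space form and its isometries -/

section Frames

open Topology Module

variable {E V K : Type*} [NormedAddCommGroup E] [NormedSpace ℝ E]
  [NormedAddCommGroup V] [NormedSpace ℝ V]
  [NormedAddCommGroup K] [NormedSpace ℝ K]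

/-- A linear functional `ι` on `K` which selects the part of the frame of a jet that is linearly
independent: `K` is `ℝ` if `κ ≠ 0`, when the position is part of the frame, and trivial
if `κ = 0`. -/
structure IsFrameIndex (E V : Type*) [NormedAddCommGroup E] [NormedSpace ℝ E]
    [NormedAddCommGroup V] [NormedSpace ℝ V] (κ : ℝ) (ι : K →L[ℝ] ℝ) : Prop where
  eq_zero : ∀ r, κ * ι r = 0 → r = 0
  exists_eq : ∃ r, κ * ι r = κ
  finrank_eq : finrank ℝ (E × ℝ × K) = finrank ℝ V

/-- The linearly independent part of the frame of a jet. -/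
def reducedFrame (κ : ℝ) (ι : K →L[ℝ] ℝ) (p : Jet E V) : E × ℝ × K →L[ℝ] V :=
  (frameMap κ p).comp
    ((ContinuousLinearMap.id ℝ E).prodMap ((ContinuousLinearMap.id ℝ ℝ).prodMap ι))

lemma reducedFrame_apply (κ : ℝ) (ι : K →L[ℝ] ℝ) (p : Jet E V) (X : E × ℝ × K) :
    reducedFrame κ ι p X = p.2.1 X.1 + X.2.1 • p.2.2 + κ • ι X.2.2 • p.1 := rfl

lemma reducedFrame_comp (κ : ℝ) (ι : K →L[ℝ] ℝ) (p : Jet E V) (L : E →L[ℝ] E) :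
    reducedFrame κ ι (p.comp L)
      = (reducedFrame κ ι p).comp (L.prodMap (ContinuousLinearMap.id ℝ (ℝ × K))) := rfl

variable {B : V →L[ℝ] V →L[ℝ] ℝ} {κ : ℝ} {b : E →L[ℝ] E →L[ℝ] ℝ} {p p' : Jet E V} {ι : K →L[ℝ] ℝ}

lemma IsAdapted.injective_reducedFrame (h : IsAdapted B κ b p) (hb : ∀ v, v ≠ 0 → 0 < b v v)
    (hι : IsFrameIndex E V κ ι) : Function.Injective (reducedFrame κ ι p) := by
  refine (injective_iff_map_eq_zero _).mpr fun X hX => ?_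
  have key : ∀ Y : E × ℝ × ℝ, modelForm κ b (X.1, X.2.1, ι X.2.2) Y = 0 := fun Y => by
    rw [← h, show frameMap κ p (X.1, X.2.1, ι X.2.2) = 0 from hX, map_zero]
    rfl
  have h1 : X.1 = 0 := by
    by_contra hne
    have := key (X.1, 0, 0)
    simp only [modelForm, mul_zero, add_zero, sub_zero] at this
    exact (hb _ hne).ne' this
  have h2 : X.2.1 = 0 := by simpa [modelForm] using key (0, 1, 0)
  have h3 : X.2.2 = 0 := hι.eq_zero _ (by simpa [modelForm] using key (0, 0, 1))
  exact Prod.ext h1 (Prod.ext h2 h3)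

/-- The affine map with linear part `A` and translation part `a`, acting on jets. -/
def Jet.act [FiniteDimensional ℝ V] (A : V ≃ₗ[ℝ] V) (a : V) (p : Jet E V) : Jet E V :=
  (A p.1 + a, A.toContinuousLinearEquiv.toContinuousLinearMap.comp p.2.1, A p.2.2)

variable [FiniteDimensional ℝ V]

lemma frameMap_act (A : V ≃ₗ[ℝ] V) {a : V} (ha : κ • a = 0) (p : Jet E V) (X : E × ℝ × ℝ) :
    frameMap κ (p.act A a) X = A (frameMap κ p X) := by
  have h1 : (p.act A a).2.1 X.1 = A (p.2.1 X.1) := rfl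
  have h2 : κ • X.2.2 • (A p.1 + a) = κ • X.2.2 • A p.1 := by
    rw [smul_add, smul_add, smul_comm κ X.2.2 a, ha, smul_zero, add_zero]
  rw [frameMap_apply, frameMap_apply, h1, map_add, map_add, map_smul, map_smul, map_smul]
  change _ + _ • A p.2.2 + κ • X.2.2 • (A p.1 + a) = _
  rw [h2]

lemma reducedFrame_act (A : V ≃ₗ[ℝ] V) {a : V} (ha : κ • a = 0) (p : Jet E V) (X : E × ℝ × K) :
    reducedFrame κ ι (p.act A a) X = A (reducedFrame κ ι p X) :=
  frameMap_act A ha p _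

/-- The determinant of the frame of a jet with respect to a fixed frame. -/
def frameDet (κ : ℝ) (ι : K →L[ℝ] ℝ) (Θ : V ≃ₗ[ℝ] E × ℝ × K) (p : Jet E V) : ℝ :=
  (Θ.toContinuousLinearEquiv.toContinuousLinearMap.comp (reducedFrame κ ι p)).det

variable {Θ : V ≃ₗ[ℝ] E × ℝ × K}

lemma frameDet_act (A : V ≃ₗ[ℝ] V) {a : V} (ha : κ • a = 0) (p : Jet E V) :
    frameDet κ ι Θ (p.act A a) = LinearMap.det A.toLinearMap * frameDet κ ι Θ p := by
  rw [← LinearMap.det_conj A.toLinearMap Θ]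
  refine Eq.trans ?_ (LinearMap.det_comp _ _)
  refine congrArg LinearMap.det (LinearMap.ext fun X => ?_)
  change Θ (reducedFrame κ ι (p.act A a) X) = Θ (A (Θ.symm (Θ (reducedFrame κ ι p X))))
  rw [reducedFrame_act A ha, LinearEquiv.symm_apply_apply]

variable [FiniteDimensional ℝ E] [FiniteDimensional ℝ K]

/-- The frame of an adapted jet, as a linear equivalence. -/
def IsAdapted.frameEquiv (h : IsAdapted B κ b p) (hb : ∀ v, v ≠ 0 → 0 < b v v)
    (hι : IsFrameIndex E V κ ι) : (E × ℝ × K) ≃ₗ[ℝ] V :=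
  LinearMap.linearEquivOfInjective (reducedFrame κ ι p).toLinearMap
    (h.injective_reducedFrame hb hι) hι.finrank_eq

lemma IsAdapted.frameEquiv_apply (h : IsAdapted B κ b p) (hb : ∀ v, v ≠ 0 → 0 < b v v)
    (hι : IsFrameIndex E V κ ι) (X : E × ℝ × K) :
    h.frameEquiv hb hι X = reducedFrame κ ι p X :=
  LinearMap.linearEquivOfInjective_apply _ _ _

/-- Any two adapted jets with the same metric differ by an isometry. -/
theorem IsAdapted.exists_act (h : IsAdapted B κ b p) (h' : IsAdapted B κ b p')
    (hb : ∀ v, v ≠ 0 → 0 < b v v) (hι : IsFrameIndex E V κ ι) :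
    ∃ (A : V ≃ₗ[ℝ] V) (a : V), κ • a = 0 ∧ (∀ x y, B (A x) (A y) = B x y) ∧ p' = p.act A a := by
  set A : V ≃ₗ[ℝ] V := (h.frameEquiv hb hι).symm.trans (h'.frameEquiv hb hι) with hA
  have hAf : ∀ X, A (reducedFrame κ ι p X) = reducedFrame κ ι p' X := fun X => by
    rw [hA, LinearEquiv.trans_apply, ← h.frameEquiv_apply hb hι, LinearEquiv.symm_apply_apply,
      h'.frameEquiv_apply]
  have hsurj : ∀ x, ∃ X, x = reducedFrame κ ι p X := fun x =>
    ⟨(h.frameEquiv hb hι).symm x, by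
      rw [← h.frameEquiv_apply hb hι, LinearEquiv.apply_symm_apply]⟩
  refine ⟨A, p'.1 - A p.1, ?_, fun x y => ?_, Prod.ext ?_ (Prod.ext ?_ ?_)⟩
  · obtain ⟨r, hr⟩ := hι.exists_eq
    have := hAf (0, 0, r)
    simp only [reducedFrame_apply, map_zero, zero_smul, zero_add, smul_smul, hr, map_smul] at this
    rw [smul_sub, this, sub_self]
  · obtain ⟨X, rfl⟩ := hsurj x
    obtain ⟨Y, rfl⟩ := hsurj y
    rw [hAf, hAf]
    exact (h' _ _).trans (h _ _).symm
  · exact (add_sub_cancel _ _).symm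
  · ext v
    have := hAf (v, 0, 0)
    simp only [reducedFrame_apply, map_zero, zero_smul, smul_zero, add_zero] at this
    exact this.symm
  · have := hAf (0, 1, 0)
    simp only [reducedFrame_apply, map_zero, zero_smul, smul_zero, add_zero, zero_add,
      one_smul] at this
    exact this.symm

lemma IsAdapted.act_injective (h : IsAdapted B κ b p) (hb : ∀ v, v ≠ 0 → 0 < b v v)
    (hι : IsFrameIndex E V κ ι) {A A' : V ≃ₗ[ℝ] V} {a a' : V} (ha : κ • a = 0) (ha' : κ • a' = 0)
    (heq : p.act A a = p.act A' a') : A = A' ∧ a = a' := by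
  have hA : A = A' := by
    ext x
    rw [← (h.frameEquiv hb hι).apply_symm_apply x, h.frameEquiv_apply hb hι,
      ← reducedFrame_act A ha, ← reducedFrame_act A' ha', heq]
  refine ⟨hA, ?_⟩
  have := congrArg Prod.fst heq
  rw [hA] at this
  exact add_left_cancel this

lemma frameDet_comp (p : Jet E V) (L : E →L[ℝ] E) :
    frameDet κ ι Θ (p.comp L) = L.det * frameDet κ ι Θ p := by
  have h1 : LinearMap.det (L.prodMap (ContinuousLinearMap.id ℝ (ℝ × K))).toLinearMap = L.det := by
    have : (L.prodMap (ContinuousLinearMap.id ℝ (ℝ × K))).toLinearMap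
        = L.toLinearMap.prodMap LinearMap.id := rfl
    rw [this, LinearMap.det_prodMap, LinearMap.det_id, mul_one]
  rw [frameDet, frameDet, reducedFrame_comp, ← h1, mul_comm]
  exact LinearMap.det_comp
    (Θ.toContinuousLinearEquiv.toContinuousLinearMap.comp (reducedFrame κ ι p)).toLinearMap
    (L.prodMap (ContinuousLinearMap.id ℝ (ℝ × K))).toLinearMap

lemma continuous_frameDet : Continuous (frameDet κ ι Θ : Jet E V → ℝ) := by
  refine ContinuousLinearMap.continuous_det.comp (continuous_const.clm_comp ?_)
  refine continuous_clm_apply.mpr fun X => ?_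
  exact ((continuous_snd.fst.clm_apply continuous_const).add
    (continuous_snd.snd.const_smul X.2.1)).add
    ((continuous_fst.const_smul (ι X.2.2)).const_smul κ)

lemma IsAdapted.frameDet_ne_zero (h : IsAdapted B κ b p) (hb : ∀ v, v ≠ 0 → 0 < b v v)
    (hι : IsFrameIndex E V κ ι) : frameDet κ ι Θ p ≠ 0 := by
  have := ((h.frameEquiv hb hι).trans Θ).isUnit_det'.ne_zero
  convert this using 1
  refine congrArg LinearMap.det (LinearMap.ext fun X => ?_)
  exact congrArg Θ (h.frameEquiv_apply hb hι X).symm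

/-- The structure equations are invariant under the isometries of the space form. -/
lemma SolvesAt.act {G : E → E →L[ℝ] E →L[ℝ] ℝ} {Γ : E → E →L[ℝ] E →L[ℝ] E} {H N : E → ℝ} {ξ : E → E}
    {u : E → Jet E V} {x : E} (hu : SolvesAt (bonnetSystem V κ G Γ H N ξ) u x) (A : V ≃ₗ[ℝ] V)
    {a : V} (ha : κ • a = 0) :
    SolvesAt (bonnetSystem V κ G Γ H N ξ) (fun y => (u y).act A a) x := by
  have du : HasFDerivAt u _ x := hu
  set L := A.toContinuousLinearEquiv.toContinuousLinearMap with hL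
  have key := ((L.hasFDerivAt.comp x du.fst).add_const a).prodMk
    (((hasFDerivAt_const (𝕜 := ℝ) L x).clm_comp du.snd.fst).prodMk
      (L.hasFDerivAt.comp x du.snd.snd))
  refine HasFDerivAt.congr_fderiv (f := fun y => (u y).act A a) key ?_
  have hLA : ∀ v, L v = A v := fun v => rfl
  refine ContinuousLinearMap.ext fun v => Prod.ext ?_ (Prod.ext ?_ ?_)
  · simp [bonnetSystem, structureMap_apply, Jet.act, hLA]
  · ext w
    have h2 : κ • G x v w • a = 0 := by rw [smul_comm, ha, smul_zero]
    simp [bonnetSystem, structureMap_apply, Jet.act, hLA, h2]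
  · simp [bonnetSystem, structureMap_apply, Jet.act, hLA]

end Frames

/-! ### The equivariant immersion of the universal covering -/

section Covering

open Topology Module

variable {n : ℕ} {M : Type*} [TopologicalSpace M]
  [ChartedSpace (EuclideanSpace ℝ (Fin n)) M] [IsManifold (𝓡 n) ∞ M] {g : SmoothMetric n M}
  {H N : M → ℝ} {ξ : M → EuclideanSpace ℝ (Fin n)} {κ : ℝ}
  {V : Type*} [NormedAddCommGroup V] [NormedSpace ℝ V] [FiniteDimensional ℝ V]
  {K : Type*} [NormedAddCommGroup K] [NormedSpace ℝ K] [FiniteDimensional ℝ K] {ι : K →L[ℝ] ℝ}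
  {B : V →L[ℝ] V →L[ℝ] ℝ}
  {Mt : Type*} [TopologicalSpace Mt] {π : C(Mt, M)}
  {U : Mt → Jet (EuclideanSpace ℝ (Fin n)) V}

lemma SolvesNear.act {u : M → Jet (EuclideanSpace ℝ (Fin n)) V} {x : M}
    (hu : SolvesNear g H N ξ κ u x) (A : V ≃ₗ[ℝ] V) {a : V} (ha : κ • a = 0) :
    SolvesNear g H N ξ κ (fun q => (u q).act A a) x := by
  obtain ⟨e, Γ, h, hx, hs⟩ := hu
  exact ⟨e, Γ, h, hx, hs.mono fun y hy => hy.act A ha⟩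

lemma IsFlatOver.act (hU : IsFlatOver (SolvesNear g H N ξ κ) π U) (A : V ≃ₗ[ℝ] V) {a : V}
    (ha : κ • a = 0) : IsFlatOver (SolvesNear g H N ξ κ) π fun x => (U x).act A a := by
  intro x
  obtain ⟨v, hv, hUv⟩ := hU x
  exact ⟨_, hv.act A ha, hUv.mono fun y hy => congrArg (Jet.act A a) hy⟩

lemma IsFlatOver.comp_homeomorph {X W A : Type*} [TopologicalSpace X] [TopologicalSpace A]
    {P : (X → W) → X → Prop} {f : A → X} {u : A → W} (hu : IsFlatOver P f u) (φ : A ≃ₜ A)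
    (hφ : ∀ x, f (φ x) = f x) : IsFlatOver P f (u ∘ φ) := by
  intro x
  obtain ⟨v, hv, huv⟩ := hu (φ x)
  refine ⟨v, hφ x ▸ hv, ?_⟩
  filter_upwards [φ.continuous.continuousAt.eventually huv] with y hy
  simp only [Function.comp_apply] at hy ⊢
  rw [hy, hφ]

/-- The relations of an isometric immersion hold everywhere if they hold at one point. -/
theorem IsFlatOver.isAdapted [PreconnectedSpace Mt] (hn : 3 ≤ n) (hκ : ∀ p, 0 < H p + κ)
    (hU : IsFlatOver (SolvesNear g H N ξ κ) π U) {x₀ : Mt}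
    (h₀ : IsAdapted B κ (metricAt g (π x₀)) (U x₀)) (x : Mt) :
    IsAdapted B κ (metricAt g (π x)) (U x) := by
  have hloc : IsLocallyConstant fun x => IsAdapted B κ (metricAt g (π x)) (U x) := by
    refine (IsLocallyConstant.iff_eventually_eq _).mpr fun x => ?_
    obtain ⟨v, hv, hUv⟩ := hU x
    have h1 := π.continuous.continuousAt.eventually (hv.eventually_isAdapted_iff hn hκ B)
    filter_upwards [h1, hUv] with y hy hUy
    have hx : U x = v (π x) := hUv.self_of_nhds
    have hy' : U y = v (π y) := hUy
    rw [hx, hy']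
    exact propext hy
  rw [hloc.apply_eq_of_preconnectedSpace x x₀]
  exact h₀

section Differential

variable [ChartedSpace (EuclideanSpace ℝ (Fin n)) Mt]

theorem IsFlatOver.contMDiff_and_differential (hn : 3 ≤ n) (hκ : ∀ p, 0 < H p + κ)
    (hπ : IsLocalDiffeomorph (𝓡 n) (𝓡 n) ∞ π) (hU : IsFlatOver (SolvesNear g H N ξ κ) π U) :
    (ContMDiff (𝓡 n) 𝓘(ℝ, V) ∞ (fun x => (U x).1) ∧
      ∀ (x : Mt) (v : TangentSpace (𝓡 n) x), differential (fun x => (U x).1) x v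
        = (U x).2.1 (mfderiv (𝓡 n) (𝓡 n) π x v)) ∧
    (ContMDiff (𝓡 n) 𝓘(ℝ, V) ∞ (fun x => (U x).2.2) ∧
      ∀ (x : Mt) (v : TangentSpace (𝓡 n) x), differential (fun x => (U x).2.2) x v
        = -(U x).2.1 (shapeAt g H N ξ κ (π x) (mfderiv (𝓡 n) (𝓡 n) π x v))) := by
  have key : ∀ x, ∃ v : M → Jet (EuclideanSpace ℝ (Fin n)) V, U =ᶠ[𝓝 x] v ∘ π ∧ U x = v (π x) ∧
      SolvesNear g H N ξ κ v (π x) := fun x => by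
    obtain ⟨v, hv, hUv⟩ := hU x
    exact ⟨v, hUv, hUv.self_of_nhds, hv⟩
  have hπd : ∀ x, HasMFDerivAt (𝓡 n) (𝓡 n) π x (mfderiv (𝓡 n) (𝓡 n) π x) := fun x =>
    (hπ.contMDiff.mdifferentiableAt (by simp)).hasMFDerivAt
  refine ⟨⟨fun x => ?_, fun x w => ?_⟩, ⟨fun x => ?_, fun x w => ?_⟩⟩ <;>
    obtain ⟨v, hUv, hx, hv⟩ := key x <;> obtain ⟨⟨h1, h2⟩, ⟨h3, h4⟩⟩ := hv.hasMFDerivAt hn hκ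
  · exact (h1.comp x hπ.contMDiff.contMDiffAt).congr_of_eventuallyEq
      (hUv.fun_comp Prod.fst)
  · have h5 := ((h2.comp x (hπd x)).congr_of_eventuallyEq (hUv.fun_comp Prod.fst)).mfderiv
    refine (congrArg (fun L : EuclideanSpace ℝ (Fin n) →L[ℝ] V => L w) h5).trans ?_
    rw [hx]
    rfl
  · exact (h3.comp x hπ.contMDiff.contMDiffAt).congr_of_eventuallyEq
      (hUv.fun_comp fun p => p.2.2)
  · have h5 := ((h4.comp x (hπd x)).congr_of_eventuallyEq
      (hUv.fun_comp fun p => p.2.2)).mfderiv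
    refine (congrArg (fun L : EuclideanSpace ℝ (Fin n) →L[ℝ] V => L w) h5).trans ?_
    rw [hx]
    rfl

end Differential

/-- A covering transformation changes a solution by an isometry of the space form. -/
theorem IsFlatOver.exists_act [PreconnectedSpace Mt] (hn : 3 ≤ n) (hκ : ∀ p, 0 < H p + κ)
    (hQ : ∀ p, ∃ e Γ, p ∈ e.source ∧ IsQCChart g H N ξ e Γ)
    (hι : IsFrameIndex (EuclideanSpace ℝ (Fin n)) V κ ι)
    (hU : IsFlatOver (SolvesNear g H N ξ κ) π U)
    (hB : ∀ x, IsAdapted B κ (metricAt g (π x)) (U x)) (x₀ : Mt) {φ : Mt ≃ₜ Mt}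
    (hφ : ∀ x, π (φ x) = π x) :
    ∃ (A : V ≃ₗ[ℝ] V) (a : V), κ • a = 0 ∧ (∀ x y, B (A x) (A y) = B x y) ∧
      ∀ x, U (φ x) = (U x).act A a := by
  have h0 := hB (φ x₀)
  rw [hφ] at h0
  obtain ⟨A, a, ha, hA, heq⟩ := (hB x₀).exists_act h0 (metricAt_pos g _) hι
  refine ⟨A, a, ha, hA, fun x => ?_⟩
  exact congrFun (IsFlatOver.eq (isFlatSystem_solvesNear hn hκ hQ) π.continuous
    (hU.comp_homeomorph φ hφ) (hU.act A ha) (a₀ := x₀) heq) x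

/-- If `M` is orientable, the isometries that correspond to covering transformations preserve the
orientation: the sign of the determinant of the frame, with respect to the positive charts, is
locally constant. -/
theorem IsFlatOver.det_pos [PreconnectedSpace Mt] (hn : 3 ≤ n) (hκ : ∀ p, 0 < H p + κ)
    (hι : IsFrameIndex (EuclideanSpace ℝ (Fin n)) V κ ι)
    (hU : IsFlatOver (SolvesNear g H N ξ κ) π U)
    (hB : ∀ x, IsAdapted B κ (metricAt g (π x)) (U x)) (x₀ : Mt) (hM : IsOrientable n M)
    {φ : Mt ≃ₜ Mt} (hφ : ∀ x, π (φ x) = π x) {A : V ≃ₗ[ℝ] V} {a : V} (ha : κ • a = 0)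
    (hA : ∀ x, U (φ x) = (U x).act A a) : 0 < LinearMap.det A.toLinearMap := by
  obtain ⟨𝒜, h𝒜, hcov, hor⟩ := hM
  set Θ := ((hB x₀).frameEquiv (metricAt_pos g _) hι).symm with hΘ
  set δ : OpenPartialHomeomorph M (EuclideanSpace ℝ (Fin n)) → Mt → ℝ := fun e x =>
    frameDet κ ι Θ ((U x).comp (chartFrame e (e (π x)))) with hδ
  have hne : ∀ e ∈ 𝒜, ∀ x, π x ∈ e.source → δ e x ≠ 0 := by
    intro e he x hx h0
    have h1 : (((U x).comp (chartFrame e (e (π x)))).comp (chartCoframe e (π x))) = U x :=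
      Jet.comp_eq_self _ (chartFrame_chartCoframe (h𝒜 he) hx)
    refine (hB x).frameDet_ne_zero (Θ := Θ) (metricAt_pos g _) hι ?_
    rw [← h1, frameDet_comp]
    exact mul_eq_zero_of_right _ h0
  have hchange : ∀ e ∈ 𝒜, ∀ e' ∈ 𝒜, ∀ x, π x ∈ e.source → π x ∈ e'.source →
      0 < δ e' x → 0 < δ e x := by
    intro e he e' he' x hx hx' hpos
    have hy : e (π x) ∈ (e.symm.trans e').source :=
      ⟨e.map_source hx, by simpa [e.left_inv hx] using hx'⟩
    have hτ : transition e e' (e (π x)) = e' (π x) := by rw [transition, e.left_inv hx]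
    have h1 : (U x).comp (chartFrame e (e (π x)))
        = ((U x).comp (chartFrame e' (e' (π x)))).comp
          (fderiv ℝ (transition e e') (e (π x))) := by
      refine Prod.ext rfl (Prod.ext ?_ rfl)
      ext w
      have := chartFrame_transition (h𝒜 he) (h𝒜 he') hy w
      rw [hτ] at this
      exact congrArg (U x).2.1 this.symm
    have h2 : δ e x = (fderiv ℝ (transition e e') (e (π x))).det * δ e' x := by
      rw [hδ]
      simp only
      rw [h1, frameDet_comp]
    rw [h2]
    exact mul_pos (hor e he e' he' _ hy) hpos
  have hloc : IsLocallyConstant fun x => ∃ e ∈ 𝒜, π x ∈ e.source ∧ 0 < δ e x := by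
    refine (IsLocallyConstant.iff_eventually_eq _).mpr fun x => ?_
    obtain ⟨e, he, hx⟩ := hcov (π x)
    obtain ⟨v, hv, hUv⟩ := hU x
    have hmem : ∀ᶠ y in 𝓝 x, π y ∈ e.source :=
      π.continuous.continuousAt.eventually (e.open_source.mem_nhds hx)
    have hcont : ContinuousAt (δ e) x := by
      have h1 : ContinuousAt (fun y => frameDet κ ι Θ (chartJet e v (e (π y)))) x :=
        continuous_frameDet.continuousAt.comp (ContinuousAt.comp (f := fun y => e (π y))
          (hv.continuousAt_chartJet hn hκ (h𝒜 he) hx)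
          (ContinuousAt.comp (g := e) (e.continuousAt hx) π.continuous.continuousAt))
      refine h1.congr ?_
      filter_upwards [hUv, hmem] with y hy hye
      rw [chartJet, e.left_inv hye, hδ]
      simp only
      rw [hy]
      rfl
    have hiff : ∀ᶠ y in 𝓝 x, (0 < δ e y ↔ 0 < δ e x) := by
      rcases lt_or_gt_of_ne (hne e he x hx) with h | h
      · filter_upwards [hcont.eventually_lt_const h] with y hy
        exact ⟨fun h' => absurd h' hy.not_gt, fun h' => absurd h' h.not_gt⟩
      · filter_upwards [hcont.eventually_const_lt h] with y hy
        exact ⟨fun _ => h, fun _ => hy⟩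
    have hex : ∀ y, π y ∈ e.source → ((∃ e ∈ 𝒜, π y ∈ e.source ∧ 0 < δ e y) ↔ 0 < δ e y) :=
      fun y hy => ⟨fun ⟨e', he', hy', hpos⟩ => hchange e he e' he' y hy hy' hpos,
        fun h => ⟨e, he, hy, h⟩⟩
    filter_upwards [hmem, hiff] with y hy hyiff
    exact propext ((hex y hy).trans (hyiff.trans (hex x hx).symm))
  obtain ⟨e, he, hx⟩ := hcov (π x₀)
  have hx' : π (φ x₀) ∈ e.source := by rwa [hφ]
  have heq := hloc.apply_eq_of_preconnectedSpace (φ x₀) x₀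
  have hδA : δ e (φ x₀) = LinearMap.det A.toLinearMap * δ e x₀ := by
    rw [hδ]
    simp only
    rw [← frameDet_act A ha, hφ, hA]
    rfl
  have hiff : 0 < δ e (φ x₀) ↔ 0 < δ e x₀ := by
    constructor
    · intro h
      obtain ⟨e', he', hy', hpos⟩ := heq.mp ⟨e, he, hx', h⟩
      exact hchange e he e' he' x₀ hx hy' hpos
    · intro h
      obtain ⟨e', he', hy', hpos⟩ := heq.mpr ⟨e, he, hx, h⟩
      exact hchange e he e' he' _ hx' hy' hpos
  have hn1 := hne e he x₀ hx
  have hn2 := hne e he _ hx'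
  rw [hδA] at hiff hn2
  rcases lt_or_gt_of_ne hn1 with h | h
  · by_contra hd
    have hd' := lt_of_le_of_ne (not_lt.mp hd) (left_ne_zero_of_mul hn2)
    exact absurd (hiff.mp (mul_pos_of_neg_of_neg hd' h)) h.not_gt
  · exact (mul_pos_iff_of_pos_right h).mp (hiff.mpr h)

end Covering

section Covering

open Topology Module

lemma Jet.act_act {E V : Type*} [NormedAddCommGroup E] [NormedSpace ℝ E] [NormedAddCommGroup V]
    [NormedSpace ℝ V] [FiniteDimensional ℝ V] (p : Jet E V) (A A' : V ≃ₗ[ℝ] V) (a a' : V) :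
    (p.act A a).act A' a' = p.act (A' * A) (A' a + a') := by
  refine Prod.ext ?_ rfl
  change A' (A p.1 + a) + a' = A' (A p.1) + (A' a + a')
  rw [map_add, add_assoc]

lemma exists_monoidHom_of_unique {G G' : Type*} [Group G] [Group G'] (R : G → G' → Prop)
    (hex : ∀ γ, ∃ k, R γ k) (huniq : ∀ γ k k', R γ k → R γ k' → k = k')
    (hmul : ∀ γ δ k l, R γ k → R δ l → R (γ * δ) (k * l)) : ∃ ρ : G →* G', ∀ γ, R γ (ρ γ) := by
  choose ρ hρ using hex
  exact ⟨MonoidHom.mk' ρ fun γ δ => huniq _ _ _ (hρ _) (hmul _ _ _ _ (hρ γ) (hρ δ)), hρ⟩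

variable {n : ℕ} {M : Type*} [TopologicalSpace M]
  [ChartedSpace (EuclideanSpace ℝ (Fin n)) M] [IsManifold (𝓡 n) ∞ M] {g : SmoothMetric n M}
  {H N : M → ℝ} {ξ : M → EuclideanSpace ℝ (Fin n)} {κ : ℝ}
  {V : Type*} [NormedAddCommGroup V] [NormedSpace ℝ V] [FiniteDimensional ℝ V]
  {K : Type*} [NormedAddCommGroup K] [NormedSpace ℝ K] [FiniteDimensional ℝ K] {ι : K →L[ℝ] ℝ}
  {B : V →L[ℝ] V →L[ℝ] ℝ}
  {Mt : Type*} [TopologicalSpace Mt] {π : C(Mt, M)}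
  {U : Mt → Jet (EuclideanSpace ℝ (Fin n)) V}

/-- If each covering transformation changes the jets `U` by an element of the group `G` of
isometries, where `k ∈ G` has linear part `lin k` and translation part `tr k`, then this defines a
homomorphism of the fundamental group. -/
theorem exists_monoidHom_of_act [SimplyConnectedSpace Mt] [LocallyPathConnectedSpace Mt]
    (hπ : IsCoveringMap π) {x₀ : Mt} (hι : IsFrameIndex (EuclideanSpace ℝ (Fin n)) V κ ι)
    (hB : IsAdapted B κ (metricAt g (π x₀)) (U x₀)) {G : Type*} [Group G]
    (lin : G →* (V ≃ₗ[ℝ] V)) (tr : G → V) (htr : ∀ k, κ • tr k = 0)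
    (hmul : ∀ k l, tr (k * l) = lin k (tr l) + tr k)
    (hinj : ∀ k l, lin k = lin l → tr k = tr l → k = l)
    (hex : ∀ φ : Mt ≃ₜ Mt, (∀ x, π (φ x) = π x) →
      ∃ k, ∀ x, U (φ x) = (U x).act (lin k) (tr k)) :
    ∃ ρ : FundamentalGroup M (π x₀) →* G, ∀ γ, ∃ φ : Mt ≃ₜ Mt, IsDeckTransformationOf π x₀ γ φ ∧
      ∀ x, U (φ x) = (U x).act (lin (ρ γ)) (tr (ρ γ)) := by
  refine exists_monoidHom_of_unique (fun γ k => ∃ φ : Mt ≃ₜ Mt, IsDeckTransformationOf π x₀ γ φ ∧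
      ∀ x, U (φ x) = (U x).act (lin k) (tr k)) (fun γ => ?_) ?_ ?_
  · obtain ⟨φ, hφ⟩ := exists_isDeckTransformationOf hπ γ
    obtain ⟨k, hk⟩ := hex φ hφ.1
    exact ⟨k, φ, hφ, hk⟩
  · rintro γ k k' ⟨φ, hφ, hk⟩ ⟨φ', hφ', hk'⟩
    have h1 := hk' x₀
    rw [hφ'.eq hπ hφ, hk] at h1
    obtain ⟨h2, h3⟩ := hB.act_injective (metricAt_pos g _) hι (htr _) (htr _) h1
    exact hinj _ _ h2 h3
  · rintro γ δ k l ⟨φ, hφ, hk⟩ ⟨ψ, hψ, hl⟩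
    refine ⟨ψ.trans φ, hφ.mul hψ, fun x => ?_⟩
    rw [Homeomorph.trans_apply, hk, hl, Jet.act_act, map_mul, hmul]

/-- The second fundamental form of an adapted solution. -/
theorem IsQCField.hasOneQCForm [ChartedSpace (EuclideanSpace ℝ (Fin n)) Mt]
    (h : IsQCField g H N ξ) (hn : 3 ≤ n)
    {s : ∀ x : Mt, TangentSpace (𝓡 n) x → TangentSpace (𝓡 n) x → ℝ}
    (hs : ∀ (x : Mt) (v w : TangentSpace (𝓡 n) x), s x v w
      = secondForm (metricAt g (π x)) (H (π x)) (N (π x)) κ (ξ (π x))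
        (mfderiv (𝓡 n) (𝓡 n) π x v) (mfderiv (𝓡 n) (𝓡 n) π x w)) :
    HasOneQCForm g π H N κ s := by
  refine fun x v w => ⟨fun hx => ?_, fun hx η hη => ?_⟩
  · refine ((hs x v w).trans (secondForm_apply _ _ _ _ _ _ _)).trans ?_
    rw [(h.isIsotropic_iff hn).mp hx, sub_self, zero_div, zero_mul, add_zero]
    rfl
  · refine ((hs x v w).trans (secondForm_apply _ _ _ _ _ _ _)).trans ?_
    have := h.eq_of_isDistinguished hn hx hη (mfderiv (𝓡 n) (𝓡 n) π x v)
      (mfderiv (𝓡 n) (𝓡 n) π x w)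
    rw [← this]
    rfl

/-- The conclusions about the immersion and its unit normal field that hold in all space forms. -/
theorem IsFlatOver.isIsometricImmersion [PreconnectedSpace Mt]
    [ChartedSpace (EuclideanSpace ℝ (Fin n)) Mt] (hn : 3 ≤ n) (hκ : ∀ p, 0 < H p + κ)
    (hπ : IsLocalDiffeomorph (𝓡 n) (𝓡 n) ∞ π) (h : IsQCField g H N ξ)
    (hU : IsFlatOver (SolvesNear g H N ξ κ) π U)
    (hB : ∀ x, IsAdapted B κ (metricAt g (π x)) (U x)) :
    IsIsometricImmersion g π (fun x y => B x y) (fun x => (U x).1) ∧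
    IsUnitNormal n (fun x y => B x y) (fun x => (U x).1) (fun x => (U x).2.2) ∧
    HasOneQCForm g π H N κ (secondFundamentalForm (fun x y => B x y) (fun x => (U x).1)
      (fun x => (U x).2.2)) := by
  obtain ⟨⟨hf, hdf⟩, ⟨hν, hdν⟩⟩ := hU.contMDiff_and_differential hn hκ hπ
  have hΦ : ∀ x v w, B ((U x).2.1 v) ((U x).2.1 w) = metricAt g (π x) v w := fun x v w => by
    simpa [frameMap_apply, modelForm] using hB x (v, 0, 0) (w, 0, 0)
  have hνν : ∀ x, B (U x).2.2 (U x).2.2 = 1 := fun x => by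
    simpa [frameMap_apply, modelForm] using hB x (0, 1, 0) (0, 1, 0)
  have hνΦ : ∀ x v, B (U x).2.2 ((U x).2.1 v) = 0 := fun x v => by
    simpa [frameMap_apply, modelForm] using hB x (0, 1, 0) (v, 0, 0)
  refine ⟨⟨hf, fun x v w => ?_⟩, ⟨hν, hνν, fun x v => ?_⟩, h.hasOneQCForm hn fun x v w => ?_⟩
  · change B _ _ = _
    rw [hdf, hdf]
    exact hΦ _ _ _
  · change B _ _ = _
    rw [hdf]
    exact hνΦ _ _
  · change -B _ _ = _
    rw [hdf, hdν, map_neg, neg_apply, neg_neg]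
    exact (hΦ _ _ _).trans (apply_shapeOperator _ _ _ _ _ _ _)

end Covering

/-! ### Initial values and determinants -/

section LinearAlgebra

open Module

variable {E V : Type*} [NormedAddCommGroup E] [NormedSpace ℝ E] [FiniteDimensional ℝ E]

lemma exists_orthonormal_family {b : E →L[ℝ] E →L[ℝ] ℝ} (hb : ∀ v, v ≠ 0 → 0 < b v v)
    (hsymm : ∀ u v, b u v = b v u) {k : ℕ} (hk : k ≤ finrank ℝ E) :
    ∃ w : Fin k → E, ∀ i j, b (w i) (w j) = if i = j then 1 else 0 := by
  induction k with
  | zero => exact ⟨Fin.elim0, fun i => i.elim0⟩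
  | succ k ih =>
    obtain ⟨w, hw⟩ := ih (by omega)
    obtain ⟨u, hu, hwu⟩ := exists_unit_orthogonal hb (by omega) w
    refine ⟨Fin.snoc w u, fun i j => ?_⟩
    refine Fin.lastCases ?_ (fun i => ?_) i <;> refine Fin.lastCases ?_ (fun j => ?_) j
    · simpa using hu
    · simpa [hsymm u, (Fin.castSucc_lt_last j).ne'] using hwu j
    · simpa using hwu i
    · simpa using hw i j

/-- A positive definite form is isometric to the Euclidean inner product. -/
lemma exists_equiv_inner {n : ℕ} {b : E →L[ℝ] E →L[ℝ] ℝ} (hn : finrank ℝ E = n)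
    (hb : ∀ v, v ≠ 0 → 0 < b v v) (hsymm : ∀ u v, b u v = b v u) :
    ∃ L : E →L[ℝ] EuclideanSpace ℝ (Fin n), ∀ u v, inner ℝ (L u) (L v) = b u v := by
  obtain ⟨w, hw⟩ := exists_orthonormal_family hb hsymm hn.ge
  set T : EuclideanSpace ℝ (Fin n) →ₗ[ℝ] E :=
    ∑ i, (EuclideanSpace.proj i : EuclideanSpace ℝ (Fin n) →L[ℝ] ℝ).toLinearMap.smulRight (w i)
    with hT
  have hTb : ∀ c d, b (T c) (T d) = inner ℝ c d := fun c d => by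
    simp [hT, hw, PiLp.inner_apply, mul_comm]
  have hinj : Function.Injective T := by
    refine (injective_iff_map_eq_zero _).mpr fun c hc => ?_
    have := hTb c c
    rw [hc, map_zero] at this
    exact inner_self_eq_zero.mp this.symm
  set e := T.linearEquivOfInjective hinj (by simp [hn]) with he
  refine ⟨e.symm.toLinearMap.toContinuousLinearMap, fun u v => ?_⟩
  have key : ∀ u, T (e.symm u) = u := fun u => by
    rw [← T.linearEquivOfInjective_apply hinj (by simp [hn]), ← he, LinearEquiv.apply_symm_apply]
  rw [← hTb]
  exact congrArg₂ (fun x y => b x y) (key u) (key v)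

/-- A linear map that preserves a nondegenerate bilinear form and the orientation has
determinant one. -/
lemma det_eq_one_of_isometry [NormedAddCommGroup V] [NormedSpace ℝ V] [FiniteDimensional ℝ V]
    {B : V →L[ℝ] V →L[ℝ] ℝ} (hB : ∀ x, (∀ y, B x y = 0) → x = 0)
    {A : V ≃ₗ[ℝ] V} (hA : ∀ x y, B (A x) (A y) = B x y) (hpos : 0 < LinearMap.det A.toLinearMap) :
    LinearMap.det A.toLinearMap = 1 := by
  set β₀ : V →ₗ[ℝ] Dual ℝ V := LinearMap.mk₂ ℝ (fun x y => B x y) (by simp) (by simp) (by simp)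
    (by simp) with hβ₀
  have hinj : Function.Injective β₀ := (injective_iff_map_eq_zero _).mpr fun x hx =>
    hB x fun y => LinearMap.congr_fun hx y
  set β := β₀.linearEquivOfInjective hinj (Subspace.dual_finrank_eq).symm with hβ
  have h1 : LinearMap.comp (β.symm.toLinearMap ∘ₗ A.toLinearMap.dualMap ∘ₗ β.toLinearMap)
      A.toLinearMap = LinearMap.id := by
    refine LinearMap.ext fun x => ?_
    change β.symm (A.toLinearMap.dualMap (β (A x))) = x
    rw [LinearEquiv.symm_apply_eq]
    refine LinearMap.ext fun y => ?_
    rw [LinearMap.dualMap_apply, hβ, LinearMap.linearEquivOfInjective_apply,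
      LinearMap.linearEquivOfInjective_apply]
    exact hA x y
  have h2 : LinearMap.det (β.symm.toLinearMap ∘ₗ A.toLinearMap.dualMap ∘ₗ β.toLinearMap)
      = LinearMap.det A.toLinearMap := by
    have := LinearMap.det_conj A.toLinearMap.dualMap β.symm
    rw [LinearEquiv.symm_symm, LinearMap.det_dualMap] at this
    exact this
  have h3 := congrArg LinearMap.det h1
  rw [LinearMap.det_comp, h2, LinearMap.det_id] at h3
  nlinarith

end LinearAlgebra

/-! ### Adapted jets in Euclidean and in Minkowski space -/

section Models

open Module

variable {E : Type*} [NormedAddCommGroup E] [NormedSpace ℝ E] [FiniteDimensional ℝ E] {n : ℕ}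

/-- The inclusion of `ℝⁿ` in `ℝⁿ⁺¹` as the hyperplane orthogonal to the last coordinate vector. -/
lemma exists_hyperplane (n : ℕ) :
    ∃ (j : EuclideanSpace ℝ (Fin n) →L[ℝ] EuclideanSpace ℝ (Fin (n + 1)))
    (ν : EuclideanSpace ℝ (Fin (n + 1))), (∀ u v, inner ℝ (j u) (j v) = (inner ℝ u v : ℝ)) ∧
      inner ℝ ν ν = (1 : ℝ) ∧ ∀ u, inner ℝ (j u) ν = (0 : ℝ) := by
  set j : EuclideanSpace ℝ (Fin n) →ₗ[ℝ] EuclideanSpace ℝ (Fin (n + 1)) :=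
    { toFun := fun u => WithLp.toLp 2 (Fin.snoc (fun i => u i) 0)
      map_add' := fun u v => by
        ext i
        refine Fin.lastCases ?_ (fun i => ?_) i <;> simp
      map_smul' := fun c u => by
        ext i
        refine Fin.lastCases ?_ (fun i => ?_) i <;> simp } with hj
  refine ⟨j.toContinuousLinearMap, EuclideanSpace.single (Fin.last n) 1, fun u v => ?_, by simp,
    fun u => ?_⟩
  · simp [hj, PiLp.inner_apply, Fin.sum_univ_castSucc]
  · simp [hj, PiLp.inner_apply]

lemma exists_isAdapted_euclidean {b : E →L[ℝ] E →L[ℝ] ℝ} (hn : finrank ℝ E = n)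
    (hb : ∀ v, v ≠ 0 → 0 < b v v) (hsymm : ∀ u v, b u v = b v u) :
    ∃ p : Jet E (EuclideanSpace ℝ (Fin (n + 1))), IsAdapted (innerSL ℝ) 0 b p := by
  obtain ⟨L, hL⟩ := exists_equiv_inner hn hb hsymm
  obtain ⟨j, ν, hj, hν, hjν⟩ := exists_hyperplane n
  refine ⟨(0, j.comp L, ν), fun X Y => ?_⟩
  have hνj : ∀ u, inner ℝ ν (j u) = (0 : ℝ) := fun u => by rw [real_inner_comm, hjν]
  rw [innerSL_apply_apply]
  simp [frameMap_apply, modelForm, inner_add_left, inner_add_right, inner_smul_left,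
    inner_smul_right, hj, hjν, hνj, hL, hν, -inner_self_eq_norm_sq_to_K, mul_comm]

/-- The Lorentzian inner product as a continuous bilinear map. -/
def lorentzForm (m : ℕ) : Minkowski m →L[ℝ] Minkowski m →L[ℝ] ℝ :=
  toBilin <| LinearMap.mk₂ ℝ lorentz
    (fun x x' y => by simp [lorentz, inner_add_left]; ring)
    (fun c x y => by simp [lorentz, inner_smul_left]; ring)
    (fun x y y' => by simp [lorentz, inner_add_right]; ring)
    (fun c x y => by simp [lorentz, inner_smul_right]; ring)

lemma lorentzForm_apply {m : ℕ} (x y : Minkowski m) : lorentzForm m x y = lorentz x y := rfl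

lemma lorentzForm_nondegenerate {m : ℕ} (x : Minkowski m) (h : ∀ y, lorentzForm m x y = 0) :
    x = 0 := by
  have h1 : lorentz x (x.1, -x.2) = 0 := h _
  have h2 : inner ℝ x.1 x.1 + x.2 * x.2 = 0 := by
    rw [← h1, lorentz]
    ring
  have h3 : (0 : ℝ) ≤ inner ℝ x.1 x.1 := real_inner_self_nonneg
  have h4 := mul_self_nonneg x.2
  exact Prod.ext (inner_self_eq_zero.mp (by linarith : inner ℝ x.1 x.1 = (0 : ℝ)))
    (mul_self_eq_zero.mp (by linarith))

/-- The initial jet lies over the point `(0, 1 / √κ)` of the hyperboloid. -/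
lemma exists_isAdapted_lorentz {b : E →L[ℝ] E →L[ℝ] ℝ} (hn : finrank ℝ E = n)
    (hb : ∀ v, v ≠ 0 → 0 < b v v) (hsymm : ∀ u v, b u v = b v u) {κ : ℝ} (hκ : 0 < κ) :
    ∃ p : Jet E (Minkowski (n + 1)), IsAdapted (lorentzForm (n + 1)) κ b p ∧ 0 < p.1.2 := by
  obtain ⟨L, hL⟩ := exists_equiv_inner hn hb hsymm
  obtain ⟨j, ν, hj, hν, hjν⟩ := exists_hyperplane n
  have hs : √κ ≠ 0 := (Real.sqrt_pos.mpr hκ).ne'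
  have hs2 : κ * (√κ)⁻¹ = √κ := by
    rw [← div_eq_mul_inv, div_eq_iff hs, Real.mul_self_sqrt hκ.le]
  refine ⟨((0, (√κ)⁻¹), (ContinuousLinearMap.inl ℝ _ ℝ).comp (j.comp L), (ν, 0)),
    fun X Y => ?_, by positivity⟩
  have hνj : ∀ u, inner ℝ ν (j u) = (0 : ℝ) := fun u => by rw [real_inner_comm, hjν]
  have h1 : κ * (X.2.2 * (√κ)⁻¹) * (κ * (Y.2.2 * (√κ)⁻¹)) = κ * (X.2.2 * Y.2.2) := by
    calc _ = (κ * (√κ)⁻¹) * (κ * (√κ)⁻¹) * (X.2.2 * Y.2.2) := by ring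
      _ = _ := by rw [hs2, Real.mul_self_sqrt hκ.le]
  simp [frameMap_apply, modelForm, lorentzForm_apply, lorentz, inner_add_left, inner_add_right,
    inner_smul_left, inner_smul_right, hj, hjν, hνj, hL, hν, -inner_self_eq_norm_sq_to_K,
    h1, mul_comm]

/-- The reversed Cauchy-Schwarz inequality, in its qualitative form. -/
lemma lorentz_neg_of_timelike {m : ℕ} {x y : Minkowski m} (hx : lorentz x x < 0)
    (hy : lorentz y y < 0) (hx0 : 0 < x.2) (hy0 : 0 < y.2) : lorentz x y < 0 := by
  have key : ∀ {z : Minkowski m}, lorentz z z < 0 → 0 < z.2 → ‖z.1‖ < z.2 := by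
    intro z hz hz0
    rw [lorentz, real_inner_self_eq_norm_sq] at hz
    exact lt_of_pow_lt_pow_left₀ 2 hz0.le (by linarith [sq z.2])
  have h1 := real_inner_le_norm x.1 y.1
  have h2 : ‖x.1‖ * ‖y.1‖ < x.2 * y.2 :=
    mul_lt_mul'' (key hx hx0) (key hy hy0) (norm_nonneg _) (norm_nonneg _)
  rw [lorentz]
  linarith

lemma snd_ne_zero_of_timelike {m : ℕ} {x : Minkowski m} (hx : lorentz x x < 0) : x.2 ≠ 0 := by
  intro h
  rw [lorentz, h, mul_zero, sub_zero] at hx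
  exact absurd hx (not_lt.mpr real_inner_self_nonneg)

/-- A linear isometry of Minkowski space that maps one future vector to a future vector preserves
the future cone. -/
lemma mem_lorentzGroup_of_future {m : ℕ} {A : Minkowski m ≃ₗ[ℝ] Minkowski m}
    (hA : ∀ x y, lorentz (A x) (A y) = lorentz x y) {x : Minkowski m} (hx : lorentz x x < 0)
    (hx0 : 0 < x.2) (hAx : 0 < (A x).2) : A ∈ lorentzGroup m := by
  refine ⟨hA, fun y hy hy0 => ?_⟩
  have h1 : lorentz (A x) (A y) < 0 := by
    rw [hA]
    exact lorentz_neg_of_timelike hx hy hx0 hy0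
  have hAx' : lorentz (A x) (A x) < 0 := by rwa [hA]
  have hAy : lorentz (A y) (A y) < 0 := by rwa [hA]
  by_contra hneg
  have h2 : 0 < (-(A y)).2 :=
    neg_pos.mpr (lt_of_le_of_ne (not_lt.mp hneg) (snd_ne_zero_of_timelike hAy))
  have h3 : lorentz (-(A y)) (-(A y)) < 0 := by
    simpa [lorentz] using hAy
  have h4 := lorentz_neg_of_timelike hAx' h3 hAx h2
  rw [← lorentzForm_apply, map_neg, lorentzForm_apply] at h4
  linarith

end Models

/-! ### Immersions in hyperbolic and in Euclidean space -/

section Immersion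

open Topology Module

variable {n : ℕ} {M : Type*} [TopologicalSpace M]
  [ChartedSpace (EuclideanSpace ℝ (Fin n)) M] [IsManifold (𝓡 n) ∞ M] {g : SmoothMetric n M}
  {H N : M → ℝ} {ξ : M → EuclideanSpace ℝ (Fin n)} {κ : ℝ}
  {Mt : Type*} [TopologicalSpace Mt] [SimplyConnectedSpace Mt]
  [ChartedSpace (EuclideanSpace ℝ (Fin n)) Mt] {π : C(Mt, M)}

lemma isFrameIndex_lorentz (hκ : 0 < κ) : IsFrameIndex (EuclideanSpace ℝ (Fin n))
    (Minkowski (n + 1)) κ (ContinuousLinearMap.id ℝ ℝ) where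
  eq_zero r hr := (mul_eq_zero.mp hr).resolve_left hκ.ne'
  exists_eq := ⟨1, mul_one κ⟩
  finrank_eq := by simp

lemma isFrameIndex_euclidean : IsFrameIndex (EuclideanSpace ℝ (Fin n))
    (EuclideanSpace ℝ (Fin (n + 1))) 0 (0 : EuclideanSpace ℝ (Fin 0) →L[ℝ] ℝ) where
  eq_zero r _ := Subsingleton.elim _ _
  exists_eq := ⟨0, by simp⟩
  finrank_eq := by simp

/-- The case `κ > 0`. The solution of the structure equations stays on the hyperboloid because the
Gram matrix is conserved, and on its upper sheet because it is connected. -/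
theorem exists_hyperbolic_immersion (hn : 3 ≤ n) (hH : ∀ p, 0 < H p + κ) (hκ : 0 < κ)
    (h : IsQCField g H N ξ) (hQ : ∀ p, ∃ e Γ, p ∈ e.source ∧ IsQCChart g H N ξ e Γ)
    (hπ : IsCoveringMap π) (hπ' : IsLocalDiffeomorph (𝓡 n) (𝓡 n) ∞ π) (x₀ : Mt) :
    ∃ (f ν : Mt → Minkowski (n + 1)) (ρ : FundamentalGroup M (π x₀) →* lorentzGroup (n + 1)),
      (∀ x, f x ∈ hyperbolicSpace κ (n + 1)) ∧
      IsIsometricImmersion g π lorentz f ∧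
      (∀ γ, ∃ φ : Mt ≃ₜ Mt, IsDeckTransformationOf π x₀ γ φ ∧
        ∀ x, f (φ x) = (ρ γ : Minkowski (n + 1) ≃ₗ[ℝ] Minkowski (n + 1)) (f x)) ∧
      (IsOrientable n M → ∀ γ,
        LinearMap.det ((ρ γ : Minkowski (n + 1) ≃ₗ[ℝ] Minkowski (n + 1)) :
          Minkowski (n + 1) →ₗ[ℝ] Minkowski (n + 1)) = 1) ∧
      IsUnitNormal n lorentz f ν ∧ (∀ x, lorentz (ν x) (f x) = 0) ∧
      HasOneQCForm g π H N κ (secondFundamentalForm lorentz f ν) := by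
  have : LocallyPathConnectedSpace Mt :=
    ChartedSpace.locallyPathConnectedSpace (EuclideanSpace ℝ (Fin n)) Mt
  have hι := isFrameIndex_lorentz (n := n) hκ
  obtain ⟨w₀, hw₀, hw₀'⟩ := exists_isAdapted_lorentz (n := n) finrank_euclideanSpace_fin
    (metricAt_pos g (π x₀)) (metricAt_symm g (π x₀)) hκ
  obtain ⟨U, hU0, hU⟩ := exists_isFlatOver
    (isFlatSystem_solvesNear (V := Minkowski (n + 1)) hn hH hQ) π x₀ w₀
  have hB := fun x => hU.isAdapted (B := lorentzForm (n + 1)) hn hH (x₀ := x₀) (by rwa [hU0]) x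
  obtain ⟨him, hun, hsf⟩ := hU.isIsometricImmersion hn hH hπ' h hB
  have hFF : ∀ x, lorentz (U x).1 (U x).1 = -1 / κ := fun x => by
    have h1 := hB x (0, 0, 1) (0, 0, 1)
    simp [frameMap_apply, modelForm, lorentzForm_apply] at h1
    rw [eq_div_iff hκ.ne']
    refine mul_left_cancel₀ hκ.ne' ?_
    linarith
  have hνF : ∀ x, lorentz (U x).2.2 (U x).1 = 0 := fun x => by
    have h1 := hB x (0, 1, 0) (0, 0, 1)
    simpa [frameMap_apply, modelForm, lorentzForm_apply, hκ.ne'] using h1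
  have htime : ∀ x, lorentz (U x).1 (U x).1 < 0 := fun x => by
    rw [hFF]
    exact div_neg_of_neg_of_pos (by norm_num) hκ
  have hfut : ∀ x, 0 < (U x).1.2 := fun x => by
    by_contra hneg
    have hc : Continuous fun x => (U x).1.2 := him.1.continuous.snd
    obtain ⟨y, hy⟩ := mem_range_of_exists_le_of_exists_ge hc ⟨x, not_lt.mp hneg⟩
      ⟨x₀, by rw [hU0]; exact hw₀'.le⟩
    exact snd_ne_zero_of_timelike (htime y) hy
  obtain ⟨ρ, hρ⟩ := exists_monoidHom_of_act (U := U) hπ hι (hB x₀)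
    (lorentzGroup (n + 1)).subtype (fun _ => 0) (fun _ => smul_zero κ) (fun _ _ => by simp)
    (fun k l hkl _ => Subtype.ext hkl) fun φ hφ => by
      obtain ⟨A, a, ha, hA, hUA⟩ := hU.exists_act hn hH hQ hι hB x₀ hφ
      have ha0 : a = 0 := (smul_eq_zero.mp ha).resolve_left hκ.ne'
      subst ha0
      have hAF : A (U x₀).1 = (U (φ x₀)).1 := by
        rw [hUA]
        exact (add_zero _).symm
      exact ⟨⟨A, mem_lorentzGroup_of_future hA (htime x₀) (hfut x₀) (hAF ▸ hfut _)⟩, hUA⟩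
  refine ⟨fun x => (U x).1, fun x => (U x).2.2, ρ, fun x => ⟨hFF x, hfut x⟩, him, fun γ => ?_,
    fun hM γ => ?_, hun, hνF, hsf⟩
  · obtain ⟨φ, hφ, hUφ⟩ := hρ γ
    exact ⟨φ, hφ, fun x => by
      change (U (φ x)).1 = _
      rw [hUφ]
      exact add_zero _⟩
  · obtain ⟨φ, hφ, hUφ⟩ := hρ γ
    exact det_eq_one_of_isometry lorentzForm_nondegenerate (ρ γ).2.1
      (hU.det_pos hn hH hι hB x₀ hM hφ.1 (smul_zero κ) hUφ)

/-- The linear part of an affine isometry of Euclidean space. -/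
def linearPart (m : ℕ) : (EuclideanSpace ℝ (Fin m) ≃ᵃⁱ[ℝ] EuclideanSpace ℝ (Fin m)) →*
    (EuclideanSpace ℝ (Fin m) ≃ₗ[ℝ] EuclideanSpace ℝ (Fin m)) where
  toFun T := T.linearIsometryEquiv.toLinearEquiv
  map_one' := rfl
  map_mul' _ _ := rfl

lemma linearPart_apply {m : ℕ} (T : EuclideanSpace ℝ (Fin m) ≃ᵃⁱ[ℝ] EuclideanSpace ℝ (Fin m))
    (x : EuclideanSpace ℝ (Fin m)) : linearPart m T x + T 0 = T x := by
  have := T.map_vadd 0 x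
  simp only [vadd_eq_add, add_zero] at this
  exact this.symm

/-- The case `κ = 0`. The position does not enter the structure equations for the tangential and
the normal part of the jet, so that the covering transformations act by affine isometries. -/
theorem exists_euclidean_immersion (hn : 3 ≤ n) (hH : ∀ p, 0 < H p)
    (h : IsQCField g H N ξ) (hQ : ∀ p, ∃ e Γ, p ∈ e.source ∧ IsQCChart g H N ξ e Γ)
    (hπ : IsCoveringMap π) (hπ' : IsLocalDiffeomorph (𝓡 n) (𝓡 n) ∞ π) (x₀ : Mt) :
    ∃ (f ν : Mt → EuclideanSpace ℝ (Fin (n + 1)))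
      (ρ : FundamentalGroup M (π x₀) →*
        (EuclideanSpace ℝ (Fin (n + 1)) ≃ᵃⁱ[ℝ] EuclideanSpace ℝ (Fin (n + 1)))),
      IsIsometricImmersion g π euclid f ∧
      (∀ γ, ∃ φ : Mt ≃ₜ Mt, IsDeckTransformationOf π x₀ γ φ ∧
        ∀ x, f (φ x) = ρ γ (f x)) ∧
      (IsOrientable n M → ∀ γ,
        LinearMap.det (((ρ γ).linearIsometryEquiv.toLinearEquiv :
          EuclideanSpace ℝ (Fin (n + 1)) ≃ₗ[ℝ] EuclideanSpace ℝ (Fin (n + 1))) :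
          EuclideanSpace ℝ (Fin (n + 1)) →ₗ[ℝ] EuclideanSpace ℝ (Fin (n + 1))) = 1) ∧
      IsUnitNormal n euclid f ν ∧
      HasOneQCForm g π H N 0 (secondFundamentalForm euclid f ν) := by
  have : LocallyPathConnectedSpace Mt :=
    ChartedSpace.locallyPathConnectedSpace (EuclideanSpace ℝ (Fin n)) Mt
  have hH' : ∀ p, 0 < H p + 0 := fun p => by rw [add_zero]; exact hH p
  have hι := isFrameIndex_euclidean (n := n)
  obtain ⟨w₀, hw₀⟩ := exists_isAdapted_euclidean (n := n) finrank_euclideanSpace_fin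
    (metricAt_pos g (π x₀)) (metricAt_symm g (π x₀))
  obtain ⟨U, hU0, hU⟩ := exists_isFlatOver
    (isFlatSystem_solvesNear (V := EuclideanSpace ℝ (Fin (n + 1))) hn hH' hQ) π x₀ w₀
  have hB := fun x => hU.isAdapted (B := innerSL ℝ) hn hH' (x₀ := x₀) (by rwa [hU0]) x
  obtain ⟨him, hun, hsf⟩ := hU.isIsometricImmersion hn hH' hπ' h hB
  obtain ⟨ρ, hρ⟩ := exists_monoidHom_of_act (U := U) hπ hι (hB x₀)
    (linearPart (n + 1)) (fun T => T 0) (fun _ => zero_smul ℝ _)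
    (fun k l => (linearPart_apply k (l 0)).symm)
    (fun k l hkl h0 => AffineIsometryEquiv.ext fun x => by
      rw [← linearPart_apply k x, ← linearPart_apply l x, hkl,
        show k 0 = l 0 from h0]) fun φ hφ => by
      obtain ⟨A, a, -, hA, hUA⟩ := hU.exists_act hn hH' hQ hι hB x₀ hφ
      have hnorm : ∀ x, ‖A x‖ = ‖x‖ := fun x => by
        have : inner ℝ (A x) (A x) = (inner ℝ x x : ℝ) := hA x x
        rw [real_inner_self_eq_norm_sq, real_inner_self_eq_norm_sq] at this
        exact (pow_left_inj₀ (norm_nonneg _) (norm_nonneg _) two_ne_zero).mp this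
      set T := (LinearIsometryEquiv.mk A hnorm).toAffineIsometryEquiv.trans
        (AffineIsometryEquiv.constVAdd ℝ (EuclideanSpace ℝ (Fin (n + 1))) a) with hT
      have hT0 : T 0 = a := by simp [hT]
      have hTA : linearPart (n + 1) T = A := by
        ext1 x
        have h1 := linearPart_apply T x
        have h2 : T x = A x + a := by
          simp [hT, add_comm]
        rw [hT0, h2] at h1
        exact add_right_cancel h1
      exact ⟨T, by rw [hTA, hT0]; exact hUA⟩
  refine ⟨fun x => (U x).1, fun x => (U x).2.2, ρ, him, fun γ => ?_, fun hM γ => ?_, hun, hsf⟩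
  · obtain ⟨φ, hφ, hUφ⟩ := hρ γ
    exact ⟨φ, hφ, fun x => by
      change (U (φ x)).1 = _
      rw [hUφ]
      exact linearPart_apply _ _⟩
  · obtain ⟨φ, hφ, hUφ⟩ := hρ γ
    refine det_eq_one_of_isometry (B := innerSL ℝ) (A := linearPart (n + 1) (ρ γ))
      (fun x hx => inner_self_eq_zero.mp (hx x))
      (fun x y => (ρ γ).linearIsometryEquiv.inner_map_map x y)
      (hU.det_pos hn hH' hι hB x₀ hM hφ.1 (zero_smul ℝ _) hUφ)

end Immersion

end OneQC

end

theorem mainTheorem3 (n : ℕ) (hn : 3 ≤ n)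
    {M : Type*} [TopologicalSpace M] [T2Space M] [SecondCountableTopology M] [ConnectedSpace M]
    [ChartedSpace (EuclideanSpace ℝ (Fin n)) M] [IsManifold (𝓡 n) ∞ M]
    (g : OneQC.SmoothMetric n M) (hg : OneQC.IsOneQC g)
    (h3 : n = 3 → OneQC.IsConformallyFlat g)
    {Mt : Type*} [TopologicalSpace Mt] [SimplyConnectedSpace Mt]
    [ChartedSpace (EuclideanSpace ℝ (Fin n)) Mt] [IsManifold (𝓡 n) ∞ Mt]
    (π : C(Mt, M)) (hπ : IsCoveringMap π) (hπ' : IsLocalDiffeomorph (𝓡 n) (𝓡 n) ∞ π)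
    (x₀ : Mt) :
    ∃ H N : M → ℝ, OneQC.AreCurvatureFunctions g H N ∧
      (CompactSpace M ∨ BddBelow (Set.range H) →
        -- the case `κ = 1 - inf H > 0`: hyperbolic space
        ((⨅ p, H p) ≤ 0 → ∀ κ : ℝ, κ = 1 - (⨅ p, H p) →
          ∃ (f ν : Mt → OneQC.Minkowski (n + 1))
            (ρ : FundamentalGroup M (π x₀) →* OneQC.lorentzGroup (n + 1)),
            (∀ x, f x ∈ OneQC.hyperbolicSpace κ (n + 1)) ∧
            OneQC.IsIsometricImmersion g π OneQC.lorentz f ∧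
            (∀ γ, ∃ φ : Mt ≃ₜ Mt, OneQC.IsDeckTransformationOf π x₀ γ φ ∧
              ∀ x, f (φ x) = (ρ γ : OneQC.Minkowski (n + 1) ≃ₗ[ℝ] OneQC.Minkowski (n + 1)) (f x)) ∧
            (OneQC.IsOrientable n M → ∀ γ,
              LinearMap.det ((ρ γ : OneQC.Minkowski (n + 1) ≃ₗ[ℝ] OneQC.Minkowski (n + 1)) :
                OneQC.Minkowski (n + 1) →ₗ[ℝ] OneQC.Minkowski (n + 1)) = 1) ∧
            OneQC.IsUnitNormal n OneQC.lorentz f ν ∧ (∀ x, OneQC.lorentz (ν x) (f x) = 0) ∧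
            OneQC.HasOneQCForm g π H N κ (OneQC.secondFundamentalForm OneQC.lorentz f ν)) ∧
        -- the case `κ = 0`: Euclidean space
        (0 < (⨅ p, H p) →
          ∃ (f ν : Mt → EuclideanSpace ℝ (Fin (n + 1)))
            (ρ : FundamentalGroup M (π x₀) →*
              (EuclideanSpace ℝ (Fin (n + 1)) ≃ᵃⁱ[ℝ] EuclideanSpace ℝ (Fin (n + 1)))),
            OneQC.IsIsometricImmersion g π OneQC.euclid f ∧
            (∀ γ, ∃ φ : Mt ≃ₜ Mt, OneQC.IsDeckTransformationOf π x₀ γ φ ∧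
              ∀ x, f (φ x) = ρ γ (f x)) ∧
            (OneQC.IsOrientable n M → ∀ γ,
              LinearMap.det (((ρ γ).linearIsometryEquiv.toLinearEquiv :
                EuclideanSpace ℝ (Fin (n + 1)) ≃ₗ[ℝ] EuclideanSpace ℝ (Fin (n + 1))) :
                EuclideanSpace ℝ (Fin (n + 1)) →ₗ[ℝ] EuclideanSpace ℝ (Fin (n + 1))) = 1) ∧
            OneQC.IsUnitNormal n OneQC.euclid f ν ∧
            OneQC.HasOneQCForm g π H N 0 (OneQC.secondFundamentalForm OneQC.euclid f ν))) := by
  obtain ⟨H, N, ξ, h⟩ := OneQC.IsOneQC.exists_isQCField hg hn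
  have hQ : ∀ p, ∃ e Γ, p ∈ e.source ∧ OneQC.IsQCChart g H N ξ e Γ :=
    h.exists_isQCChart hn h3
  have hbelow : (CompactSpace M ∨ BddBelow (Set.range H)) → ∀ p, (⨅ p, H p) ≤ H p := by
    rintro (hM | hbdd) p
    · exact ciInf_le (isCompact_range (OneQC.continuous_of_isQCChart hn hQ)).bddBelow p
    · exact ciInf_le hbdd p
  refine ⟨H, N, h.areCurvatureFunctions hn, fun hbdd => ⟨fun hinf κ hκ => ?_, fun hinf => ?_⟩⟩
  · exact OneQC.exists_hyperbolic_immersion hn (fun p => by linarith [hbelow hbdd p])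
      (by linarith) h hQ hπ hπ' x₀
  · exact OneQC.exists_euclidean_immersion hn (fun p => hinf.trans_le (hbelow hbdd p))
      h hQ hπ hπ' x₀
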